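/- Let $G=(V,E)$ be an undirected graph with $n\ge 1$ nodes and $m$ edges, and let $h\ge 1$. For a node $v$ of a graph, $N(v;i)$ is the set of nodes reachable from $v$ by a path with at most $i$ edges ($v$ included). The $(k,h)$-core of $G$ is the maximal subgraph $H$ such that $|N(v;h)|-1\ge k$ for every node $v$ of $H$, with $N(v;h)$ taken in $H$; the core number $c(v)$ is the largest $k$ such that $v$ is in the $(k,h)$-core. A map $c':V\to[0,\infty)$ is an $\epsilon$-approximate $(k,h)$-core map if $|c'(v)-c(v)|\le\epsilon\, c(v)$ for all $v\in V$. The algorithm Core, with parameters $\epsilon$ and $C$, puts $M=1+\frac{4(2+\epsilon)}{\epsilon^2}(C+\log 8)$ and gives the nodes independent random ranks $r[v]\in\{0,1,\dots\}$ with $P(r[v]\ge k)=2^{-k}$. For all $v$ and $i\le h$ it maintains, in the graph of the nodes not yet deleted, the smallest $k[v,i]\ge 0$ such that $B[v,i]=\{u\in N(v;i): r[u]\ge k[v,i]\}$ has at most $M$ elements, and the estimate $d[v]$, which with $k=k[v,h]$ is $|B[v,h]\setminus\{v\}|\,2^{k}$ if $k=0$, and $\max(|B[v,h]\setminus\{v\}|\,2^{k},\,M2^{k-1})$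 if $k>0$. Until the graph is empty, it deletes a node $u$ with the smallest $d[u]$ (ties: smallest $k[u,h]$) and outputs as $c'(u)$ the largest of the values $d[w]$ of the nodes $w$ deleted so far, each taken at the time of its deletion. The sets $B[v,i]$ are stored as sorted linked lists in which each $u$ carries the number of neighbours $w$ of $v$ with $u\in B[w,i-1]$; when a node is deleted these counters are decreased level by level, and $B[v,i]$ is recomputed, by merging the lists $B[w,i-1]$, only if no neighbour $w$ has $k[w,i-1]=k[v,i]$ and the stored elements of $B[v,i]$ together with the stored list $D[v,i]$ of elements of rank $k[v,i]-1$ number at most $M$; the next node to delete is found with a bucket queue. Running time is the number of elementary steps on a unit-cost random access machine. Let $0<\epsilon\le 1/2$, $\delta>0$ and $C=\log(2n/\delta)$. Then, with probability at least $1-\delta$, Core outputs an $\epsilon$-approximate $(k,h)$-core map and, if $n\le 2m$ (for example, if $G$ has no isolated nodes), its running time is at most $$K\,\frac{h\,m\,\log(n/\delta)}{\epsilon^{2}}\;\max\Bigl(1,\ \log\frac{n\epsilon^{2}}{\log(n/\delta)}\Bigr),$$ where $K$ is an absolute constant. Moreover, for every $a>0$, this bound is in $O(\epsilon^{-2}hm(\log^2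 n-\log\delta))$ for $n^{-a}\le\delta\le 1$ and $0<\epsilon\le1/2$, with a constant that depends only on $a$; in particular for every fixed $\delta\in(0,1)$ and $n\ge 2$. -/

import Mathlib

namespace KHCore

/-! ## Distance-generalized cores -/

/-- The `h`-neighbourhood `N(v; h)`: all nodes reachable from `v` by a path with at most `h`
edges.  It contains `v` itself. -/
def nbhd {V : Type*} (G : SimpleGraph V) (v : V) (h : ℕ) : Set V :=
  {u | ∃ p : G.Walk v u, p.length ≤ h}

/-- `H` is the `(k, h)`-core of `G`: the maximal subgraph in which every node `u` satisfies
`|N(u; h)| - 1 ≥ k`, the neighbourhood being taken inside the subgraph. -/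
def IsCore {V : Type*} (G : SimpleGraph V) (h k : ℕ) (H : G.Subgraph) : Prop :=
  IsGreatest {H' : G.Subgraph | ∀ u : H'.verts, k + 1 ≤ (nbhd H'.coe u h).ncard} H

/-- The core number `c(v)`: the largest `k` such that `v` lies in the `(k, h)`-core. -/
noncomputable def coreNumber {V : Type*} (G : SimpleGraph V) (h : ℕ) (v : V) : ℕ :=
  sSup {k | ∃ H : G.Subgraph, IsCore G h k H ∧ v ∈ H.verts}

/-- `c'` approximates the core map of `G` within the relative error `ε`. -/
def IsApproxCoreMap {V : Type*} (G : SimpleGraph V) (h : ℕ) (ε : ℝ) (c' : V → ℝ) : Prop :=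
  ∀ v, |c' v - (coreNumber G h v : ℝ)| ≤ ε * (coreNumber G h v : ℝ)

/-! ## Step counting

A program is written in the monad `Timed`, which counts elementary steps.  One step is a constant
number of operations of a random access machine with unit cost arithmetic: reading or writing a
memory cell, following a pointer, unlinking a cell of a doubly linked list, putting a cell in front
of such a list, reading the stored length of a list, comparing or computing numbers.
All iteration is explicit and every iteration is charged. -/

/-- A result together with the number of elementary steps that were used to obtain it. -/
structure Timed (α : Type) where
  val : α
  steps : ℕ

instance : Monad Timed where
  pure a := ⟨a, 0⟩
  bind x f := ⟨(f x.val).val, x.steps + (f x.val).steps⟩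

/-- Spend one elementary step. -/
def tick : Timed Unit := ⟨(), 1⟩

/-- Loop over a list with a loop state; each iteration costs one step and the cost of its body. -/
def forEach {α σ : Type} (body : α → σ → Timed σ) : List α → σ → Timed σ
  | [], s => pure s
  | a :: L, s => do
    tick
    let s' ← body a s
    forEach body L s'

/-- A loop whose body has no effect on the modelled data: its cost is the length of the list.  It
charges for allocating, initialising or relinking one memory cell per element. -/
def touch {α : Type} (L : List α) : Timed Unit :=
  forEach (fun _ _ => pure ()) L ()

/-- Traverse a list and copy the images of the elements on which `f` is defined. -/
def scan {α β : Type} (f : α → Option β) : List α → Timed (List β)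
  | [] => pure []
  | a :: L => do
    tick
    let L' ← scan f L
    pure (match f a with
      | some b => b :: L'
      | none => L')

/-! ## The data of the algorithm

The nodes are `0, …, n - 1` and `r` is the vector of ranks.  An entry `(u, z)` of a buffer consists
of a node `u` and a counter `z`. -/

/-- An entry of a buffer: a node with its counter. -/
abbrev Entry (n : ℕ) : Type := Fin n × ℕ

/-- The memory of the algorithm. -/
structure Store (n : ℕ) where
  /-- `A(v)`, the current adjacency lists -/
  adj : Fin n → List (Fin n)
  /-- `B[v, i]`, sorted by decreasing rank (ties by node number); the counter of `u` is the number
  of neighbours `w` of `v` with `u` in `B[w, i - 1]`, plus one if `u = v` -/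
  buf : Fin n → ℕ → List (Entry n)
  /-- `k[v, i]` -/
  lvl : Fin n → ℕ → ℕ
  /-- `D[v, i]`, the nodes of rank `k[v, i] - 1`, with counters as in `B[v, i]`, unsorted -/
  dep : Fin n → ℕ → List (Entry n)
  /-- `m[v, i]`, the number of neighbours `w` of `v` with `k[w, i - 1] = k[v, i]` -/
  ties : Fin n → ℕ → ℕ
  /-- `d[v]`, the current estimate -/
  est : Fin n → ℝ
  /-- the priority queue: an array of doubly linked lists of nodes -/
  bucket : ℕ → List (Fin n)
  /-- the number of the bucket that contains `v` -/
  key : Fin n → ℕ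
  /-- all buckets below this one are empty -/
  ptr : ℕ
  /-- the number of allocated buckets -/
  top : ℕ

/-- Write `x` into the cell `(v, i)` of a two-dimensional array. -/
def write {n : ℕ} {α : Type} (f : Fin n → ℕ → α) (v : Fin n) (i : ℕ) (x : α) : Fin n → ℕ → α :=
  fun v' i' => if v' = v ∧ i' = i then x else f v' i'

/-- The order in which buffers are sorted: decreasing rank, ties by node number. -/
def before {n : ℕ} (r : Fin n → ℕ) (a b : Fin n) : Prop :=
  r b < r a ∨ (r a = r b ∧ a < b)

instance {n : ℕ} (r : Fin n → ℕ) (a b : Fin n) : Decidable (before r a b) := by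
  unfold before; infer_instance

/-- `MergeSort(X, Y)`: merge two sorted lists and add up the counters of common nodes. -/
def mergeSort {n : ℕ} (r : Fin n → ℕ) : List (Entry n) → List (Entry n) → Timed (List (Entry n))
  | [], Y => do
    tick
    pure Y
  | x :: X, [] => do
    tick
    pure (x :: X)
  | x :: X, y :: Y => do
    tick
    if x.1 = y.1 then
      let T ← mergeSort r X Y
      pure ((x.1, x.2 + y.2) :: T)
    else if before r x.1 y.1 then
      let T ← mergeSort r X (y :: Y)
      pure (x :: T)
    else
      let T ← mergeSort r (x :: X) Y
      pure (y :: T)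
  termination_by X Y => X.length + Y.length

/-- Increase the counter of `u` in an unsorted list, appending `u` if it is not present.  This is one
step, since an array over the nodes tells where the entry of `u` is. -/
def increase {n : ℕ} (u : Fin n) : List (Entry n) → List (Entry n)
  | [] => [(u, 1)]
  | e :: L => if e.1 = u then (u, e.2 + 1) :: L else e :: increase u L

/-- Decrease the counter of `u`, if `u` is present, and remove `u` when its counter reaches `0`.
This is one step, since a pointer (null if `u` is not present) to the entry of `u` is at hand. -/
def decrease {n : ℕ} (u : Fin n) : List (Entry n) → List (Entry n)
  | [] => []
  | e :: L => if e.1 = u then (if e.2 ≤ 1 then L else (u, e.2 - 1) :: L) else e :: decrease u L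

/-- If a sorted list `T` has more than `M` entries, raise the threshold `k` to
`r[t] + 1`, where `t` is the entry number `⌊M⌋ + 1` of `T`, and drop the entries of smaller rank. -/
noncomputable def trim {n : ℕ} (r : Fin n → ℕ) (M : ℝ) (T : List (Entry n)) (k : ℕ) :
    Timed (List (Entry n) × ℕ) := do
  tick
  if M < (T.length : ℝ) then
    let _ ← touch T
    let k' := match T[⌊M⌋₊]? with
      | some t => max k (r t.1 + 1)
      | none => k
    let T' ← scan (fun e => if k' ≤ r e.1 then some e else none) T
    pure (T', k')
  else
    pure (T, k)

/-- `Union`: the nodes of rank `k - 1` in the sets `B[w, j]`, `w ∈ A(v)`, and in `{v}`, with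
their multiplicities. -/
def union {n : ℕ} (r : Fin n → ℕ) (s : Store n) (v : Fin n) (j k : ℕ) :
    Timed (List (Entry n)) := do
  let D ← forEach (fun w D => do
      let X ← scan (fun e => if r e.1 + 1 = k then some e.1 else none) (s.buf w j)
      forEach (fun u D => pure (increase u D)) X D)
    (s.adj v) (if r v + 1 = k then [(v, 1)] else [])
  let _ ← touch D
  pure D

/-- `Compute(v, j + 1)`: recompute `B`, `k`, `m` and `D` at `(v, j + 1)` from level `j`. -/
noncomputable def compute {n : ℕ} (r : Fin n → ℕ) (M : ℝ) (v : Fin n) (j : ℕ) (s : Store n) :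
    Timed (Store n) := do
  tick
  let k₀ ← forEach (fun w k => pure (max k (s.lvl w j))) (s.adj v) 0
  let Tk ← forEach (fun w Tk => do
      let X ← scan (fun e => if Tk.2 ≤ r e.1 then some (e.1, 1) else none) (s.buf w j)
      let T ← mergeSort r Tk.1 X
      trim r M T Tk.2)
    (s.adj v) ((if k₀ ≤ r v then [(v, 1)] else []), k₀)
  let m ← forEach (fun w m => pure (if s.lvl w j = Tk.2 then m + 1 else m)) (s.adj v) 0
  let D ← if m = 0 then union r s v j Tk.2 else pure []
  -- the entries of each `B[w, j]` get their pointers to the new `B` and `D` at `(v, j + 1)`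
  let _ ← forEach (fun w _ => touch (s.buf w j)) (s.adj v) ()
  -- each entry of the new `B` gets an array of `deg v` pointers to the next level
  let _ ← forEach (fun _ _ => touch (s.adj v)) Tk.1 ()
  pure { s with
    buf := write s.buf v (j + 1) Tk.1
    lvl := write s.lvl v (j + 1) Tk.2
    ties := write s.ties v (j + 1) m
    dep := write s.dep v (j + 1) D }

/-- `Estimate`, for a sample of `b` nodes other than `v` at the threshold `k`. -/
noncomputable def estimate (M : ℝ) (b k : ℕ) : ℝ :=
  if 0 < k then max ((b : ℝ) * 2 ^ k) (M * 2 ^ (k - 1)) else (b : ℝ) * 2 ^ k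

/-- The bucket of a node with `b` sampled nodes and threshold `k`. -/
noncomputable def bucketIndex (M : ℝ) (b k : ℕ) : ℕ := k * (⌊M⌋₊ + 1) + b

/-- The order of the buckets is compatible with the order of the estimates, with smaller thresholds
preferred among equal estimates: a node of the first non-empty bucket is a valid minimizer. -/
theorem estimate_le_of_bucketIndex_le {M : ℝ} (hM : 0 ≤ M) {b k b' k' : ℕ}
    (hb : b ≤ ⌊M⌋₊) (hb' : b' ≤ ⌊M⌋₊) (hle : bucketIndex M b k ≤ bucketIndex M b' k') :
    k ≤ k' ∧ estimate M b k ≤ estimate M b' k' := by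
  have hk : k ≤ k' := by
    by_contra hlt
    have h1 : k' + 1 ≤ k := by omega
    have h2 := Nat.mul_le_mul_right (⌊M⌋₊ + 1) h1
    unfold bucketIndex at hle
    nlinarith
  refine ⟨hk, ?_⟩
  have hbM : (b : ℝ) ≤ M := le_trans (by exact_mod_cast hb) (Nat.floor_le hM)
  rcases hk.eq_or_lt with rfl | hlt
  · have hbb : (b : ℝ) ≤ b' := by
      unfold bucketIndex at hle
      exact_mod_cast (by omega : b ≤ b')
    unfold estimate
    split_ifs
    · gcongr
    · gcongr
  · have hk' : 0 < k' := by omega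
    have hpow : (2 : ℝ) ^ k ≤ 2 ^ (k' - 1) := pow_le_pow_right₀ (by norm_num) (by omega)
    have h1 : (b : ℝ) * 2 ^ k ≤ M * 2 ^ (k' - 1) := by gcongr
    have h2 : M * 2 ^ (k - 1) ≤ M * 2 ^ (k' - 1) := by
      gcongr
      norm_num
    unfold estimate
    rw [if_pos hk']
    split_ifs
    · exact le_trans (max_le h1 h2) (le_max_right _ _)
    · exact le_trans h1 (le_max_right _ _)

/-- Recompute the estimate `d[v]` from `B[v, h] \ {v}` and `k[v, h]`, and move `v` to the
corresponding bucket (new buckets are allocated if necessary). -/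
noncomputable def requeue {n : ℕ} (M : ℝ) (h : ℕ) (v : Fin n) (s : Store n) :
    Timed (Store n) := do
  tick
  let b := (((s.buf v h).map Prod.fst).erase v).length
  let k := s.lvl v h
  let p := bucketIndex M b k
  let _ ← touch (List.range (p + 1 - s.top))
  let bucket' := Function.update s.bucket (s.key v) ((s.bucket (s.key v)).erase v)
  pure { s with
    est := Function.update s.est v (estimate M b k)
    bucket := Function.update bucket' p (v :: bucket' p)
    key := Function.update s.key v p
    ptr := min s.ptr p
    top := max s.top (p + 1) }

/-! ## Deleting a node -/

/-- A stack of pairs `(v, Y)`, where `Y` are nodes that were removed from a buffer of `v`. -/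
abbrev Stack (n : ℕ) : Type := List (Fin n × List (Fin n))

/-- A neighbour of `w` has lost the nodes `Y` at level `j`, and, if `old = some k`, it no longer has
threshold `k` at level `j`: update the counters of `w` at level `j + 1` (`Delete`), and push `w` with
the nodes `Z` which thereby leave `B[w, j + 1]`. -/
def notify {n : ℕ} (j : ℕ) (Y : List (Fin n)) (old : Option ℕ) (w : Fin n)
    (sW : Store n × Stack n) : Timed (Store n × Stack n) := do
  tick
  let s := sW.1
  let BDZ ← forEach (fun y (BDZ : List (Entry n) × List (Entry n) × List (Fin n)) =>
      pure (decrease y BDZ.1, decrease y BDZ.2.1,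
        if (y, 1) ∈ BDZ.1 then y :: BDZ.2.2 else BDZ.2.2))
    Y (s.buf w (j + 1), s.dep w (j + 1), [])
  let m := s.ties w (j + 1)
  pure ({ s with
      buf := write s.buf w (j + 1) BDZ.1
      dep := write s.dep w (j + 1) BDZ.2.1
      ties := write s.ties w (j + 1) (if old = some (s.lvl w (j + 1)) then m - 1 else m) },
    (w, BDZ.2.2) :: sW.2)

/-- Process an entry `(v, Y)` popped from the stack at level `j + 1`, where `Y` has been removed from
`B[v, j + 1]`: call `Compute` if required, and pass the changes on to level `j + 2`. -/
noncomputable def process {n : ℕ} (r : Fin n → ℕ) (M : ℝ) (h j : ℕ) (vY : Fin n × List (Fin n))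
    (sW : Store n × Stack n) : Timed (Store n × Stack n) := do
  tick
  let v := vY.1
  let Y := vY.2
  let k := sW.1.lvl v (j + 1)
  let s ←
    if ((sW.1.buf v (j + 1)).length + (sW.1.dep v (j + 1)).length : ℝ) ≤ M
        ∧ sW.1.ties v (j + 1) = 0 then
      compute r M v j sW.1
    else pure sW.1
  let s ← if j + 1 = h then requeue M h v s else pure s
  if j + 1 < h ∧ (Y ≠ [] ∨ s.lvl v (j + 1) ≠ k) then
    forEach (notify (j + 1) Y (if s.lvl v (j + 1) ≠ k then some k else none)) (s.adj v) (s, sW.2)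
  else
    pure (s, sW.2)

/-- `Update(u)`: delete `u` from the graph and update the affected data level by level. -/
noncomputable def update {n : ℕ} (r : Fin n → ℕ) (M : ℝ) (h : ℕ) (u : Fin n) (s : Store n) :
    Timed (Store n) := do
  tick
  let A := s.adj u
  let s ← forEach
    (fun w s => pure { s with adj := Function.update s.adj w ((s.adj w).erase u) }) A s
  let s := { s with adj := Function.update s.adj u [] }
  let sU ← forEach (fun j (sU : Store n × Stack n) => do
      let Y ← scan (fun e => some e.1) (sU.1.buf u j)
      let sU ← forEach (notify j Y (some (sU.1.lvl u j))) A sU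
      let s := { sU.1 with buf := write sU.1.buf u j [] }
      forEach (process r M h j) sU.2 (s, []))
    (List.range h) (s, [])
  pure sU.1

/-! ## The main algorithm -/

/-- Move from bucket `p` to the first non-empty bucket, with at most `f` buckets to go. -/
def seek {n : ℕ} (bucket : ℕ → List (Fin n)) : ℕ → ℕ → Timed ℕ
  | 0, p => pure p
  | f + 1, p => do
    tick
    if bucket p = [] then seek bucket f (p + 1) else pure p

/-- The state of the main loop: the memory, the running maximum `c`, and the core numbers that have
been output so far. -/
structure MainState (n : ℕ) where
  store : Store n
  c : ℝ
  out : Fin n → ℝ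

/-- One iteration of the main loop: take a node `u` with the smallest estimate, output its core
number, and delete it. -/
noncomputable def mainStep {n : ℕ} (r : Fin n → ℕ) (M : ℝ) (h : ℕ) (t : MainState n) :
    Timed (MainState n) := do
  tick
  let p ← seek t.store.bucket (t.store.top - t.store.ptr) t.store.ptr
  match t.store.bucket p with
  | [] => pure t
  | u :: rest =>
    let c := max t.c (t.store.est u)
    let s ← update r M h u
      { t.store with bucket := Function.update t.store.bucket p rest, ptr := p }
    pure { store := s, c := c, out := Function.update t.out u c }

/-- The memory before the start: only the graph is present. -/
def initialStore {n : ℕ} (G : SimpleGraph (Fin n)) [DecidableRel G.Adj] : Store n where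
  adj v := (List.finRange n).filter (fun w => G.Adj v w)
  buf _ _ := []
  lvl _ _ := 0
  dep _ _ := []
  ties _ _ := 0
  est _ := 0
  bucket _ := []
  key _ := 0
  ptr := 0
  top := 0

/-- The algorithm with the buffer bound `M`, for given outcomes `r` of the random ranks.
Sampling the rank of `v` costs `r v + 1` steps, one for each coin flip. -/
noncomputable def run {n : ℕ} (G : SimpleGraph (Fin n)) [DecidableRel G.Adj] (h : ℕ) (M : ℝ)
    (r : Fin n → ℕ) : Timed (Fin n → ℝ) := do
  tick
  let nodes := List.finRange n
  let s ← forEach (fun v (s : Store n) => do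
      let _ ← touch (List.range (r v + 1))
      -- the only entry of `B[v, 0]` gets an array of `deg v` pointers to the next level
      let _ ← touch (s.adj v)
      pure { s with buf := write s.buf v 0 [(v, 1)], lvl := write s.lvl v 0 0 })
    nodes (initialStore G)
  let s ← forEach (fun j s => forEach (fun v s => compute r M v j s) nodes s) (List.range h) s
  let s ← forEach (fun v s => requeue M h v s) nodes s
  let t ← forEach (fun _ t => mainStep r M h t) nodes { store := s, c := 0, out := fun _ => 0 }
  pure t.out

/-- The buffer bound `M`. -/
noncomputable def bufferBound (ε C : ℝ) : ℝ :=
  1 + 4 * (2 + ε) / ε ^ 2 * (C + Real.log 8)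

/-- `Core(G, ε, C)` with path length `h`: its output and its number of steps, for given outcomes `r`
of the random ranks. -/
noncomputable def core {n : ℕ} (G : SimpleGraph (Fin n)) [DecidableRel G.Adj] (h : ℕ) (ε C : ℝ)
    (r : Fin n → ℕ) : Timed (Fin n → ℝ) :=
  run G h (bufferBound ε C) r

/-- The law of the ranks: independent geometric variables on `0, 1, 2, …` with parameter `1/2`,
so that a rank is at least `k` with probability `2⁻ᵏ`. -/
noncomputable def rankLaw (n : ℕ) : MeasureTheory.Measure (Fin n → ℕ) :=
  MeasureTheory.Measure.pi fun _ =>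
    ProbabilityTheory.geometricMeasure ⟨1 / 2, by norm_num, by norm_num⟩

/-- `h m ε⁻² log(n/δ) · log(n ε² / log(n/δ))`, where the second logarithm is replaced by `1` if it is
smaller than `1`. -/
noncomputable def timeBound (n m h : ℕ) (ε δ : ℝ) : ℝ :=
  h * m * Real.log (n / δ) / ε ^ 2 * max 1 (Real.log (n * ε ^ 2 / Real.log (n / δ)))

end KHCore

namespace KHCore

/-! ## Timed programs -/

/-! Correctness. Fix the ranks. The estimate that the data structure holds for `v` when the node set
`S` remains depends only on `S`, not on the history (`Levels.eq_threshold`, `Fresh.est_eq`), and it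
is monotone in `S` (`sizeEstimate_mono`, `ball_mono`). For any monotone function `d`, repeatedly
removing a minimizer and recording the running maximum gives `v` the value max over `S ∋ v` of min
over `u ∈ S` of `d S u`; `Separates` expresses this and `Peeled.step` carries it through the loop.
The core number is the same max-min for the exact size of the ball minus one. To compare the two,
accuracy on all subsets is not needed: by `exists_approx_of_accurate` two sets per node suffice, the
core of order `c(u)` for the lower bound and the set from which an exact peeling removes `u` for the
upper bound. These sets do not depend on the ranks, although the deletion order of the algorithm
does, so Chernoff bounds (`accurate_prob`, `sizeEstimate_accurate`) and a union bound apply.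

Running time. Let `N = ⌊M⌋`. During a deletion, neighbours of a node still count on elements that
have already left its buffer but wait on a stack; the invariant `Levels` is therefore stated for the
visible lists `vis`. The cost is amortized. Recomputing a buffer of `v` costs `O(deg v · N)` and, by
`Node.recompute`, lowers a potential which starts at `2k + 1` and never is below `2k`, where `k` is
the current threshold: either `k` drops, or the list `D` becomes valid, after which it detects
exactly when `k` may drop. The only exception is a node without neighbours, where the cost is
constant. An element that leaves a buffer of `v` costs `O(deg v)` for informing the neighbours and
is paid for by the length of the buffer. Queue keys only fall, and they pay for the retreats of the
pointer. `process_spec`, `update_spec` and `mainLoop_spec` add this up.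

The result is `run_spec`: apart from the coin flips, `O(h (n + m) N (k + 1))` steps, where `k` is
any threshold at which at most `N` of all nodes are sampled. Accuracy for the full node set allows
`k = 0` or `2 ^ k * M ≤ 4 n` (`exists_threshold`), whence the second logarithm. In `core_spec` the
failure probability is split into four parts of at most `δ / 4`. -/

@[simp] theorem bind_val {α β : Type} (x : Timed α) (f : α → Timed β) :
    (x >>= f).val = (f x.val).val := rfl

@[simp] theorem bind_steps {α β : Type} (x : Timed α) (f : α → Timed β) :
    (x >>= f).steps = x.steps + (f x.val).steps := rfl

@[simp] theorem pure_val {α : Type} (a : α) : (pure a : Timed α).val = a := rfl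

@[simp] theorem pure_steps {α : Type} (a : α) : (pure a : Timed α).steps = 0 := rfl

@[simp] theorem tick_steps : tick.steps = 1 := rfl

@[simp] theorem forEach_nil {α σ : Type} (body : α → σ → Timed σ) (s : σ) :
    forEach body [] s = pure s := rfl

@[simp] theorem forEach_cons_val {α σ : Type} (body : α → σ → Timed σ) (a : α) (L : List α)
    (s : σ) : (forEach body (a :: L) s).val = (forEach body L (body a s).val).val := rfl

@[simp] theorem forEach_cons_steps {α σ : Type} (body : α → σ → Timed σ) (a : α) (L : List α)
    (s : σ) : (forEach body (a :: L) s).steps =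
      1 + ((body a s).steps + (forEach body L (body a s).val).steps) := rfl

/-- The invariant rule for loops; the invariant may refer to the elements to come and to the
number of steps so far. -/
theorem forEach_rule {α σ : Type} {body : α → σ → Timed σ} (I : List α → σ → ℕ → Prop)
    (step : ∀ a L s t, I (a :: L) s t → I L (body a s).val (t + 1 + (body a s).steps))
    (L : List α) (s : σ) (t : ℕ) (h0 : I L s t) :
    I [] (forEach body L s).val (t + (forEach body L s).steps) := by
  induction L generalizing s t with
  | nil => simpa using h0
  | cons a L ih =>
    have := ih _ _ (step a L s t h0)
    simp only [forEach_cons_val, forEach_cons_steps]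
    convert this using 1
    omega

theorem forEach_steps_le {α σ : Type} {body : α → σ → Timed σ} {L : List α} {b : ℕ}
    (hb : ∀ a ∈ L, ∀ s, (body a s).steps ≤ b) (s : σ) :
    (forEach body L s).steps ≤ L.length * (b + 1) := by
  induction L generalizing s with
  | nil => simp
  | cons a L ih =>
    have h1 := hb a (by simp) s
    have h2 := ih (fun x hx => hb x (by simp [hx])) (body a s).val
    simp only [forEach_cons_steps, List.length_cons]
    nlinarith

@[simp] theorem forEach_pure_val {α σ : Type} (f : α → σ → σ) (L : List α) (s : σ) :
    (forEach (fun a s => pure (f a s)) L s).val = L.foldl (fun s a => f a s) s := by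
  induction L generalizing s with
  | nil => rfl
  | cons a L ih => simp [ih]

@[simp] theorem forEach_pure_steps {α σ : Type} (f : α → σ → σ) (L : List α) (s : σ) :
    (forEach (fun a s => pure (f a s)) L s).steps = L.length := by
  induction L generalizing s with
  | nil => rfl
  | cons a L ih => simp [ih]; omega

@[simp] theorem touch_steps {α : Type} (L : List α) : (touch L).steps = L.length :=
  forEach_pure_steps (fun _ _ => ()) L ()

@[simp] theorem scan_val {α β : Type} (f : α → Option β) (L : List α) :
    (scan f L).val = L.filterMap f := by
  induction L with
  | nil => rfl
  | cons a L ih =>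
    rw [scan]
    simp only [bind_val, pure_val, ih, List.filterMap_cons]
    cases f a <;> rfl

@[simp] theorem scan_steps {α β : Type} (f : α → Option β) (L : List α) :
    (scan f L).steps = L.length := by
  induction L with
  | nil => rfl
  | cons a L ih =>
    rw [scan]
    simp only [bind_steps, pure_steps, ih, List.length_cons, tick_steps]
    omega

/-! ## Buffers -/

variable {n : ℕ}

/-- The nodes of a buffer. -/
def keys (L : List (Entry n)) : List (Fin n) := L.map Prod.fst

/-- The total counter of a node in a buffer. -/
def counter (L : List (Entry n)) (x : Fin n) : ℕ :=
  (L.map fun e => if e.1 = x then e.2 else 0).sum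

@[simp] theorem keys_nil : keys ([] : List (Entry n)) = [] := rfl
@[simp] theorem keys_cons (e : Entry n) (L : List (Entry n)) : keys (e :: L) = e.1 :: keys L := rfl
@[simp] theorem keys_length (L : List (Entry n)) : (keys L).length = L.length := by simp [keys]
@[simp] theorem counter_nil (x : Fin n) : counter [] x = 0 := rfl
@[simp] theorem counter_cons (e : Entry n) (L : List (Entry n)) (x : Fin n) :
    counter (e :: L) x = (if e.1 = x then e.2 else 0) + counter L x := rfl

theorem counter_eq_zero {L : List (Entry n)} {x : Fin n} (h : x ∉ keys L) : counter L x = 0 := by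
  induction L with
  | nil => rfl
  | cons e L ih =>
    simp only [keys_cons, List.mem_cons, not_or] at h
    simp [ih h.2, Ne.symm h.1]

/-- The buffer `L` has distinct nodes with positive counters, which are given by `f`. -/
structure Lists (L : List (Entry n)) (f : Fin n → ℕ) : Prop where
  nodup : (keys L).Nodup
  pos : ∀ e ∈ L, 0 < e.2
  counter_eq : ∀ x, counter L x = f x

/-- Positivity excludes entries with counter `0`, which `counter` could not distinguish from absent
nodes. -/
theorem mem_keys_iff_counter {L : List (Entry n)} (hp : ∀ e ∈ L, 0 < e.2) (x : Fin n) :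
    x ∈ keys L ↔ 0 < counter L x := by
  induction L with
  | nil => simp
  | cons e L ih =>
    have h1 := hp e (by simp)
    have h2 := ih fun e' he' => hp e' (by simp [he'])
    by_cases he : e.1 = x
    · simp [he]; omega
    · simp [he, h2, Ne.symm he]

theorem Lists.mem_keys {L : List (Entry n)} {f : Fin n → ℕ} (h : Lists L f) {x : Fin n} :
    x ∈ keys L ↔ 0 < f x := by
  rw [mem_keys_iff_counter h.pos, h.counter_eq]

/-- This turns the stored lengths, which the algorithm tests, into cardinalities of sets of nodes.
-/
theorem Lists.length_eq {L : List (Entry n)} {f : Fin n → ℕ} (h : Lists L f) :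
    L.length = (Finset.univ.filter fun x => 0 < f x).card := by
  rw [← keys_length, ← List.toFinset_card_of_nodup h.nodup]
  congr 1
  ext x
  simp [h.mem_keys]

theorem Lists.congr {L : List (Entry n)} {f g : Fin n → ℕ} (h : Lists L f) (hfg : ∀ x, f x = g x) :
    Lists L g := ⟨h.nodup, h.pos, fun x => (h.counter_eq x).trans (hfg x)⟩

theorem before_trans {r : Fin n → ℕ} {a b c : Fin n} (h1 : before r a b) (h2 : before r b c) :
    before r a c := by
  unfold before at *
  omega

theorem before_irrefl {r : Fin n → ℕ} {a : Fin n} : ¬ before r a a := by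
  unfold before
  omega

theorem before_of_not {r : Fin n → ℕ} {a b : Fin n} (h1 : a ≠ b) (h2 : ¬ before r a b) :
    before r b a := by
  unfold before at *
  omega

theorem nodup_of_before {r : Fin n → ℕ} {L : List (Fin n)} (h : L.Pairwise (before r)) :
    L.Nodup := h.imp fun {a b} hab => by
  rintro rfl
  exact before_irrefl hab

/-! ### Merging -/

theorem mergeSort_counter (r : Fin n → ℕ) (X Y : List (Entry n)) (x : Fin n) :
    counter (mergeSort r X Y).val x = counter X x + counter Y x := by
  fun_induction mergeSort r X Y with
  | case1 Y => simp
  | case2 a X => simp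
  | case3 a X b Y ih1 ih2 ih3 =>
    simp only [bind_val]
    split_ifs with hab hbe
    · simp only [bind_val, pure_val, counter_cons, ih1, hab]
      split_ifs <;> omega
    · simp only [bind_val, pure_val, counter_cons, ih2]; omega
    · simp only [bind_val, pure_val, counter_cons, ih3]; omega

theorem mergeSort_pos (r : Fin n → ℕ) (X Y : List (Entry n)) (hX : ∀ e ∈ X, 0 < e.2)
    (hY : ∀ e ∈ Y, 0 < e.2) : ∀ e ∈ (mergeSort r X Y).val, 0 < e.2 := by
  fun_induction mergeSort r X Y with
  | case1 Y => simpa using hY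
  | case2 a X => simpa using hX
  | case3 a X b Y ih1 ih2 ih3 =>
    simp only [List.mem_cons, forall_eq_or_imp] at hX hY ih1 ih2 ih3
    simp only [bind_val]
    split_ifs with hab hbe
    · simp only [bind_val, pure_val, List.mem_cons, forall_eq_or_imp]
      exact ⟨by omega, ih1 hX.2 hY.2⟩
    · simp only [bind_val, pure_val, List.mem_cons, forall_eq_or_imp]
      exact ⟨hX.1, ih2 hX.2 hY⟩
    · simp only [bind_val, pure_val, List.mem_cons, forall_eq_or_imp]
      exact ⟨hY.1, ih3 hX hY.2⟩

theorem mergeSort_mem_keys (r : Fin n → ℕ) (X Y : List (Entry n)) (x : Fin n)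
    (h : x ∈ keys (mergeSort r X Y).val) : x ∈ keys X ∨ x ∈ keys Y := by
  fun_induction mergeSort r X Y with
  | case1 Y => right; simpa using h
  | case2 a X => left; simpa using h
  | case3 a X b Y ih1 ih2 ih3 =>
    simp only [bind_val] at h
    split_ifs at h with hab hbe <;>
    · simp only [bind_val, pure_val, keys_cons, List.mem_cons] at h ih2 ih3 ⊢
      tauto

/-- The entry put in front precedes the rest of both lists, and by `mergeSort_mem_keys` the merged
tail contains nothing else. -/
theorem mergeSort_sorted (r : Fin n → ℕ) (X Y : List (Entry n))
    (hX : (keys X).Pairwise (before r)) (hY : (keys Y).Pairwise (before r)) :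
    (keys (mergeSort r X Y).val).Pairwise (before r) := by
  fun_induction mergeSort r X Y with
  | case1 Y => simpa using hY
  | case2 a X => simpa using hX
  | case3 a X b Y ih1 ih2 ih3 =>
    have hX' := List.pairwise_cons.1 hX
    have hY' := List.pairwise_cons.1 hY
    simp only [bind_val]
    split_ifs with hab hbe
    · simp only [bind_val, pure_val, keys_cons, List.pairwise_cons]
      refine ⟨fun x hx => ?_, ih1 hX'.2 hY'.2⟩
      rcases mergeSort_mem_keys r X Y x hx with h | h
      · exact hX'.1 x h
      · exact hab ▸ hY'.1 x h
    · simp only [bind_val, pure_val, keys_cons, List.pairwise_cons]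
      refine ⟨fun x hx => ?_, ih2 hX'.2 hY⟩
      rcases mergeSort_mem_keys r X _ x hx with h | h
      · exact hX'.1 x h
      · rcases List.mem_cons.1 h with rfl | h
        · exact hbe
        · exact before_trans hbe (hY'.1 x h)
    · have hba := before_of_not hab hbe
      simp only [bind_val, pure_val, keys_cons, List.pairwise_cons]
      refine ⟨fun x hx => ?_, ih3 hX hY'.2⟩
      rcases mergeSort_mem_keys r _ Y x hx with h | h
      · rcases List.mem_cons.1 h with rfl | h
        · exact hba
        · exact before_trans hba (hX'.1 x h)
      · exact hY'.1 x h

theorem mergeSort_length_le (r : Fin n → ℕ) (X Y : List (Entry n)) :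
    (mergeSort r X Y).val.length ≤ X.length + Y.length := by
  fun_induction mergeSort r X Y with
  | case1 Y => simp
  | case2 a X => simp
  | case3 a X b Y ih1 ih2 ih3 =>
    simp only [List.length_cons] at *
    simp only [bind_val]
    split_ifs <;> simp only [bind_val, pure_val, List.length_cons] <;> omega

theorem mergeSort_steps_le (r : Fin n → ℕ) (X Y : List (Entry n)) :
    (mergeSort r X Y).steps ≤ X.length + Y.length + 1 := by
  fun_induction mergeSort r X Y with
  | case1 Y => simp
  | case2 a X => simp
  | case3 a X b Y ih1 ih2 ih3 =>
    simp only [List.length_cons] at *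
    simp only [bind_steps, tick_steps]
    split_ifs <;> simp only [bind_steps, pure_steps] <;> omega

/-! ### Changing a counter -/

theorem increase_counter (u : Fin n) (L : List (Entry n)) (x : Fin n) :
    counter (increase u L) x = counter L x + if x = u then 1 else 0 := by
  induction L with
  | nil => simp [increase, eq_comm]
  | cons e L ih =>
    rw [increase]
    split_ifs with he hx hx
    · subst he; simp [hx]; omega
    · simp [he, Ne.symm hx]
    · rw [counter_cons, counter_cons, ih, if_pos hx]; omega
    · simp [ih, hx]

theorem increase_pos (u : Fin n) {L : List (Entry n)} (h : ∀ e ∈ L, 0 < e.2) :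
    ∀ e ∈ increase u L, 0 < e.2 := by
  induction L with
  | nil => simp [increase]
  | cons e L ih =>
    simp only [List.mem_cons, forall_eq_or_imp] at h
    rw [increase]
    split_ifs
    · simp only [List.mem_cons, forall_eq_or_imp]; exact ⟨by omega, h.2⟩
    · simp only [List.mem_cons, forall_eq_or_imp]; exact ⟨h.1, ih h.2⟩

theorem mem_keys_increase {u : Fin n} {L : List (Entry n)} {x : Fin n}
    (h : x ∈ keys (increase u L)) : x = u ∨ x ∈ keys L := by
  induction L with
  | nil => simpa [increase] using h
  | cons e L ih =>
    rw [increase] at h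
    split_ifs at h with he
    · simp at h ⊢; tauto
    · simp at h ⊢; tauto

theorem increase_nodup (u : Fin n) {L : List (Entry n)} (h : (keys L).Nodup) :
    (keys (increase u L)).Nodup := by
  induction L with
  | nil => simp [increase]
  | cons e L ih =>
    simp only [keys_cons, List.nodup_cons] at h
    rw [increase]
    split_ifs with he
    · simpa [← he] using h
    · simp only [keys_cons, List.nodup_cons]
      exact ⟨fun hm => (mem_keys_increase hm).elim he h.1, ih h.2⟩

theorem increase_length (u : Fin n) (L : List (Entry n)) :
    (increase u L).length ≤ L.length + 1 := by
  induction L with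
  | nil => simp [increase]
  | cons e L ih => rw [increase]; split_ifs <;> simp; omega

theorem Lists.increase {L : List (Entry n)} {f : Fin n → ℕ} (h : Lists L f) (u : Fin n) :
    Lists (increase u L) fun x => f x + if x = u then 1 else 0 :=
  ⟨increase_nodup u h.nodup, increase_pos u h.pos, fun x => by
    rw [increase_counter, h.counter_eq]⟩

theorem keys_decrease_sublist (u : Fin n) (L : List (Entry n)) :
    (keys (decrease u L)).Sublist (keys L) := by
  induction L with
  | nil => simp [decrease]
  | cons e L ih =>
    rw [decrease]
    split_ifs with h1 h2
    · simp
    · simp [h1]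
    · simpa using ih

theorem decrease_pos (u : Fin n) {L : List (Entry n)} (h : ∀ e ∈ L, 0 < e.2) :
    ∀ e ∈ decrease u L, 0 < e.2 := by
  induction L with
  | nil => simp [decrease]
  | cons e L ih =>
    simp only [List.mem_cons, forall_eq_or_imp] at h
    rw [decrease]
    split_ifs
    · exact h.2
    · simp only [List.mem_cons, forall_eq_or_imp]; exact ⟨by omega, h.2⟩
    · simp only [List.mem_cons, forall_eq_or_imp]; exact ⟨h.1, ih h.2⟩

/-- Distinct nodes make the first match the only one, and positivity makes the removal of an entry a
loss of exactly one unit. Truncated subtraction covers the case that `u` is absent. -/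
theorem decrease_counter (u : Fin n) {L : List (Entry n)} (hn : (keys L).Nodup)
    (hp : ∀ e ∈ L, 0 < e.2) (x : Fin n) :
    counter (decrease u L) x = counter L x - if x = u then 1 else 0 := by
  induction L with
  | nil => simp [decrease]
  | cons e L ih =>
    simp only [List.mem_cons, forall_eq_or_imp] at hp
    simp only [keys_cons, List.nodup_cons] at hn
    have h0 := counter_eq_zero hn.1
    have ih' := ih hn.2 hp.2
    rw [decrease]
    by_cases h1 : e.1 = u
    · by_cases h3 : x = u
      · subst h3
        rw [h1] at h0
        split_ifs <;> simp_all
      · split_ifs <;> simp_all [Ne.symm h3]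
    · by_cases h3 : e.1 = x
      · simp_all
      · simp_all

theorem Lists.decrease {L : List (Entry n)} {f : Fin n → ℕ} (h : Lists L f) (u : Fin n) :
    Lists (decrease u L) fun x => f x - if x = u then 1 else 0 :=
  ⟨h.nodup.sublist (keys_decrease_sublist u L), decrease_pos u h.pos, fun x => by
    rw [decrease_counter u h.nodup h.pos, h.counter_eq]⟩

end KHCore

namespace KHCore

variable {n : ℕ}

/-! ## Recomputing a buffer -/

theorem keys_filter (p : Fin n → Bool) (L : List (Entry n)) :
    keys (L.filter fun e => p e.1) = (keys L).filter p := by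
  simp [keys, List.filter_map, Function.comp_def]

theorem counter_filter (p : Fin n → Bool) (L : List (Entry n)) (x : Fin n) :
    counter (L.filter fun e => p e.1) x = if p x then counter L x else 0 := by
  induction L with
  | nil => simp
  | cons e L ih =>
    by_cases hx : e.1 = x
    · subst hx
      by_cases h : p e.1 <;> simp_all
    · by_cases h : p e.1 <;> simp_all

theorem Lists.filter {L : List (Entry n)} {f : Fin n → ℕ} (h : Lists L f) (p : Fin n → Bool) :
    Lists (L.filter fun e => p e.1) fun x => if p x then f x else 0 :=
  ⟨by rw [keys_filter]; exact h.nodup.filter _, fun e he => h.pos e (List.mem_filter.1 he).1,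
    fun x => by rw [counter_filter, h.counter_eq]⟩

theorem filterMap_ite {α β : Type} (p : α → Prop) [DecidablePred p] (f : α → β) (L : List α) :
    L.filterMap (fun e => if p e then some (f e) else none) =
      (L.filter fun e => decide (p e)).map f := by
  induction L with
  | nil => rfl
  | cons e L ih =>
    by_cases h : p e <;> simp [h, ih]

/-- `X` lists nodes once each. -/
theorem lists_ones {X : List (Fin n)} (h : X.Nodup) :
    Lists (X.map fun x => (x, 1)) fun x => if x ∈ X then 1 else 0 := by
  refine ⟨by simpa [keys, Function.comp_def] using h, by simp, fun x => ?_⟩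
  induction X with
  | nil => simp
  | cons a X ih =>
    have := List.nodup_cons.1 h
    have ih' := ih this.2
    by_cases hx : a = x
    · subst hx
      simp_all
    · simp_all [Ne.symm hx]

theorem keys_ones (X : List (Fin n)) : keys (X.map fun x => (x, 1)) = X := by
  simp [keys, Function.comp_def]

/-- The number of lists `X w`, `w ∈ A`, that contain `x`, plus one if `x = v`. -/
def mult (A : List (Fin n)) (X : Fin n → List (Fin n)) (v x : Fin n) : ℕ :=
  A.countP (fun w => decide (x ∈ X w)) + if x = v then 1 else 0

theorem mult_nil (X : Fin n → List (Fin n)) (v x : Fin n) :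
    mult [] X v x = if x = v then 1 else 0 := by simp [mult]

theorem mult_append_singleton (A : List (Fin n)) (w : Fin n) (X : Fin n → List (Fin n))
    (v x : Fin n) : mult (A ++ [w]) X v x = mult A X v x + if x ∈ X w then 1 else 0 := by
  simp [mult, List.countP_append, List.countP_cons]
  omega

theorem mult_le_append (A B : List (Fin n)) (X : Fin n → List (Fin n))
    (v x : Fin n) : mult A X v x ≤ mult (A ++ B) X v x := by
  simp only [mult, List.countP_append]
  omega

/-- The list `D` consists of the nodes of rank `k - 1`, and no neighbour has the threshold `k`. -/
def DepValid (r : Fin n → ℕ) (c : Fin n → ℕ) (ks : List ℕ) (D : List (Entry n)) (k : ℕ) : Prop :=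
  k ∉ ks ∧ Lists D fun x => if r x + 1 = k then c x else 0

/-- The threshold `k` is the smallest possible one. -/
def Minimal (r : Fin n → ℕ) (N : ℕ) (c : Fin n → ℕ) (ks : List ℕ) (k : ℕ) : Prop :=
  ∀ k', (∀ κ ∈ ks, κ ≤ k') → (Finset.univ.filter fun x => k' ≤ r x ∧ 0 < c x).card ≤ N → k ≤ k'

/-- The data `B`, `D`, `k`, `m` of a node are consistent with the counters `c` and thresholds `ks`
which its neighbours have at the level below.  The number `pot` bounds the number of future
recomputations. -/
structure Node (r : Fin n → ℕ) (N : ℕ) (c : Fin n → ℕ) (ks : List ℕ)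
    (B D : List (Entry n)) (k m pot : ℕ) : Prop where
  lists : Lists B fun x => if k ≤ r x then c x else 0
  sorted : (keys B).Pairwise (before r)
  length_le : B.length ≤ N
  le : ∀ κ ∈ ks, κ ≤ k
  ties : m = ks.count k
  dep : D ≠ [] → DepValid r c ks D k
  pot_le : 2 * k ≤ pot
  pot_eq : pot = 2 * k → DepValid r c ks D k

theorem sorted_filter {r : Fin n → ℕ} {L : List (Entry n)} (h : (keys L).Pairwise (before r))
    (p : Fin n → Bool) : (keys (L.filter fun e => p e.1)).Pairwise (before r) := by
  rw [keys_filter]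
  exact h.filter _

/-- Count entries from `0`. In a sorted list, everything ranked strictly above entry `N` lies among
the first `N` entries, so a threshold just above its rank keeps at most `N` of them. Every smaller
threshold keeps the first `N + 1` entries and is not admissible. -/
theorem trim_spec {r : Fin n → ℕ} {N : ℕ} {M : ℝ} (hM : 0 ≤ M) (hN : ⌊M⌋₊ = N)
    {T : List (Entry n)} {f : Fin n → ℕ} {k : ℕ} (hT : Lists T f)
    (hs : (keys T).Pairwise (before r)) (hk : ∀ x, 0 < f x → k ≤ r x) :
    k ≤ (trim r M T k).val.2 ∧
    Lists (trim r M T k).val.1 (fun x => if (trim r M T k).val.2 ≤ r x then f x else 0) ∧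
    (keys (trim r M T k).val.1).Pairwise (before r) ∧ (trim r M T k).val.1.length ≤ N ∧
    (trim r M T k).val.1.length ≤ T.length ∧
    (∀ k', k ≤ k' → (Finset.univ.filter fun x => k' ≤ r x ∧ 0 < f x).card ≤ N →
      (trim r M T k).val.2 ≤ k') ∧
    (trim r M T k).steps ≤ 1 + 2 * T.length := by
  have hlt : M < (T.length : ℝ) ↔ N < T.length := by rw [← hN, Nat.floor_lt hM]
  by_cases h : M < (T.length : ℝ)
  · have hlen := hlt.1 h
    have ht : T[⌊M⌋₊]? = some T[N] := by rw [hN]; exact List.getElem?_eq_getElem hlen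
    have hval : (trim r M T k).val = (T.filter (fun e => decide (max k (r T[N].1 + 1) ≤ r e.1)),
        max k (r T[N].1 + 1)) := by
      simp only [trim, bind_val, if_pos h, scan_val, pure_val, ht]
      rw [filterMap_ite _ (fun e => e)]
      simp
    have hsteps : (trim r M T k).steps = 1 + 2 * T.length := by
      simp only [trim, bind_steps, if_pos h, scan_steps, pure_steps, tick_steps, touch_steps]
      omega
    have htk : k ≤ r T[N].1 := hk _ (by
      rw [← hT.mem_keys]
      exact List.mem_map.2 ⟨_, List.getElem_mem hlen, rfl⟩)
    have hmax : max k (r T[N].1 + 1) = r T[N].1 + 1 := by omega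
    rw [hmax] at hval
    have hpair : ∀ i j (hi : i < T.length) (hj : j < T.length), i < j →
        before r T[i].1 T[j].1 := by
      intro i j hi hj hij
      have := List.pairwise_iff_getElem.1 hs i j (by simpa using hi) (by simpa using hj) hij
      simpa [keys] using this
    rw [hval]
    refine ⟨by omega, ?_, sorted_filter hs (fun x => decide (r T[N].1 + 1 ≤ r x)), ?_,
      List.length_filter_le _ _, ?_, hsteps.le⟩
    · exact (hT.filter (fun x => decide (r T[N].1 + 1 ≤ r x))).congr fun x => by simp
    · have h1 : (T.drop N).filter (fun e => decide (r T[N].1 + 1 ≤ r e.1)) = [] := by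
        rw [List.filter_eq_nil_iff]
        intro e he
        obtain ⟨i, hi, rfl⟩ := List.mem_iff_getElem.1 he
        rw [List.length_drop] at hi
        rw [List.getElem_drop]
        rcases Nat.eq_zero_or_pos i with rfl | hpos
        · simp
        · have := hpair N (N + i) hlen (by omega) (by omega)
          simp only [decide_eq_true_eq]
          unfold before at this
          omega
      have h2 : ∀ q : Entry n → Bool, T.filter q = (T.take N).filter q ++ (T.drop N).filter q :=
        fun q => by rw [← List.filter_append, List.take_append_drop]
      show (T.filter _).length ≤ N
      rw [h2, h1, List.append_nil]
      refine (List.length_filter_le _ _).trans ?_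
      simp
    · intro k' _ hcard
      by_contra hlt'
      have hle : k' ≤ r T[N].1 := by
        by_contra hcon
        apply hlt'
        show r T[N].1 + 1 ≤ k'
        omega
      have hsub : ((keys (T.take (N + 1))).toFinset) ⊆
          Finset.univ.filter fun x => k' ≤ r x ∧ 0 < f x := by
        intro x hx
        rw [List.mem_toFinset] at hx
        obtain ⟨e, he, rfl⟩ := List.mem_map.1 hx
        have heT : e ∈ T := List.mem_of_mem_take he
        refine Finset.mem_filter.2 ⟨Finset.mem_univ _, ?_, hT.mem_keys.1
          (List.mem_map.2 ⟨e, heT, rfl⟩)⟩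
        obtain ⟨i, hi, rfl⟩ := List.mem_iff_getElem.1 he
        rw [List.length_take] at hi
        rw [List.getElem_take]
        rcases Nat.lt_or_ge i N with hiN | hiN
        · have := hpair i N (by omega) hlen hiN
          unfold before at this
          omega
        · have : i = N := by omega
          subst this
          exact hle
      have hnd : (keys (T.take (N + 1))).Nodup := by
        have : keys (T.take (N + 1)) = (keys T).take (N + 1) := by simp [keys, List.map_take]
        rw [this]
        exact hT.nodup.sublist (List.take_sublist _ _)
      have := Finset.card_le_card hsub
      rw [List.toFinset_card_of_nodup hnd, keys_length, List.length_take] at this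
      omega
  · have hval : (trim r M T k).val = (T, k) := by
      simp only [trim, bind_val, if_neg h, pure_val]
    have hsteps : (trim r M T k).steps = 1 := by
      simp only [trim, bind_steps, if_neg h, pure_steps, tick_steps]
    rw [hval]
    refine ⟨le_rfl, hT.congr fun x => ?_, hs, ?_, le_rfl, fun k' hk' _ => hk', by omega⟩
    · by_cases hx : 0 < f x
      · simp [hk x hx]
      · simp; omega
    · rw [hlt] at h
      show T.length ≤ N
      omega

/-- The main loop of `compute`. -/
noncomputable def gather (r : Fin n → ℕ) (M : ℝ) (v : Fin n) (j k₀ : ℕ) (s : Store n) :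
    Timed (List (Entry n) × ℕ) :=
  forEach (fun w Tk => do
      let X ← scan (fun e => if Tk.2 ≤ r e.1 then some (e.1, 1) else none) (s.buf w j)
      let T ← mergeSort r Tk.1 X
      trim r M T Tk.2)
    (s.adj v) ((if k₀ ≤ r v then [(v, 1)] else []), k₀)

/-- The end of `compute`. -/
def finishCompute (v : Fin n) (j : ℕ) (s : Store n) (T : List (Entry n)) (k m : ℕ)
    (D : List (Entry n)) : Timed (Store n) := do
  let _ ← forEach (fun w _ => touch (s.buf w j)) (s.adj v) ()
  let _ ← forEach (fun _ _ => touch (s.adj v)) T ()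
  pure { s with
    buf := write s.buf v (j + 1) T
    lvl := write s.lvl v (j + 1) k
    ties := write s.ties v (j + 1) m
    dep := write s.dep v (j + 1) D }

theorem compute_eq (r : Fin n → ℕ) (M : ℝ) (v : Fin n) (j : ℕ) (s : Store n) :
    compute r M v j s =
      (tick >>= fun _ => forEach (fun w k => pure (max k (s.lvl w j))) (s.adj v) 0 >>= fun k₀ =>
        gather r M v j k₀ s >>= fun Tk =>
          forEach (fun w m => pure (if s.lvl w j = Tk.2 then m + 1 else m)) (s.adj v) 0 >>=
            fun m => if m = 0 then union r s v j Tk.2 >>= finishCompute v j s Tk.1 Tk.2 m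
              else pure [] >>= finishCompute v j s Tk.1 Tk.2 m) := rfl

/-- The running threshold only rises, so dropped entries never become relevant again and the list
always carries exact counters at the ranks that are kept. The threshold is minimal because a prefix
of the neighbours contributes no more nodes than all of them. The length bound in terms of the
degree keeps the cost of `compute` constant for a node without neighbours. -/
theorem gather_spec {r : Fin n → ℕ} {N : ℕ} {M : ℝ} (hM : 0 ≤ M) (hN : ⌊M⌋₊ = N) (hN1 : 1 ≤ N)
    (v : Fin n) (j k₀ : ℕ) (s : Store n)
    (hsort : ∀ w ∈ s.adj v, (keys (s.buf w j)).Pairwise (before r))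
    (hlen : ∀ w ∈ s.adj v, (s.buf w j).length ≤ N) :
    ∃ T k, (gather r M v j k₀ s).val = (T, k) ∧ k₀ ≤ k ∧
    Lists T (fun x => if k ≤ r x then mult (s.adj v) (fun w => keys (s.buf w j)) v x else 0) ∧
    (keys T).Pairwise (before r) ∧ T.length ≤ N ∧ T.length ≤ 1 + (s.adj v).length * N ∧
    (∀ k', k₀ ≤ k' → (Finset.univ.filter fun x =>
      k' ≤ r x ∧ 0 < mult (s.adj v) (fun w => keys (s.buf w j)) v x).card ≤ N → k ≤ k') ∧
    (gather r M v j k₀ s).steps ≤ (s.adj v).length * (7 * (N + 1)) := by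
  set X := fun w => keys (s.buf w j) with hX
  set A := s.adj v with hA
  -- `P` is the prefix of neighbours already merged. One neighbour costs at most `N` for scanning,
  -- `2N + 1` for merging, `4N + 1` for trimming and one step of the loop.
  have key := forEach_rule (body := fun w (Tk : List (Entry n) × ℕ) => do
      let X ← scan (fun e => if Tk.2 ≤ r e.1 then some (e.1, 1) else none) (s.buf w j)
      let T ← mergeSort r Tk.1 X
      trim r M T Tk.2)
    (fun R Tk t => ∃ P, A = P ++ R ∧ k₀ ≤ Tk.2 ∧
      Lists Tk.1 (fun x => if Tk.2 ≤ r x then mult P X v x else 0) ∧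
      (keys Tk.1).Pairwise (before r) ∧ Tk.1.length ≤ N ∧ Tk.1.length ≤ 1 + P.length * N ∧
      (∀ k', k₀ ≤ k' → (Finset.univ.filter fun x =>
        k' ≤ r x ∧ 0 < mult A X v x).card ≤ N → Tk.2 ≤ k') ∧ t ≤ P.length * (7 * (N + 1)))
    ?_ A ((if k₀ ≤ r v then [(v, 1)] else []), k₀) 0 ?_
  · obtain ⟨P, hP, h1, h2, h3, h4, h5, h6, h7⟩ := key
    rw [List.append_nil] at hP
    subst hP
    exact ⟨_, _, rfl, h1, h2, h3, h4, h5, h6, by rw [zero_add] at h7; exact h7⟩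
  · rintro w R ⟨T, k⟩ t ⟨P, hP, h1, h2, h3, h4, h5, h6, h7⟩
    dsimp only at h1 h2 h3 h4 h5 h6
    have hw : w ∈ A := by rw [hP]; simp
    set Y := (keys (s.buf w j)).filter (fun x => decide (k ≤ r x)) with hY
    have hscan : (scan (fun e : Entry n => if k ≤ r e.1 then some (e.1, 1) else none)
        (s.buf w j)).val = Y.map (fun x => (x, 1)) := by
      rw [scan_val, filterMap_ite, hY, ← keys_filter]
      simp [keys]
    have hYs : Y.Pairwise (before r) := (hsort w hw).filter _
    have hYn : Y.Nodup := nodup_of_before hYs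
    have hYl := lists_ones hYn
    have hYlen : Y.length ≤ N := (List.length_filter_le _ _).trans (by simpa using hlen w hw)
    set T1 := (mergeSort r T (Y.map fun x => (x, 1))).val with hT1
    have hs1 : (keys T1).Pairwise (before r) := mergeSort_sorted r _ _ h3 (by rwa [keys_ones])
    have hl1 : Lists T1 (fun x => if k ≤ r x then mult (P ++ [w]) X v x else 0) := by
      refine ⟨nodup_of_before hs1, mergeSort_pos r _ _ h2.pos hYl.pos, fun x => ?_⟩
      rw [hT1, mergeSort_counter, h2.counter_eq, hYl.counter_eq, mult_append_singleton]
      by_cases hk : k ≤ r x <;> simp [hY, hk, hX]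
    have hlen1 : T1.length ≤ T.length + Y.length := by
      simpa using mergeSort_length_le r T (Y.map fun x => (x, 1))
    have hst1 : (mergeSort r T (Y.map fun x => (x, 1))).steps ≤ T.length + Y.length + 1 := by
      simpa using mergeSort_steps_le r T (Y.map fun x => (x, 1))
    obtain ⟨g1, g2, g3, g4, g5, g6, g7⟩ := trim_spec hM hN hl1 hs1 (fun x hx => by
      by_contra hc
      rw [if_neg hc] at hx
      omega)
    refine ⟨P ++ [w], by simp [hP], ?_⟩
    simp only [bind_val, bind_steps, hscan, scan_steps, ← hT1]
    refine ⟨h1.trans g1, g2.congr fun x => ?_, g3, g4, ?_, ?_, ?_⟩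
    · split_ifs with h1 h2
      · rfl
      · omega
      · rfl
    · rw [List.length_append, List.length_singleton]
      nlinarith
    · intro k' hk0 hc
      have hkk := h6 k' hk0 hc
      refine g6 k' hkk (le_trans (Finset.card_le_card ?_) hc)
      intro x hx
      rw [Finset.mem_filter] at hx ⊢
      refine ⟨hx.1, hx.2.1, ?_⟩
      have h8 := hx.2.2
      rw [if_pos (hkk.trans hx.2.1)] at h8
      refine h8.trans_le ?_
      have : A = (P ++ [w]) ++ R := by simp [hP]
      rw [this]
      exact mult_le_append _ _ _ _ _
    · have := hlen w hw
      rw [List.length_append, List.length_singleton]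
      nlinarith
  · refine ⟨[], rfl, le_rfl, ?_, ?_, ?_, ?_, fun k' h _ => h, by simp⟩
    · dsimp only
      split_ifs with h
      · refine ⟨by simp, by simp, fun x => ?_⟩
        rw [mult_nil]
        by_cases hx : v = x
        · subst hx; simp [h]
        · simp [hx, Ne.symm hx]
      · refine ⟨by simp, by simp, fun x => ?_⟩
        rw [mult_nil]
        by_cases hx : v = x
        · subst hx; simp [h]
        · simp [Ne.symm hx]
    all_goals
      dsimp only
      split_ifs <;> simp [hN1]

theorem union_spec {r : Fin n → ℕ} {N : ℕ} (v : Fin n) (j k : ℕ) (s : Store n)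
    (hnd : ∀ w ∈ s.adj v, (keys (s.buf w j)).Nodup)
    (hlen : ∀ w ∈ s.adj v, (s.buf w j).length ≤ N) :
    Lists (union r s v j k).val
      (fun x => if r x + 1 = k then mult (s.adj v) (fun w => keys (s.buf w j)) v x else 0) ∧
    (union r s v j k).steps ≤ (s.adj v).length * (3 * (N + 1)) + 1 := by
  set X := fun w => keys (s.buf w j) with hX
  set A := s.adj v with hA
  have key := forEach_rule (body := fun w (D : List (Entry n)) => do
      let X ← scan (fun e => if r e.1 + 1 = k then some e.1 else none) (s.buf w j)
      forEach (fun u D => pure (increase u D)) X D)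
    (fun R D t => ∃ P, A = P ++ R ∧
      Lists D (fun x => if r x + 1 = k then mult P X v x else 0) ∧ D.length ≤ 1 + P.length * N ∧
      t ≤ P.length * (2 * N + 1))
    ?_ A (if r v + 1 = k then [(v, 1)] else []) 0 ?_
  · obtain ⟨P, hP, h1, h2, h3⟩ := key
    rw [List.append_nil] at hP
    subst hP
    refine ⟨h1, ?_⟩
    simp only [union, bind_steps, touch_steps, pure_steps]
    rw [← hA]
    nlinarith
  · rintro w R D t ⟨P, hP, h1, h2, h3⟩
    have hw : w ∈ A := by rw [hP]; simp
    set Y := (keys (s.buf w j)).filter (fun x => decide (r x + 1 = k)) with hY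
    have hscan : (scan (fun e : Entry n => if r e.1 + 1 = k then some e.1 else none)
        (s.buf w j)).val = Y := by
      rw [scan_val, filterMap_ite, hY, ← keys_filter]
      rfl
    have hYn : Y.Nodup := (hnd w hw).filter _
    have hYlen : Y.length ≤ N := (List.length_filter_le _ _).trans (by simpa using hlen w hw)
    refine ⟨P ++ [w], by simp [hP], ?_⟩
    simp only [bind_val, bind_steps, hscan, scan_steps, forEach_pure_val, forEach_pure_steps]
    have hfold : ∀ (Y : List (Fin n)) (_ : Y.Nodup) (D : List (Entry n)) (f : Fin n → ℕ),
        Lists D f → Lists (Y.foldl (fun s a => increase a s) D)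
          (fun x => f x + if x ∈ Y then 1 else 0) ∧
        (Y.foldl (fun s a => increase a s) D).length ≤ D.length + Y.length := by
      intro Y
      induction Y with
      | nil => intro _ D f h; exact ⟨h.congr fun x => by simp, by simp⟩
      | cons y Y ih =>
        intro hn D f h
        have hn' := List.nodup_cons.1 hn
        obtain ⟨i1, i2⟩ := ih hn'.2 _ _ (h.increase y)
        refine ⟨i1.congr fun x => ?_, ?_⟩
        · by_cases hx : x = y
          · subst hx; simp [hn'.1]
          · simp [hx]
        · have := increase_length y D
          simp only [List.foldl_cons, List.length_cons]
          omega
    obtain ⟨i1, i2⟩ := hfold Y hYn D _ h1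
    refine ⟨i1.congr fun x => ?_, ?_, ?_⟩
    · rw [mult_append_singleton]
      by_cases hx : r x + 1 = k <;> simp [hY, hx, hX]
    · rw [List.length_append, List.length_singleton]
      nlinarith
    · have := hlen w hw
      rw [List.length_append, List.length_singleton]
      nlinarith
  · refine ⟨[], rfl, ?_, ?_, by simp⟩
    · split_ifs with h
      · refine ⟨by simp, by simp, fun x => ?_⟩
        rw [mult_nil]
        by_cases hx : v = x
        · subst hx; simp [h]
        · simp [hx, Ne.symm hx]
      · refine ⟨by simp, by simp, fun x => ?_⟩
        rw [mult_nil]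
        by_cases hx : v = x
        · subst hx; simp [h]
        · simp [Ne.symm hx]
    · split_ifs <;> simp

theorem foldl_max_spec {α : Type} (f : α → ℕ) (A : List α) (b : ℕ) :
    b ≤ A.foldl (fun k w => max k (f w)) b ∧ (∀ w ∈ A, f w ≤ A.foldl (fun k w => max k (f w)) b) ∧
    ∀ k, b ≤ k → (∀ w ∈ A, f w ≤ k) → A.foldl (fun k w => max k (f w)) b ≤ k := by
  induction A generalizing b with
  | nil => simp
  | cons a A ih =>
    obtain ⟨h1, h2, h3⟩ := ih (max b (f a))
    simp only [List.foldl_cons, List.mem_cons, forall_eq_or_imp]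
    refine ⟨by omega, ⟨by omega, h2⟩, fun k hk h => h3 k (by omega) h.2⟩

theorem foldl_count (f : Fin n → ℕ) (k : ℕ) (A : List (Fin n)) (b : ℕ) :
    A.foldl (fun m w => if f w = k then m + 1 else m) b = b + (A.map f).count k := by
  induction A generalizing b with
  | nil => simp
  | cons a A ih =>
    simp only [List.foldl_cons, ih, List.map_cons, List.count_cons]
    by_cases h : f a = k <;> simp [h]
    omega

/-- With potential `2 * k + 1` the field `pot_eq` is vacuous; validity of `D` when there are no ties
is returned separately, so that `Node.recompute` can lower the potential to `2 * k`. The additive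
constant `3` is the whole cost at degree `0`. -/
theorem compute_spec {r : Fin n → ℕ} {N : ℕ} {M : ℝ} (hM : 0 ≤ M) (hN : ⌊M⌋₊ = N) (hN1 : 1 ≤ N)
    (v : Fin n) (j : ℕ) (s : Store n)
    (hsort : ∀ w ∈ s.adj v, (keys (s.buf w j)).Pairwise (before r))
    (hlen : ∀ w ∈ s.adj v, (s.buf w j).length ≤ N)
    {c : Fin n → ℕ} (hc : c = mult (s.adj v) (fun w => keys (s.buf w j)) v)
    {ks : List ℕ} (hks : ks = (s.adj v).map fun w => s.lvl w j) :
    ∃ B D k m, (compute r M v j s).val = { s with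
        buf := write s.buf v (j + 1) B
        lvl := write s.lvl v (j + 1) k
        ties := write s.ties v (j + 1) m
        dep := write s.dep v (j + 1) D } ∧
      Node r N c ks B D k m (2 * k + 1) ∧ (m = 0 → DepValid r c ks D k) ∧ Minimal r N c ks k ∧
      (compute r M v j s).steps ≤ 20 * ((s.adj v).length * (N + 1)) + 3 := by
  set A := s.adj v with hA
  set k₀ := A.foldl (fun k w => max k (s.lvl w j)) 0 with hk₀
  obtain ⟨-, f2, f3⟩ := foldl_max_spec (fun w => s.lvl w j) A 0
  obtain ⟨T, k, hg, g1, g2, g3, g4, g5, g6, g7⟩ := gather_spec hM hN hN1 v j k₀ s hsort hlen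
  rw [← hA, ← hc] at g2 g6
  rw [← hA] at g5 g7
  set m := ks.count k with hm
  have hm' : A.foldl (fun m w => if s.lvl w j = k then m + 1 else m) 0 = m := by
    rw [foldl_count, hm, hks, zero_add]
  obtain ⟨u1, u2⟩ := union_spec (r := r) v j k s (fun w hw => nodup_of_before (hsort w hw)) hlen
  rw [← hA, ← hc] at u1
  rw [← hA] at u2
  set D := if m = 0 then (union r s v j k).val else [] with hD
  have hmks : m = 0 ↔ k ∉ ks := List.count_eq_zero
  have hvalid : m = 0 → DepValid r c ks D k := fun h => ⟨hmks.1 h, by rw [hD, if_pos h]; exact u1⟩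
  refine ⟨T, D, k, m, ?_, ?_, hvalid, ?_, ?_⟩
  · rw [compute_eq]
    simp only [bind_val, forEach_pure_val]
    rw [← hA, ← hk₀, hg]
    simp only [hm', hD]
    by_cases h0 : m = 0
    · simp only [if_pos h0]
      rfl
    · simp only [if_neg h0]
      rfl
  · refine ⟨g2, g3, g4, fun κ hκ => ?_, rfl, fun hne => hvalid ?_, by omega, by omega⟩
    · rw [hks] at hκ
      obtain ⟨w, hw, rfl⟩ := List.mem_map.1 hκ
      exact (f2 w hw).trans g1
    · by_contra hm0
      exact hne (by rw [hD, if_neg hm0])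
  · intro k' hk' hcard
    refine g6 k' (f3 k' (Nat.zero_le _) fun w hw => hk' _ ?_) hcard
    rw [hks]
    exact List.mem_map.2 ⟨w, hw, rfl⟩
  · have h1 : (compute r M v j s).steps = 1 + (A.length + ((gather r M v j k₀ s).steps +
        (A.length + ((if m = 0 then union r s v j k else pure []).steps +
          ((forEach (fun w _ => touch (s.buf w j)) A ()).steps +
          (forEach (fun _ _ => touch A) T ()).steps))))) := by
      rw [compute_eq]
      simp only [bind_steps, forEach_pure_val, forEach_pure_steps, tick_steps]
      rw [← hA, ← hk₀, hg]
      simp only [hm']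
      by_cases h0 : m = 0
      · simp only [if_pos h0]
        rfl
      · simp only [if_neg h0]
        rfl
    have h2 : (if m = 0 then union r s v j k else pure []).steps ≤
        A.length * (3 * (N + 1)) + 1 := by
      split_ifs
      · exact u2
      · simp
    have h3 : (forEach (fun w _ => touch (s.buf w j)) A ()).steps ≤ A.length * (N + 1) :=
      forEach_steps_le (fun w hw _ => by rw [touch_steps]; exact hlen w hw) ()
    have h4 : (forEach (fun (_ : Entry n) _ => touch A) T ()).steps ≤ T.length * (A.length + 1) :=
      forEach_steps_le (fun w hw _ => by rw [touch_steps]) ()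
    have h5 : T.length * A.length ≤ N * A.length := Nat.mul_le_mul_right _ g4
    rw [h1]
    nlinarith

end KHCore

namespace KHCore

variable {n : ℕ}

/-! ## Updating the data of one node -/

/-- Since counters are positive, `y` leaves the list exactly when its counter is `1`. This is the
test by which `notify` collects the nodes to be passed on. -/
theorem keys_decrease_perm (y : Fin n) {L : List (Entry n)} (hn : (keys L).Nodup)
    (hp : ∀ e ∈ L, 0 < e.2) :
    (keys L).Perm (if (y, 1) ∈ L then y :: keys (decrease y L) else keys (decrease y L)) := by
  induction L with
  | nil => simp [decrease]
  | cons e L ih =>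
    have hn' := List.nodup_cons.1 hn
    have h1 := hp e (by simp)
    have ih' := ih hn'.2 fun e' he' => hp e' (by simp [he'])
    obtain ⟨x, z⟩ := e
    rw [decrease]
    by_cases hx : x = y
    · subst hx
      have h3 : (x, 1) ∉ L := fun hm => hn'.1 (List.mem_map.2 ⟨(x, 1), hm, rfl⟩)
      by_cases hz : z = 1
      · subst hz
        simp
      · have : ¬ z ≤ 1 := by dsimp only at h1; omega
        simp [h3, this, Ne.symm hz]
    · have : (y, 1) ∈ (x, z) :: L ↔ (y, 1) ∈ L := by simp [Ne.symm hx]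
      simp only [this, if_neg hx, keys_cons]
      split_ifs at ih' ⊢
      · exact (ih'.cons x).trans (List.Perm.swap _ _ _)
      · exact ih'.cons x

theorem foldl_decrease_spec {Y : List (Fin n)} (hY : Y.Nodup) {L : List (Entry n)}
    {f : Fin n → ℕ} (h : Lists L f) :
    Lists (Y.foldl (fun L y => decrease y L) L) (fun x => f x - if x ∈ Y then 1 else 0) ∧
    (keys (Y.foldl (fun L y => decrease y L) L)).Sublist (keys L) := by
  induction Y generalizing L f with
  | nil => exact ⟨h.congr fun x => by simp, List.Sublist.refl _⟩
  | cons y Y ih =>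
    have hY' := List.nodup_cons.1 hY
    obtain ⟨i1, i2⟩ := ih hY'.2 (h.decrease y)
    refine ⟨i1.congr fun x => ?_, i2.trans (keys_decrease_sublist _ _)⟩
    by_cases hx : x = y
    · subst hx; simp [hY'.1]
    · simp [hx]

theorem foldl_decrease_nil (Y : List (Fin n)) :
    Y.foldl (fun L y => decrease y L) ([] : List (Entry n)) = [] := by
  induction Y with
  | nil => rfl
  | cons y Y ih => simpa [decrease] using ih

/-- Whatever leaves the buffer is moved to `Z'`. Hence the visible list of a node, buffer plus
pending nodes, is unchanged up to order when the node is notified. -/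
theorem notify_fold_spec {Y : List (Fin n)} (hY : Y.Nodup) {B : List (Entry n)}
    {f : Fin n → ℕ} (h : Lists B f) (D : List (Entry n)) (Z : List (Fin n)) :
    ∃ Z', Y.foldl (fun (BDZ : List (Entry n) × List (Entry n) × List (Fin n)) y =>
        (decrease y BDZ.1, decrease y BDZ.2.1,
          if (y, 1) ∈ BDZ.1 then y :: BDZ.2.2 else BDZ.2.2)) (B, D, Z) =
      (Y.foldl (fun L y => decrease y L) B, Y.foldl (fun L y => decrease y L) D, Z') ∧
      (keys B ++ Z).Perm (keys (Y.foldl (fun L y => decrease y L) B) ++ Z') := by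
  induction Y generalizing B D Z f with
  | nil => exact ⟨Z, rfl, List.Perm.refl _⟩
  | cons y Y ih =>
    have hY' := List.nodup_cons.1 hY
    obtain ⟨Z', i1, i2⟩ := ih hY'.2 (h.decrease y) (decrease y D)
      (if (y, 1) ∈ B then y :: Z else Z)
    refine ⟨Z', i1, List.Perm.trans ?_ i2⟩
    have hp := keys_decrease_perm y h.nodup h.pos
    split_ifs at hp ⊢
    · exact (hp.append_right Z).trans List.perm_middle.symm
    · exact hp.append_right Z

/-- The effect of `notify` on the data of a node whose counters and thresholds change from `c`, `ks`
to `c'`, `ks'`. -/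
theorem Node.notify {r : Fin n → ℕ} {N : ℕ} {c c' : Fin n → ℕ} {ks ks' : List ℕ}
    {B D : List (Entry n)} {k m pot : ℕ} (h : Node r N c ks B D k m pot)
    {Y : List (Fin n)} (hY : Y.Nodup) {old : Option ℕ}
    (hc : ∀ x, k ≤ r x → c' x = c x - if x ∈ Y then 1 else 0)
    (hc' : k ∉ ks → ∀ x, r x + 1 = k → c' x = c x - if x ∈ Y then 1 else 0)
    (hle : ∀ κ ∈ ks', κ ≤ k)
    (hcount : ks'.count k = if old = some k then ks.count k - 1 else ks.count k) :
    ∃ B' D' Z, Y.foldl (fun (BDZ : List (Entry n) × List (Entry n) × List (Fin n)) y =>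
        (decrease y BDZ.1, decrease y BDZ.2.1,
          if (y, 1) ∈ BDZ.1 then y :: BDZ.2.2 else BDZ.2.2)) (B, D, []) = (B', D', Z) ∧
      Node r N c' ks' B' D' k (if old = some k then m - 1 else m) pot ∧
      (keys B).Perm (keys B' ++ Z) ∧ (keys B').Sublist (keys B) := by
  obtain ⟨Z, hZ, hperm⟩ := notify_fold_spec hY h.lists D []
  obtain ⟨b1, b2⟩ := foldl_decrease_spec hY h.lists
  rw [List.append_nil] at hperm
  -- `D` is meaningful only while no neighbour has threshold `k`, which is why `hc'` controls the
  -- counters at rank `k - 1` only in that case.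
  have hval : DepValid r c ks D k →
      DepValid r c' ks' (Y.foldl (fun L y => decrease y L) D) k := by
    rintro ⟨v1, v2⟩
    refine ⟨?_, (foldl_decrease_spec hY v2).1.congr fun x => ?_⟩
    · have h0 := List.count_eq_zero.2 v1
      rw [← List.count_eq_zero, hcount, h0]
      simp
    · by_cases hx : r x + 1 = k
      · simp [hx, hc' v1 x hx]
      · simp [hx]
  refine ⟨_, _, Z, hZ, ⟨b1.congr fun x => ?_, h.sorted.sublist b2, ?_, hle, ?_, fun hne => ?_,
    h.pot_le, fun hp => hval (h.pot_eq hp)⟩, hperm, b2⟩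
  · by_cases hx : k ≤ r x
    · simp [hx, hc x hx]
    · simp [hx]
  · have := b2.length_le
    rw [keys_length, keys_length] at this
    exact this.trans h.length_le
  · rw [hcount, h.ties]
  · refine hval (h.dep fun hD => hne ?_)
    rw [hD, foldl_decrease_nil]

/-- Lowering the threshold from `k + 1` to `k` adds exactly the nodes of rank `k`, which are stored
in `D`. So the two stored lengths decide whether `k` is admissible. -/
theorem card_eq_length_add_length {r : Fin n → ℕ} {c : Fin n → ℕ}
    {B D : List (Entry n)} {k : ℕ} (hB : Lists B fun x => if k + 1 ≤ r x then c x else 0)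
    (hD : Lists D fun x => if r x + 1 = k + 1 then c x else 0) :
    (Finset.univ.filter fun x => k ≤ r x ∧ 0 < c x).card = B.length + D.length := by
  rw [hB.length_eq, hD.length_eq, ← Finset.card_union_of_disjoint]
  · congr 1
    ext x
    simp only [Finset.mem_filter, Finset.mem_univ, true_and, Finset.mem_union]
    split_ifs <;> omega
  · rw [Finset.disjoint_filter]
    intro x _ h1 h2
    split_ifs at h1 h2 <;> omega

/-- If `process` does not call `compute`, then the threshold is right. -/
theorem Node.minimal_of_not {r : Fin n → ℕ} {N : ℕ} {c : Fin n → ℕ} {ks : List ℕ}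
    {B D : List (Entry n)} {k m pot : ℕ} (h : Node r N c ks B D k m pot)
    (hn : ¬ (B.length + D.length ≤ N ∧ m = 0)) : Minimal r N c ks k := by
  intro k' hk' hcard
  by_contra hlt
  by_cases hm : m = 0
  · have hlen : ¬ B.length + D.length ≤ N := fun hl => hn ⟨hl, hm⟩
    -- `B` alone has at most `N` entries. An empty `D` may mean that it was never computed, whereas
    -- a non-empty one is valid by the invariant.
    have hD : D ≠ [] := by
      rintro rfl
      exact hlen (by simpa using h.length_le)
    obtain ⟨-, hv⟩ := h.dep hD
    obtain ⟨q, rfl⟩ : ∃ q, k = q + 1 := ⟨k - 1, by omega⟩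
    have := card_eq_length_add_length h.lists hv
    refine hlen (this ▸ le_trans (Finset.card_le_card fun x => ?_) hcard)
    simp only [Finset.mem_filter, Finset.mem_univ, true_and]
    exact fun hx => ⟨by omega, hx.2⟩
  -- A neighbour with threshold `k` forbids every smaller threshold.
  · have hk : k ∈ ks := by
      by_contra hk
      exact hm (by rw [h.ties, List.count_eq_zero.2 hk])
    exact hlt (hk' k hk)

theorem Node.card_le {r : Fin n → ℕ} {N : ℕ} {c : Fin n → ℕ} {ks : List ℕ}
    {B D : List (Entry n)} {k m pot : ℕ} (h : Node r N c ks B D k m pot) :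
    (Finset.univ.filter fun x => k ≤ r x ∧ 0 < c x).card ≤ N := by
  refine le_trans (le_of_eq ?_) h.length_le
  rw [h.lists.length_eq]
  congr 1
  ext x
  simp only [Finset.mem_filter, Finset.mem_univ, true_and]
  split_ifs with hx <;> simp [hx]

theorem Node.mem_keys {r : Fin n → ℕ} {N : ℕ} {c : Fin n → ℕ} {ks : List ℕ}
    {B D : List (Entry n)} {k m pot : ℕ} (h : Node r N c ks B D k m pot) {x : Fin n} :
    x ∈ keys B ↔ k ≤ r x ∧ 0 < c x := by
  rw [h.lists.mem_keys]
  split_ifs with hx <;> simp [hx]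

/-- The effect of calling `compute` in `process`. -/
theorem Node.recompute {r : Fin n → ℕ} {N : ℕ} {c : Fin n → ℕ} {ks : List ℕ}
    {B D : List (Entry n)} {k m pot : ℕ} (h : Node r N c ks B D k m pot)
    (hcond : B.length + D.length ≤ N ∧ m = 0)
    {B₁ D₁ : List (Entry n)} {k₁ m₁ : ℕ} (h₁ : Node r N c ks B₁ D₁ k₁ m₁ (2 * k₁ + 1))
    (hval : m₁ = 0 → DepValid r c ks D₁ k₁) (hmin : Minimal r N c ks k₁) :
    k₁ ≤ k ∧ ∃ pot₁, Node r N c ks B₁ D₁ k₁ m₁ pot₁ ∧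
      (pot₁ + 1 ≤ pot ∨ (pot₁ = pot ∧ k₁ = k ∧ ks = [])) := by
  -- The old threshold is still admissible, so recomputation never raises it.
  have hle : k₁ ≤ k := hmin k h.le h.card_le
  refine ⟨hle, ?_⟩
  have hp := h.pot_le
  -- If the threshold drops, even the reset potential `2 * k₁ + 1` is below `2 * k`. If it stays,
  -- the new `D` is valid and the potential may be set to `2 * k₁`, which is a gain unless it had
  -- this value before.
  rcases hle.lt_or_eq with hlt | rfl
  · exact ⟨2 * k₁ + 1, h₁, Or.inl (by omega)⟩
  · have hm : m₁ = 0 := by rw [h₁.ties, ← h.ties, hcond.2]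
    have hv := hval hm
    have hnode : Node r N c ks B₁ D₁ k₁ m₁ (2 * k₁) :=
      ⟨h₁.lists, h₁.sorted, h₁.length_le, h₁.le, h₁.ties, h₁.dep, le_rfl, fun _ => hv⟩
    rcases hp.lt_or_eq with hlt | heq
    · exact ⟨2 * k₁, hnode, Or.inl (by omega)⟩
    -- Here the old `D` was valid, so the length test says that `k₁ - 1` is admissible; minimality
    -- leaves only `k₁ = 0`. As no neighbour has threshold `0` and none has a larger one, there are
    -- no neighbours.
    · refine ⟨2 * k₁, hnode, Or.inr ⟨heq, rfl, ?_⟩⟩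
      obtain ⟨v1, v2⟩ := h.pot_eq heq.symm
      have hk0 : k₁ = 0 := by
        by_contra hne
        obtain ⟨q, rfl⟩ : ∃ q, k₁ = q + 1 := ⟨k₁ - 1, by omega⟩
        have hcard := card_eq_length_add_length h.lists v2
        have := hmin q (fun κ hκ => ?_) (by omega)
        · omega
        · have h1 := h.le κ hκ
          have h2 : κ ≠ q + 1 := by rintro rfl; exact v1 hκ
          omega
      subst hk0
      by_contra hne
      obtain ⟨κ, hκ⟩ := List.exists_mem_of_ne_nil ks hne
      have := h.le κ hκ
      exact v1 (by rwa [Nat.le_zero.1 this] at hκ)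

/-! ### Changing the lists of one neighbour -/

theorem mult_congr {A : List (Fin n)} {X X' : Fin n → List (Fin n)} {v x : Fin n}
    (h : ∀ w ∈ A, (x ∈ X' w ↔ x ∈ X w)) : mult A X' v x = mult A X v x := by
  unfold mult
  congr 1
  exact List.countP_congr fun w hw => by simpa using h w hw

/-- Only the contribution of `w` changes. The terms are moved to both sides so that no truncated
subtraction occurs. -/
theorem mult_change {A : List (Fin n)} (hA : A.Nodup) {w : Fin n} (hw : w ∈ A)
    {X X' : Fin n → List (Fin n)} {v x : Fin n}
    (h : ∀ y, y ≠ w → (x ∈ X' y ↔ x ∈ X y)) :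
    mult A X' v x + (if x ∈ X w then 1 else 0) = mult A X v x + if x ∈ X' w then 1 else 0 := by
  have hperm := List.perm_cons_erase hw
  have hc := hperm.countP_eq (fun y => decide (x ∈ X y))
  have hc' := hperm.countP_eq (fun y => decide (x ∈ X' y))
  have he : (A.erase w).countP (fun y => decide (x ∈ X' y)) =
      (A.erase w).countP (fun y => decide (x ∈ X y)) := by
    refine List.countP_congr fun y hy => ?_
    have : y ≠ w := by
      rintro rfl
      exact (List.Nodup.not_mem_erase hA) hy
    simpa using h y this
  unfold mult
  rw [hc, hc', List.countP_cons, List.countP_cons, he]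
  simp only [decide_eq_true_eq]
  omega

theorem mult_erase {A : List (Fin n)} {w : Fin n} (hw : w ∈ A)
    (X : Fin n → List (Fin n)) (v x : Fin n) :
    mult (A.erase w) X v x = mult A X v x - if x ∈ X w then 1 else 0 := by
  have hc := (List.perm_cons_erase hw).countP_eq (fun y => decide (x ∈ X y))
  unfold mult
  rw [hc, List.countP_cons]
  simp only [decide_eq_true_eq]
  split_ifs <;> omega

theorem count_map_erase {A : List (Fin n)} {w : Fin n} (hw : w ∈ A) (K : Fin n → ℕ) (k : ℕ) :
    ((A.erase w).map K).count k = (A.map K).count k - if K w = k then 1 else 0 := by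
  have hc := ((List.perm_cons_erase hw).map K).count_eq k
  rw [hc, List.map_cons, List.count_cons]
  by_cases h : K w = k <;> simp [h]

theorem count_map_change {A : List (Fin n)} (hA : A.Nodup) {w : Fin n} (hw : w ∈ A)
    {K K' : Fin n → ℕ} (h : ∀ y, y ≠ w → K' y = K y) (k : ℕ) :
    (A.map K').count k + (if K w = k then 1 else 0) =
      (A.map K).count k + if K' w = k then 1 else 0 := by
  have hc := ((List.perm_cons_erase hw).map K).count_eq k
  have hc' := ((List.perm_cons_erase hw).map K').count_eq k
  have he : (A.erase w).map K' = (A.erase w).map K := by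
    refine List.map_congr_left fun y hy => h y ?_
    rintro rfl
    exact (List.Nodup.not_mem_erase hA) hy
  rw [hc, hc', List.map_cons, List.map_cons, List.count_cons, List.count_cons, he]
  simp only [beq_iff_eq]
  omega

end KHCore

namespace KHCore

variable {n : ℕ}

/-! ## Invariants of the memory -/

/-- The nodes that were removed from a buffer of `v` according to the entries of a stack. -/
def pend (W : Stack n) (v : Fin n) : List (Fin n) :=
  (W.filter fun e => decide (e.1 = v)).flatMap Prod.snd

theorem pend_nil (v : Fin n) : pend ([] : Stack n) v = [] := rfl

theorem pend_cons_self (v : Fin n) (Y : List (Fin n)) (W : Stack n) :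
    pend ((v, Y) :: W) v = Y ++ pend W v := by simp [pend]

theorem pend_cons_ne {v x : Fin n} (h : v ≠ x) (Y : List (Fin n)) (W : Stack n) :
    pend ((v, Y) :: W) x = pend W x := by simp [pend, h]

/-- The nodes which the neighbours of `v` believe to be in `B[v, i]`. -/
def vis (W : Stack n) (s : Store n) (i : ℕ) (v : Fin n) : List (Fin n) :=
  keys (s.buf v i) ++ pend W v

theorem vis_nil (s : Store n) (i : ℕ) (v : Fin n) : vis [] s i v = keys (s.buf v i) := by
  simp [vis, pend]

/-- The data of `v` at level `i + 1` are consistent with what is visible of level `i`. -/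
def NodeAt (r : Fin n → ℕ) (N : ℕ) (A : Fin n → List (Fin n)) (W : Stack n)
    (pot : Fin n → ℕ → ℕ) (s : Store n) (i : ℕ) (v : Fin n) : Prop :=
  Node r N (mult (A v) (vis W s i) v) ((A v).map fun w => s.lvl w i)
    (s.buf v (i + 1)) (s.dep v (i + 1)) (s.lvl v (i + 1)) (s.ties v (i + 1)) (pot v (i + 1))

def MinimalAt (r : Fin n → ℕ) (N : ℕ) (A : Fin n → List (Fin n)) (W : Stack n)
    (s : Store n) (i : ℕ) (v : Fin n) : Prop :=
  Minimal r N (mult (A v) (vis W s i) v) ((A v).map fun w => s.lvl w i) (s.lvl v (i + 1))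

/-- The invariant of the levels up to `h`, for the nodes in `S`; the adjacency lists that are relevant
for the step from level `i` to level `i + 1` are `A i`, and the stack of level `i` is `W i`. -/
structure Levels (r : Fin n → ℕ) (N h : ℕ) (S : Finset (Fin n))
    (A : ℕ → Fin n → List (Fin n)) (W : ℕ → Stack n) (pot : Fin n → ℕ → ℕ) (s : Store n) :
    Prop where
  node : ∀ i < h, ∀ v ∈ S, NodeAt r N (A i) (W i) pot s i v
  minimal : ∀ i < h, ∀ v ∈ S, v ∉ (W (i + 1)).map Prod.fst → MinimalAt r N (A i) (W i) s i v
  nodup : ∀ i ≤ h, ∀ v ∈ S, (vis (W i) s i v).Nodup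
  rank : ∀ i ≤ h, ∀ v ∈ S, ∀ x ∈ pend (W i) v, s.lvl v i ≤ r x
  stack_mem : ∀ i, ∀ v ∈ (W i).map Prod.fst, v ∈ S
  base_buf : ∀ v ∈ S, s.buf v 0 = [(v, 1)]
  base_lvl : ∀ v ∈ S, s.lvl v 0 = 0
  base_stack : W 0 = []
  top_stack : ∀ i, h < i → W i = []

theorem write_same {α : Type} (f : Fin n → ℕ → α) (v : Fin n) (i : ℕ) (x : α) :
    write f v i x v i = x := by simp [write]

theorem write_ne {α : Type} (f : Fin n → ℕ → α) {v v' : Fin n} {i i' : ℕ} (x : α)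
    (h : v' ≠ v ∨ i' ≠ i) : write f v i x v' i' = f v' i' := by
  unfold write
  rw [if_neg]
  tauto

theorem write_self {α : Type} (f : Fin n → ℕ → α) (v : Fin n) (i : ℕ) :
    write f v i (f v i) = f := by
  funext v' i'
  unfold write
  split_ifs with h
  · rw [h.1, h.2]
  · rfl

theorem notify_val (j : ℕ) (Y : List (Fin n)) (old : Option ℕ) (w : Fin n) (s : Store n)
    (W : Stack n) {B D : List (Entry n)} {Z : List (Fin n)}
    (h : Y.foldl (fun (BDZ : List (Entry n) × List (Entry n) × List (Fin n)) y =>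
        (decrease y BDZ.1, decrease y BDZ.2.1,
          if (y, 1) ∈ BDZ.1 then y :: BDZ.2.2 else BDZ.2.2))
        (s.buf w (j + 1), s.dep w (j + 1), []) = (B, D, Z)) :
    (notify j Y old w (s, W)).val = ({ s with
      buf := write s.buf w (j + 1) B
      dep := write s.dep w (j + 1) D
      ties := write s.ties w (j + 1)
        (if old = some (s.lvl w (j + 1)) then s.ties w (j + 1) - 1 else s.ties w (j + 1)) },
    (w, Z) :: W) := by
  simp only [notify, bind_val, forEach_pure_val, h]
  rfl

theorem notify_steps (j : ℕ) (Y : List (Fin n)) (old : Option ℕ) (w : Fin n)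
    (sW : Store n × Stack n) : (notify j Y old w sW).steps = 1 + Y.length := by
  simp only [notify, bind_steps, forEach_pure_steps, pure_steps, tick_steps]
  omega

/-- A node or a deleted node informs the nodes in `L`. -/
theorem notify_loop {r : Fin n → ℕ} {N : ℕ} {s : Store n} {W : Stack n} {S : Finset (Fin n)}
    {j : ℕ} {Y : List (Fin n)} (hY : Y.Nodup) {old : Option ℕ} {L : List (Fin n)}
    (hL : L.Nodup) (hLS : ∀ x ∈ L, x ∈ S) {c c' : Fin n → Fin n → ℕ} {ks ks' : Fin n → List ℕ}
    {pot : Fin n → ℕ → ℕ}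
    (hnode : ∀ x ∈ S, Node r N (c x) (ks x) (s.buf x (j + 1)) (s.dep x (j + 1))
      (s.lvl x (j + 1)) (s.ties x (j + 1)) (pot x (j + 1)))
    (hc : ∀ x ∈ L, ∀ y, s.lvl x (j + 1) ≤ r y → c' x y = c x y - if y ∈ Y then 1 else 0)
    (hc' : ∀ x ∈ L, s.lvl x (j + 1) ∉ ks x → ∀ y, r y + 1 = s.lvl x (j + 1) →
      c' x y = c x y - if y ∈ Y then 1 else 0)
    (hle : ∀ x ∈ L, ∀ κ ∈ ks' x, κ ≤ s.lvl x (j + 1))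
    (hcount : ∀ x ∈ L, (ks' x).count (s.lvl x (j + 1)) =
      if old = some (s.lvl x (j + 1)) then (ks x).count (s.lvl x (j + 1)) - 1
        else (ks x).count (s.lvl x (j + 1)))
    (hout : ∀ x ∈ S, x ∉ L → c' x = c x ∧ ks' x = ks x) :
    ∃ buf dep ties W', (forEach (notify j Y old) L (s, W)).val =
        ({ s with buf := buf, dep := dep, ties := ties }, W') ∧
      (∀ x ∈ S, Node r N (c' x) (ks' x) (buf x (j + 1)) (dep x (j + 1))
        (s.lvl x (j + 1)) (ties x (j + 1)) (pot x (j + 1))) ∧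
      (∀ x i, (x ∉ L ∨ i ≠ j + 1) → buf x i = s.buf x i ∧ dep x i = s.dep x i ∧
        ties x i = s.ties x i) ∧
      (∀ x, (keys (buf x (j + 1)) ++ pend W' x).Perm
        (keys (s.buf x (j + 1)) ++ pend W x)) ∧
      (∀ x, (keys (buf x (j + 1))).Sublist (keys (s.buf x (j + 1)))) ∧
      W'.length = W.length + L.length ∧
      (∀ x, x ∈ W'.map Prod.fst ↔ x ∈ L ∨ x ∈ W.map Prod.fst) ∧
      (forEach (notify j Y old) L (s, W)).steps = L.length * (Y.length + 2) := by
  -- Nodes outside the remaining part `R` already fit the new counters. `P` records which nodes have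
  -- been visited, so that the data of those in `R` are known to be untouched.
  have key := forEach_rule (body := notify j Y old)
    (fun R sW t => ∃ P, L = P ++ R ∧ ∃ buf dep ties W',
      sW = ({ s with buf := buf, dep := dep, ties := ties }, W') ∧
      (∀ x ∈ S, x ∉ R → Node r N (c' x) (ks' x) (buf x (j + 1)) (dep x (j + 1))
        (s.lvl x (j + 1)) (ties x (j + 1)) (pot x (j + 1))) ∧
      (∀ x i, (x ∉ P ∨ i ≠ j + 1) → buf x i = s.buf x i ∧ dep x i = s.dep x i ∧
        ties x i = s.ties x i) ∧
      (∀ x, (keys (buf x (j + 1)) ++ pend W' x).Perm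
        (keys (s.buf x (j + 1)) ++ pend W x)) ∧
      (∀ x, (keys (buf x (j + 1))).Sublist (keys (s.buf x (j + 1)))) ∧
      W'.length = W.length + P.length ∧
      (∀ x, x ∈ W'.map Prod.fst ↔ x ∈ P ∨ x ∈ W.map Prod.fst) ∧
      t = P.length * (Y.length + 2))
    ?_ L (s, W) 0 ?_
  · obtain ⟨P, hP, buf, dep, ties, W', h1, h2, h3, h4, h5, h6, h7, h8⟩ := key
    rw [List.append_nil] at hP
    subst hP
    exact ⟨buf, dep, ties, W', h1, fun x hx => h2 x hx (by simp), h3, h4, h5, h6, h7,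
      by rw [← h8, zero_add]⟩
  · rintro w R sW t ⟨P, hP, buf, dep, ties, W', rfl, h2, h3, h4, h5, h6, h7, h8⟩
    have hw : w ∈ L := by rw [hP]; simp
    have hnd : (P ++ w :: R).Nodup := hP ▸ hL
    have hwP : w ∉ P := fun h => (List.nodup_append.1 hnd).2.2 w h w (by simp) rfl
    have hwR : w ∉ R := (List.nodup_cons.1 (List.nodup_append.1 hnd).2.1).1
    obtain ⟨e1, e2, e3⟩ := h3 w (j + 1) (Or.inl hwP)
    obtain ⟨B', D', Z, f1, f2, f3, f4⟩ := (hnode w (hLS w hw)).notify hY (hc w hw) (hc' w hw)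
      (hle w hw) (hcount w hw)
    refine ⟨P ++ [w], by simp [hP], write buf w (j + 1) B', write dep w (j + 1) D',
      write ties w (j + 1) (if old = some (s.lvl w (j + 1)) then s.ties w (j + 1) - 1
        else s.ties w (j + 1)), (w, Z) :: W', ?_, ?_, ?_, ?_, ?_, ?_, ?_, ?_⟩
    · rw [notify_val (B := B') (D := D') (Z := Z)]
      · simp only [e3]
      · simpa only [e1, e2] using f1
    · intro x hx hxR
      by_cases hxw : x = w
      · subst hxw
        simp only [write_same]
        exact f2
      · rw [write_ne _ _ (Or.inl hxw), write_ne _ _ (Or.inl hxw), write_ne _ _ (Or.inl hxw)]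
        exact h2 x hx (by simp [hxw, hxR])
    · intro x i hxi
      have hne : x ≠ w ∨ i ≠ j + 1 := by
        rcases hxi with h | h
        · left; rintro rfl; exact h (by simp)
        · exact Or.inr h
      rw [write_ne _ _ hne, write_ne _ _ hne, write_ne _ _ hne]
      exact h3 x i (hxi.imp_left fun h h' => h (by simp [h']))
    · intro x
      by_cases hxw : x = w
      · subst hxw
        rw [write_same, pend_cons_self, ← List.append_assoc]
        refine List.Perm.trans ?_ (h4 x)
        rw [e1]
        exact f3.symm.append_right _
      · rw [write_ne _ _ (Or.inl hxw), pend_cons_ne (Ne.symm hxw)]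
        exact h4 x
    · intro x
      by_cases hxw : x = w
      · subst hxw
        rw [write_same]
        exact f4
      · rw [write_ne _ _ (Or.inl hxw)]
        exact h5 x
    · simp only [List.length_cons, List.length_append, List.length_nil, h6]
      omega
    · intro x
      simp only [List.map_cons, List.mem_cons, h7, List.mem_append, List.not_mem_nil, or_false]
      tauto
    · rw [notify_steps, h8, List.length_append, List.length_singleton]
      ring
  · refine ⟨[], rfl, s.buf, s.dep, s.ties, W, rfl, fun x hx hxL => ?_, fun _ _ _ => ⟨rfl, rfl, rfl⟩,
      fun _ => List.Perm.refl _, fun _ => List.Sublist.refl _, rfl, by simp, by simp⟩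
    obtain ⟨o1, o2⟩ := hout x hx hxL
    rw [o1, o2]
    exact hnode x hx

end KHCore

/-! ### Preservation of the invariant when one stack entry is processed -/

namespace KHCore

variable {n : ℕ}

/-- Only membership in the visible lists matters, so permuting them, as `notify` does when it moves
nodes from a buffer to the stack, is harmless. -/
theorem NodeAt.congr {r : Fin n → ℕ} {N : ℕ} {A : Fin n → List (Fin n)} {W W' : Stack n}
    {pot pot' : Fin n → ℕ → ℕ} {s s' : Store n} {i : ℕ} {v : Fin n}
    (h : NodeAt r N A W pot s i v)
    (hvis : ∀ w ∈ A v, ∀ x, x ∈ vis W' s' i w ↔ x ∈ vis W s i w)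
    (hlvl : ∀ w ∈ A v, s'.lvl w i = s.lvl w i)
    (hbuf : s'.buf v (i + 1) = s.buf v (i + 1)) (hdep : s'.dep v (i + 1) = s.dep v (i + 1))
    (hlvl' : s'.lvl v (i + 1) = s.lvl v (i + 1)) (hties : s'.ties v (i + 1) = s.ties v (i + 1))
    (hpot : pot' v (i + 1) = pot v (i + 1)) : NodeAt r N A W' pot' s' i v := by
  have h1 : mult (A v) (vis W' s' i) v = mult (A v) (vis W s i) v :=
    funext fun x => mult_congr fun w hw => hvis w hw x
  have h2 : (A v).map (fun w => s'.lvl w i) = (A v).map fun w => s.lvl w i :=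
    List.map_congr_left hlvl
  unfold NodeAt
  rw [h1, h2, hbuf, hdep, hlvl', hties, hpot]
  exact h

theorem MinimalAt.congr {r : Fin n → ℕ} {N : ℕ} {A : Fin n → List (Fin n)} {W W' : Stack n}
    {s s' : Store n} {i : ℕ} {v : Fin n}
    (h : MinimalAt r N A W s i v)
    (hvis : ∀ w ∈ A v, ∀ x, x ∈ vis W' s' i w ↔ x ∈ vis W s i w)
    (hlvl : ∀ w ∈ A v, s'.lvl w i = s.lvl w i)
    (hlvl' : s'.lvl v (i + 1) = s.lvl v (i + 1)) : MinimalAt r N A W' s' i v := by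
  have h1 : mult (A v) (vis W' s' i) v = mult (A v) (vis W s i) v :=
    funext fun x => mult_congr fun w hw => hvis w hw x
  have h2 : (A v).map (fun w => s'.lvl w i) = (A v).map fun w => s.lvl w i :=
    List.map_congr_left hlvl
  unfold MinimalAt
  rw [h1, h2, hlvl']
  exact h

/-- The buffer of `v` at level `j + 1` has been recomputed, the entry `(v, Y)` has been popped, and
the neighbours of `v` have been informed. -/
theorem Levels.step {r : Fin n → ℕ} {N h : ℕ} {S : Finset (Fin n)}
    {A : ℕ → Fin n → List (Fin n)} {W : ℕ → Stack n} {pot : Fin n → ℕ → ℕ} {s : Store n}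
    (H : Levels r N h S A W pot s) {j : ℕ} (hj : j < h) {v : Fin n}
    {Y : List (Fin n)} {R : Stack n} (hW : W (j + 1) = (v, Y) :: R)
    {B₁ D₁ : List (Entry n)} {k₁ m₁ pot₁ : ℕ}
    (node₁ : Node r N (mult (A j v) (vis (W j) s j) v) ((A j v).map fun w => s.lvl w j)
      B₁ D₁ k₁ m₁ pot₁)
    (min₁ : Minimal r N (mult (A j v) (vis (W j) s j) v) ((A j v).map fun w => s.lvl w j) k₁)
    (hk : k₁ ≤ s.lvl v (j + 1)) {s' : Store n} {W₂ : Stack n}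
    (hlvl : s'.lvl = write s.lvl v (j + 1) k₁)
    (hv : s'.buf v (j + 1) = B₁ ∧ s'.dep v (j + 1) = D₁ ∧ s'.ties v (j + 1) = m₁)
    (hne : ∀ x i, i ≠ j + 2 → (x ≠ v ∨ i ≠ j + 1) →
      s'.buf x i = s.buf x i ∧ s'.dep x i = s.dep x i ∧ s'.ties x i = s.ties x i)
    (hperm : ∀ x, (vis W₂ s' (j + 2) x).Perm (vis (W (j + 2)) s (j + 2) x))
    (hW₂ : ∀ x ∈ W₂.map Prod.fst, x ∈ S) (hW₂' : h < j + 2 → W₂ = [])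
    (node₂ : j + 1 < h → ∀ x ∈ S,
      NodeAt r N (A (j + 1)) R (write pot v (j + 1) pot₁) s' (j + 1) x)
    (min₂ : j + 1 < h → ∀ x ∈ S, x ∉ W₂.map Prod.fst → MinimalAt r N (A (j + 1)) R s' (j + 1) x) :
    Levels r N h S A (Function.update (Function.update W (j + 1) R) (j + 2) W₂)
      (write pot v (j + 1) pot₁) s' := by
  set W' := Function.update (Function.update W (j + 1) R) (j + 2) W₂ with hW'
  have w1 : W' (j + 1) = R := by simp [hW']
  have w2 : W' (j + 2) = W₂ := by simp [hW']
  have w3 : ∀ i, i ≠ j + 1 → i ≠ j + 2 → W' i = W i := fun i h1 h2 => by simp [hW', h1, h2]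
  have hvS : v ∈ S := H.stack_mem (j + 1) v (by simp [hW])
  have hlv : s'.lvl v (j + 1) = k₁ := by rw [hlvl, write_same]
  have hln : ∀ x i, (x ≠ v ∨ i ≠ j + 1) → s'.lvl x i = s.lvl x i := fun x i hx => by
    rw [hlvl, write_ne _ _ hx]
  -- Visible lists change at level `j + 1` only: at level `j + 2` nodes merely move from buffers to
  -- the stack.
  have hvis : ∀ i, i ≠ j + 1 → ∀ x, (vis (W' i) s' i x).Perm (vis (W i) s i x) := by
    intro i hi x
    by_cases h2 : i = j + 2
    · subst h2
      rw [w2]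
      exact hperm x
    · rw [w3 i hi h2]
      unfold vis
      rw [(hne x i h2 (Or.inr hi)).1]
  have hvis₁ : ∀ x, x ≠ v → vis R s' (j + 1) x = vis (W (j + 1)) s (j + 1) x := by
    intro x hx
    unfold vis
    rw [(hne x (j + 1) (by omega) (Or.inl hx)).1, hW, pend_cons_ne (Ne.symm hx)]
  have hold := H.node j hj v hvS
  -- Old and new buffer come from the same counters and differ only in their thresholds, so they
  -- agree at ranks not below the old one.
  have hkey : ∀ x, s.lvl v (j + 1) ≤ r x → (x ∈ keys B₁ ↔ x ∈ keys (s.buf v (j + 1))) := by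
    intro x hx
    rw [node₁.mem_keys, Node.mem_keys hold]
    constructor
    · exact fun h => ⟨hx, h.2⟩
    · exact fun h => ⟨hk.trans hx, h.2⟩
  have hndv := H.nodup (j + 1) hj v hvS
  have hrkv := H.rank (j + 1) hj v hvS
  rw [vis, hW, pend_cons_self] at hndv
  rw [hW, pend_cons_self] at hrkv
  refine ⟨?_, ?_, ?_, ?_, ?_, ?_, ?_, ?_, ?_⟩
  · intro i hi x hx
    by_cases h1 : i = j + 1
    · subst h1
      rw [w1]
      exact node₂ hi x hx
    · by_cases h2 : i = j ∧ x = v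
      · obtain ⟨rfl, rfl⟩ := h2
        have e1 : mult (A i x) (vis (W' i) s' i) x = mult (A i x) (vis (W i) s i) x :=
          funext fun y => mult_congr fun w _ => (hvis i h1 w).mem_iff
        have e2 : (A i x).map (fun w => s'.lvl w i) = (A i x).map fun w => s.lvl w i :=
          List.map_congr_left fun w _ => hln w i (Or.inr (by omega))
        unfold NodeAt
        rw [e1, e2, hv.1, hv.2.1, hv.2.2, hlv, write_same]
        exact node₁
      · have h3 : x ≠ v ∨ i + 1 ≠ j + 1 := by
          by_contra hcon
          push Not at hcon
          exact h2 ⟨by omega, hcon.1⟩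
        obtain ⟨e1, e2, e3⟩ := hne x (i + 1) (by omega) h3
        exact (H.node i hi x hx).congr (fun w _ y => (hvis i h1 w).mem_iff)
          (fun w _ => hln w i (Or.inr h1)) e1 e2 (hln x (i + 1) h3) e3 (write_ne _ _ h3)
  · intro i hi x hx hxW
    by_cases h1 : i = j + 1
    · subst h1
      rw [w1]
      rw [w2] at hxW
      exact min₂ hi x hx hxW
    · by_cases h2 : i = j ∧ x = v
      · obtain ⟨rfl, rfl⟩ := h2
        have e1 : mult (A i x) (vis (W' i) s' i) x = mult (A i x) (vis (W i) s i) x :=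
          funext fun y => mult_congr fun w _ => (hvis i h1 w).mem_iff
        have e2 : (A i x).map (fun w => s'.lvl w i) = (A i x).map fun w => s.lvl w i :=
          List.map_congr_left fun w _ => hln w i (Or.inr (by omega))
        unfold MinimalAt
        rw [e1, e2, hlv]
        exact min₁
      · have h3 : x ≠ v ∨ i + 1 ≠ j + 1 := by
          by_contra hcon
          push Not at hcon
          exact h2 ⟨by omega, hcon.1⟩
        refine (H.minimal i hi x hx ?_).congr (fun w _ y => (hvis i h1 w).mem_iff)
          (fun w _ => hln w i (Or.inr h1)) (hln x (i + 1) h3)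
        by_cases h4 : i = j
        · subst h4
          rw [w1] at hxW
          rw [hW, List.map_cons, List.mem_cons, not_or]
          exact ⟨fun h => h2 ⟨rfl, h⟩, hxW⟩
        · rwa [w3 (i + 1) (by omega) (by omega)] at hxW
  · intro i hi x hx
    by_cases h1 : i = j + 1
    · subst h1
      rw [w1]
      by_cases hxv : x = v
      · subst hxv
        rw [vis, hv.1, List.nodup_append]
        refine ⟨node₁.lists.nodup, ?_, ?_⟩
        · exact (List.nodup_append.1 (List.nodup_append.1 hndv).2.1).2.1
        -- A pending node has rank at least the old threshold; if it were in the new buffer, it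
        -- would have been in the old one too, contrary to the old visible list being free of
        -- repetitions.
        · rintro a ha b hb rfl
          have h5 := hrkv a (List.mem_append.2 (Or.inr hb))
          rw [hkey a h5] at ha
          exact (List.nodup_append.1 hndv).2.2 a ha a (List.mem_append.2 (Or.inr hb)) rfl
      · rw [hvis₁ x hxv]
        exact H.nodup (j + 1) hi x hx
    · exact (hvis i h1 x).nodup_iff.2 (H.nodup i hi x hx)
  · intro i hi x hx y hy
    by_cases h1 : i = j + 1
    · subst h1
      rw [w1] at hy
      by_cases hxv : x = v
      · subst hxv
        rw [hlv]
        exact hk.trans (hrkv y (List.mem_append.2 (Or.inr hy)))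
      · rw [hln x _ (Or.inl hxv)]
        refine H.rank (j + 1) hi x hx y ?_
        rwa [hW, pend_cons_ne (Ne.symm hxv)]
    · rw [hln x _ (Or.inr h1)]
      by_cases h2 : i = j + 2
      · subst h2
        rw [w2] at hy
        have h3 : y ∈ vis (W (j + 2)) s (j + 2) x :=
          (hperm x).mem_iff.1 (List.mem_append.2 (Or.inr hy))
        rcases List.mem_append.1 h3 with h4 | h4
        · exact ((Node.mem_keys (H.node (j + 1) (by omega) x hx)).1 h4).1
        · exact H.rank _ hi x hx y h4
      · rw [w3 i h1 h2] at hy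
        exact H.rank _ hi x hx y hy
  · intro i x hx
    by_cases h1 : i = j + 1
    · subst h1
      rw [w1] at hx
      exact H.stack_mem (j + 1) x (by rw [hW]; simp [hx])
    · by_cases h2 : i = j + 2
      · subst h2
        rw [w2] at hx
        exact hW₂ x hx
      · rw [w3 i h1 h2] at hx
        exact H.stack_mem i x hx
  · intro x hx
    rw [(hne x 0 (by omega) (Or.inr (by omega))).1]
    exact H.base_buf x hx
  · intro x hx
    rw [hln x 0 (Or.inr (by omega))]
    exact H.base_lvl x hx
  · rw [w3 0 (by omega) (by omega)]
    exact H.base_stack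
  · intro i hi
    by_cases h2 : i = j + 2
    · subst h2
      rw [w2]
      exact hW₂' hi
    · rw [w3 i (by omega) h2]
      exact H.top_stack i hi

/-- The visible changes at level `j + 1` after the entry `(v, Y)` has been popped. -/
theorem Levels.change {r : Fin n → ℕ} {N h : ℕ} {S : Finset (Fin n)}
    {A : ℕ → Fin n → List (Fin n)} {W : ℕ → Stack n} {pot : Fin n → ℕ → ℕ} {s : Store n}
    (H : Levels r N h S A W pot s) {j : ℕ} (hj : j < h) {v : Fin n}
    {Y : List (Fin n)} {R : Stack n} (hW : W (j + 1) = (v, Y) :: R)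
    {B₁ D₁ : List (Entry n)} {k₁ m₁ pot₁ : ℕ}
    (node₁ : Node r N (mult (A j v) (vis (W j) s j) v) ((A j v).map fun w => s.lvl w j)
      B₁ D₁ k₁ m₁ pot₁)
    (hk : k₁ ≤ s.lvl v (j + 1)) {s' : Store n}
    (hv : s'.buf v (j + 1) = B₁)
    (hne : ∀ x, x ≠ v → s'.buf x (j + 1) = s.buf x (j + 1)) :
    (∀ x, x ≠ v → vis R s' (j + 1) x = vis (W (j + 1)) s (j + 1) x) ∧
    (∀ y, s.lvl v (j + 1) ≤ r y → ((y ∈ vis (W (j + 1)) s (j + 1) v) ↔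
      (y ∈ Y ∨ y ∈ vis R s' (j + 1) v))) ∧
    (∀ y, s.lvl v (j + 1) ≤ r y → y ∈ Y → y ∉ vis R s' (j + 1) v) ∧
    (k₁ = s.lvl v (j + 1) → B₁.length = (s.buf v (j + 1)).length ∧
      ∀ y, y ∈ keys B₁ ↔ y ∈ keys (s.buf v (j + 1))) := by
  have hvS : v ∈ S := H.stack_mem (j + 1) v (by simp [hW])
  have hold := H.node j hj v hvS
  have hkey : ∀ x, s.lvl v (j + 1) ≤ r x → (x ∈ keys B₁ ↔ x ∈ keys (s.buf v (j + 1))) := by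
    intro x hx
    rw [node₁.mem_keys, Node.mem_keys hold]
    constructor
    · exact fun h => ⟨hx, h.2⟩
    · exact fun h => ⟨hk.trans hx, h.2⟩
  have hndv := H.nodup (j + 1) hj v hvS
  rw [vis, hW, pend_cons_self] at hndv
  refine ⟨fun x hx => ?_, fun y hy => ?_, fun y hy hyY hyv => ?_, fun hk' => ?_⟩
  · unfold vis
    rw [hne x hx, hW, pend_cons_ne (Ne.symm hx)]
  · unfold vis
    rw [hW, pend_cons_self, hv, List.mem_append, List.mem_append, List.mem_append, hkey y hy]
    tauto
  · rw [vis, hv, List.mem_append, hkey y hy] at hyv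
    rw [List.nodup_append] at hndv
    rcases hyv with h1 | h1
    · exact hndv.2.2 y h1 y (by simp [hyY]) rfl
    · exact (List.nodup_append.1 hndv.2.1).2.2 y hyY y h1 rfl
  · have h1 : ∀ y, y ∈ keys B₁ ↔ y ∈ keys (s.buf v (j + 1)) := fun y => by
      rw [node₁.mem_keys, Node.mem_keys hold, hk']
    refine ⟨?_, h1⟩
    have := (List.perm_ext_iff_of_nodup node₁.lists.nodup hold.lists.nodup).2 h1
    simpa using this.length_eq

end KHCore

namespace KHCore

variable {n : ℕ}

/-! ## The priority queue -/

/-- The number of nodes other than `v` in `B[v, h]`. -/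
def size (h : ℕ) (s : Store n) (v : Fin n) : ℕ := ((keys (s.buf v h)).erase v).length

/-- The bucket queue contains the nodes of `S`. -/
structure Queue (S : Finset (Fin n)) (s : Store n) : Prop where
  mem : ∀ p v, v ∈ s.bucket p ↔ v ∈ S ∧ s.key v = p
  nodup : ∀ p, (s.bucket p).Nodup
  key_lt : ∀ v ∈ S, s.key v < s.top
  ptr_le : ∀ v ∈ S, s.ptr ≤ s.key v

/-- The keys of the nodes are upper bounds, and up to date for nodes that are not on the stack. -/
structure Fresh (M : ℝ) (h : ℕ) (S : Finset (Fin n)) (W : Stack n) (s : Store n) : Prop where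
  le : ∀ v ∈ S, bucketIndex M (size h s v) (s.lvl v h) ≤ s.key v
  eq : ∀ v ∈ S, v ∉ W.map Prod.fst → s.key v = bucketIndex M (size h s v) (s.lvl v h) ∧
    s.est v = estimate M (size h s v) (s.lvl v h)

theorem requeue_spec {S : Finset (Fin n)} {s : Store n} (H : Queue S s) (M : ℝ) (h : ℕ)
    (v : Fin n) :
    ∃ bucket, (requeue M h v s).val = { s with
      est := Function.update s.est v (estimate M (size h s v) (s.lvl v h))
      bucket := bucket
      key := Function.update s.key v (bucketIndex M (size h s v) (s.lvl v h))
      ptr := min s.ptr (bucketIndex M (size h s v) (s.lvl v h))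
      top := max s.top (bucketIndex M (size h s v) (s.lvl v h) + 1) } ∧
    Queue (insert v S) (requeue M h v s).val ∧
    (requeue M h v s).steps = 1 + (bucketIndex M (size h s v) (s.lvl v h) + 1 - s.top) := by
  set p := bucketIndex M (size h s v) (s.lvl v h) with hp
  set bucket' := Function.update s.bucket (s.key v) ((s.bucket (s.key v)).erase v) with hb'
  have hval : (requeue M h v s).val = { s with
      est := Function.update s.est v (estimate M (size h s v) (s.lvl v h))
      bucket := Function.update bucket' p (v :: bucket' p)
      key := Function.update s.key v p
      ptr := min s.ptr p
      top := max s.top (p + 1) } := rfl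
  have hmem' : ∀ q x, x ∈ bucket' q ↔ x ∈ S ∧ x ≠ v ∧ s.key x = q := by
    intro q x
    by_cases hq : q = s.key v
    · subst hq
      rw [hb', Function.update_self, (H.nodup _).mem_erase_iff, H.mem]
      tauto
    · rw [hb', Function.update_of_ne hq, H.mem]
      constructor
      · rintro ⟨h1, rfl⟩
        exact ⟨h1, fun h2 => hq (by rw [h2]), rfl⟩
      · tauto
  have hnd' : ∀ q, (bucket' q).Nodup := by
    intro q
    by_cases hq : q = s.key v
    · subst hq
      rw [hb', Function.update_self]
      exact (H.nodup _).erase _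
    · rw [hb', Function.update_of_ne hq]
      exact H.nodup q
  refine ⟨_, hval, ?_, ?_⟩
  · rw [hval]
    refine ⟨fun q x => ?_, fun q => ?_, fun x hx => ?_, fun x hx => ?_⟩
    · dsimp only
      rw [Finset.mem_insert]
      by_cases hx : x = v
      · subst hx
        rw [Function.update_self]
        by_cases hq : q = p
        · subst hq
          simp
        · rw [Function.update_of_ne hq, hmem']
          simp [Ne.symm hq]
      · rw [Function.update_of_ne hx]
        by_cases hq : q = p
        · subst hq
          rw [Function.update_self, List.mem_cons, hmem']
          tauto
        · rw [Function.update_of_ne hq, hmem']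
          tauto
    · dsimp only
      by_cases hq : q = p
      · subst hq
        rw [Function.update_self, List.nodup_cons, hmem']
        exact ⟨fun h => h.2.1 rfl, hnd' _⟩
      · rw [Function.update_of_ne hq]
        exact hnd' q
    · dsimp only
      by_cases hxv : x = v
      · subst hxv
        rw [Function.update_self]
        omega
      · rw [Function.update_of_ne hxv]
        have := H.key_lt x ((Finset.mem_insert.1 hx).resolve_left hxv)
        omega
    · dsimp only
      by_cases hxv : x = v
      · subst hxv
        rw [Function.update_self]
        exact min_le_right _ _
      · rw [Function.update_of_ne hxv]
        have := H.ptr_le x ((Finset.mem_insert.1 hx).resolve_left hxv)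
        omega
  · have : (requeue M h v s).steps = 1 + ((touch (List.range (p + 1 - s.top))).steps + 0) := rfl
    rw [this, touch_steps, List.length_range]
    omega

/-! ## Processing an entry of the stack -/

/-- The potential which pays for future work. -/
def potential (N h : ℕ) (dg : Fin n → ℕ) (S : Finset (Fin n)) (W : ℕ → Stack n)
    (pot : Fin n → ℕ → ℕ) (s : Store n) : ℕ :=
  ∑ v ∈ S, ∑ i ∈ Finset.Icc 1 h,
      dg v * (37 * (N + 1) * pot v i + 9 * (vis (W i) s i v).length) +
    6 * ∑ i ∈ Finset.Icc 1 h, (W i).length + ∑ v ∈ S, s.key v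

/-- The additive form avoids subtraction in `ℕ` and can be handed to `omega` directly. -/
theorem sum_change {ι : Type*} [DecidableEq ι] {T : Finset ι} {a : ι} (ha : a ∈ T) {f g : ι → ℕ}
    (h : ∀ i ∈ T, i ≠ a → g i = f i) : ∑ i ∈ T, g i + f a = ∑ i ∈ T, f i + g a := by
  have h1 : ∑ i ∈ T.erase a, g i = ∑ i ∈ T.erase a, f i :=
    Finset.sum_congr rfl fun i hi => h i (Finset.mem_of_mem_erase hi) (Finset.ne_of_mem_erase hi)
  have h2 : f a + ∑ i ∈ T.erase a, f i = ∑ i ∈ T, f i := Finset.add_sum_erase T f ha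
  have h3 : g a + ∑ i ∈ T.erase a, g i = ∑ i ∈ T, g i := Finset.add_sum_erase T g ha
  omega

theorem sum_sum_change {ι κ : Type*} [DecidableEq ι] [DecidableEq κ] {S : Finset ι}
    {T : Finset κ} {a : ι} {b : κ}
    (ha : a ∈ S) (hb : b ∈ T) {f g : ι → κ → ℕ}
    (h : ∀ i ∈ S, ∀ j ∈ T, i ≠ a ∨ j ≠ b → g i j = f i j) :
    ∑ i ∈ S, ∑ j ∈ T, g i j + f a b = ∑ i ∈ S, ∑ j ∈ T, f i j + g a b := by
  have h1 := sum_change ha (f := fun i => ∑ j ∈ T, f i j) (g := fun i => ∑ j ∈ T, g i j)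
    fun i hi hia => Finset.sum_congr rfl fun j hj => h i hi j hj (Or.inl hia)
  have h2 := sum_change hb (f := f a) (g := g a) fun j hj hjb => h a ha j hj (Or.inr hjb)
  omega

theorem process_eq (r : Fin n → ℕ) (M : ℝ) (h j : ℕ) (v : Fin n) (Y : List (Fin n))
    (s : Store n) (W : Stack n) :
    process r M h j (v, Y) (s, W) =
      (tick >>= fun _ =>
        (if ((s.buf v (j + 1)).length + (s.dep v (j + 1)).length : ℝ) ≤ M ∧ s.ties v (j + 1) = 0
          then compute r M v j s else pure s) >>= fun s₁ =>
        (if j + 1 = h then requeue M h v s₁ else pure s₁) >>= fun s₂ =>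
        if j + 1 < h ∧ (Y ≠ [] ∨ s₂.lvl v (j + 1) ≠ s.lvl v (j + 1)) then
          forEach (notify (j + 1) Y (if s₂.lvl v (j + 1) ≠ s.lvl v (j + 1)
            then some (s.lvl v (j + 1)) else none)) (s₂.adj v) (s₂, W)
        else pure (s₂, W)) := by
  unfold process
  by_cases h1 : ((s.buf v (j + 1)).length + (s.dep v (j + 1)).length : ℝ) ≤ M ∧
      s.ties v (j + 1) = 0
  · by_cases h2 : j + 1 = h
    · simp only [if_pos h1, if_pos h2]
    · simp only [if_pos h1, if_neg h2]
  · by_cases h2 : j + 1 = h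
    · simp only [if_neg h1, if_pos h2]
    · simp only [if_neg h1, if_neg h2]

/-- Either a drop of the potential pays, or at most three steps are used and the threshold stays;
the second case covers both no call of `compute` and a call at a node without neighbours. The empty
stack at level `j` ensures that the buffers which `compute` reads are the visible lists of that
level. -/
theorem recompute_spec {r : Fin n → ℕ} {N h : ℕ} {M : ℝ} (hM : 0 ≤ M) (hN : ⌊M⌋₊ = N)
    (hN1 : 1 ≤ N) {S : Finset (Fin n)}
    {A : ℕ → Fin n → List (Fin n)} {W : ℕ → Stack n} {pot : Fin n → ℕ → ℕ} {s : Store n}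
    (H : Levels r N h S A W pot s) {j : ℕ} (hj : j < h) (hWj : W j = []) {v : Fin n} (hv : v ∈ S)
    (hadj : s.adj v = A j v) (hsub : ∀ w ∈ s.adj v, w ∈ S) {d : ℕ} (hd : (s.adj v).length ≤ d) :
    ∃ B D k m pot₁, ((if ((s.buf v (j + 1)).length + (s.dep v (j + 1)).length : ℝ) ≤ M ∧
          s.ties v (j + 1) = 0 then compute r M v j s else pure s) : Timed (Store n)).val =
        { s with
          buf := write s.buf v (j + 1) B
          lvl := write s.lvl v (j + 1) k
          ties := write s.ties v (j + 1) m
          dep := write s.dep v (j + 1) D } ∧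
      Node r N (mult (A j v) (vis (W j) s j) v) ((A j v).map fun w => s.lvl w j) B D k m pot₁ ∧
      Minimal r N (mult (A j v) (vis (W j) s j) v) ((A j v).map fun w => s.lvl w j) k ∧
      k ≤ s.lvl v (j + 1) ∧
      ((pot₁ + 1 ≤ pot v (j + 1) ∧
        ((if ((s.buf v (j + 1)).length + (s.dep v (j + 1)).length : ℝ) ≤ M ∧
          s.ties v (j + 1) = 0 then compute r M v j s else pure s) : Timed (Store n)).steps ≤
          20 * (d * (N + 1)) + 3) ∨
      (pot₁ = pot v (j + 1) ∧ k = s.lvl v (j + 1) ∧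
        ((if ((s.buf v (j + 1)).length + (s.dep v (j + 1)).length : ℝ) ≤ M ∧
          s.ties v (j + 1) = 0 then compute r M v j s else pure s) : Timed (Store n)).steps ≤
          3)) := by
  have hold := H.node j hj v hv
  have hcast : (((s.buf v (j + 1)).length + (s.dep v (j + 1)).length : ℝ) ≤ M ∧
      s.ties v (j + 1) = 0) ↔ ((s.buf v (j + 1)).length + (s.dep v (j + 1)).length ≤ N ∧
      s.ties v (j + 1) = 0) := by
    rw [← hN, Nat.le_floor_iff hM]
    push_cast
    rfl
  by_cases hc : ((s.buf v (j + 1)).length + (s.dep v (j + 1)).length : ℝ) ≤ M ∧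
      s.ties v (j + 1) = 0
  · simp only [if_pos hc]
    have hs : ∀ w ∈ S, (keys (s.buf w j)).Pairwise (before r) ∧ (s.buf w j).length ≤ N := by
      intro w hw
      rcases Nat.eq_zero_or_pos j with rfl | hpos
      · rw [H.base_buf w hw]
        simpa using hN1
      · obtain ⟨q, rfl⟩ : ∃ q, j = q + 1 := ⟨j - 1, by omega⟩
        have := H.node q (by omega) w hw
        exact ⟨this.sorted, this.length_le⟩
    obtain ⟨B, D, k, m, h1, h2, h3, h4, h5⟩ := compute_spec hM hN hN1 v j s
      (fun w hw => (hs w (hsub w hw)).1) (fun w hw => (hs w (hsub w hw)).2)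
      (c := mult (A j v) (vis (W j) s j) v) (by
        rw [hadj, hWj]
        congr 1
        funext w
        rw [vis_nil]) (by rw [hadj])
    obtain ⟨g1, pot₁, g2, g3⟩ := hold.recompute (hcast.1 hc) h2 h3 h4
    refine ⟨B, D, k, m, pot₁, h1, g2, h4, g1, ?_⟩
    rcases g3 with g3 | ⟨g3, g4, g5⟩
    · left
      refine ⟨g3, h5.trans ?_⟩
      gcongr
    · right
      refine ⟨g3, g4, h5.trans ?_⟩
      have : s.adj v = [] := by
        rw [hadj]
        simpa using g5
      simp [this]
  · simp only [if_neg hc]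
    refine ⟨s.buf v (j + 1), s.dep v (j + 1), s.lvl v (j + 1), s.ties v (j + 1), pot v (j + 1),
      ?_, hold, hold.minimal_of_not (fun h => hc (hcast.2 h)), le_rfl,
      Or.inr ⟨rfl, rfl, by simp⟩⟩
    simp only [write_self]
    rfl

end KHCore

namespace KHCore

variable {n : ℕ}

/-- A node `v` whose buffer has been recomputed informs its neighbours, if there are changes. -/
theorem inform_spec {r : Fin n → ℕ} {N h : ℕ} {S : Finset (Fin n)}
    {A : ℕ → Fin n → List (Fin n)} {W : ℕ → Stack n} {pot : Fin n → ℕ → ℕ} {s : Store n}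
    (H : Levels r N h S A W pot s) {j : ℕ} (hj : j + 1 < h) {v : Fin n}
    {Y : List (Fin n)} {R : Stack n} (hW : W (j + 1) = (v, Y) :: R)
    {B₁ D₁ : List (Entry n)} {k₁ m₁ pot₁ : ℕ}
    (node₁ : Node r N (mult (A j v) (vis (W j) s j) v) ((A j v).map fun w => s.lvl w j)
      B₁ D₁ k₁ m₁ pot₁)
    (hk : k₁ ≤ s.lvl v (j + 1)) {s₁ : Store n} (hs₁ : s₁ = { s with
          buf := write s.buf v (j + 1) B₁
          lvl := write s.lvl v (j + 1) k₁
          ties := write s.ties v (j + 1) m₁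
          dep := write s.dep v (j + 1) D₁ })
    (hnd : (s.adj v).Nodup) (hsub : ∀ w ∈ s.adj v, w ∈ S)
    (hsymm : ∀ x ∈ S, (A (j + 1) x).Nodup ∧ (v ∈ A (j + 1) x ↔ x ∈ s.adj v)) :
    ∃ buf dep ties W₂ q,
      ((if j + 1 < h ∧ (Y ≠ [] ∨ s₁.lvl v (j + 1) ≠ s.lvl v (j + 1)) then
          forEach (notify (j + 1) Y (if s₁.lvl v (j + 1) ≠ s.lvl v (j + 1)
            then some (s.lvl v (j + 1)) else none)) (s₁.adj v) (s₁, W (j + 2))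
        else pure (s₁, W (j + 2)) : Timed (Store n × Stack n))) =
        ⟨({ s₁ with buf := buf, dep := dep, ties := ties }, W₂), q * (Y.length + 2)⟩ ∧
      (∀ x ∈ S, NodeAt r N (A (j + 1)) R (write pot v (j + 1) pot₁)
        { s₁ with buf := buf, dep := dep, ties := ties } (j + 1) x) ∧
      (∀ x ∈ S, x ∉ W₂.map Prod.fst → MinimalAt r N (A (j + 1)) R
          { s₁ with buf := buf, dep := dep, ties := ties } (j + 1) x ∧
        x ∉ (W (j + 2)).map Prod.fst ∧ buf x (j + 2) = s.buf x (j + 2)) ∧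
      (∀ x i, i ≠ j + 2 → buf x i = s₁.buf x i ∧ dep x i = s₁.dep x i ∧
        ties x i = s₁.ties x i) ∧
      (∀ x, x ∉ S → buf x (j + 2) = s.buf x (j + 2)) ∧
      (∀ x, (keys (buf x (j + 2)) ++ pend W₂ x).Perm
        (keys (s.buf x (j + 2)) ++ pend (W (j + 2)) x)) ∧
      (∀ x, (keys (buf x (j + 2))).Sublist (keys (s.buf x (j + 2)))) ∧
      W₂.length = (W (j + 2)).length + q ∧ q ≤ (s.adj v).length ∧
      (q = 0 ∨ Y ≠ [] ∨ k₁ ≠ s.lvl v (j + 1)) ∧ ∀ x ∈ W₂.map Prod.fst, x ∈ S := by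
  have hvS : v ∈ S := H.stack_mem (j + 1) v (by simp [hW])
  have hlv : s₁.lvl v (j + 1) = k₁ := by rw [hs₁]; exact write_same _ _ _ _
  have hln : ∀ x i, (x ≠ v ∨ i ≠ j + 1) → s₁.lvl x i = s.lvl x i := fun x i hx => by
    rw [hs₁]; exact write_ne _ _ hx
  have hne : ∀ x i, (x ≠ v ∨ i ≠ j + 1) →
      s₁.buf x i = s.buf x i ∧ s₁.dep x i = s.dep x i ∧ s₁.ties x i = s.ties x i := by
    intro x i hx
    rw [hs₁]
    exact ⟨write_ne _ _ hx, write_ne _ _ hx, write_ne _ _ hx⟩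
  have hadj : s₁.adj v = s.adj v := by rw [hs₁]
  have hlle : ∀ x i, s₁.lvl x i ≤ s.lvl x i := by
    intro x i
    by_cases hx : x ≠ v ∨ i ≠ j + 1
    · exact (hln x i hx).le
    · push Not at hx
      obtain ⟨rfl, rfl⟩ := hx
      rwa [hlv]
  obtain ⟨c1, c2, c3, c4⟩ := H.change (by omega) hW node₁ hk (s' := s₁)
    (by rw [hs₁]; exact write_same _ _ _ _) (fun x hx => (hne x _ (Or.inl hx)).1)
  rw [hlv, hadj]
  set c := fun x => mult (A (j + 1) x) (vis (W (j + 1)) s (j + 1)) x with hc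
  set c' := fun x => mult (A (j + 1) x) (vis R s₁ (j + 1)) x with hc'
  set ks := fun x => (A (j + 1) x).map fun w => s.lvl w (j + 1) with hks
  set ks' := fun x => (A (j + 1) x).map fun w => s₁.lvl w (j + 1) with hks'
  have hnode : ∀ x ∈ S, Node r N (c x) (ks x) (s₁.buf x (j + 1 + 1)) (s₁.dep x (j + 1 + 1))
      (s₁.lvl x (j + 1 + 1)) (s₁.ties x (j + 1 + 1)) (write pot v (j + 1) pot₁ x (j + 1 + 1)) := by
    intro x hx
    have hi : x ≠ v ∨ j + 1 + 1 ≠ j + 1 := Or.inr (by omega)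
    obtain ⟨e1, e2, e3⟩ := hne x (j + 1 + 1) hi
    rw [e1, e2, e3, hln x _ hi, write_ne _ _ hi]
    exact H.node (j + 1) hj x hx
  have hout : ∀ x, v ∉ A (j + 1) x → c' x = c x ∧ ks' x = ks x := by
    intro x hx
    constructor
    · refine funext fun y => mult_congr fun w hw => ?_
      rw [c1 w (fun h => hx (h ▸ hw))]
    · exact List.map_congr_left fun w hw => hln w _ (Or.inl fun h => hx (h ▸ hw))
  have hmin : ∀ x ∈ S, c' x = c x → ks' x = ks x → x ∉ (W (j + 2)).map Prod.fst →
      Minimal r N (c' x) (ks' x) (s₁.lvl x (j + 2)) := by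
    intro x hx h1 h2 h3
    rw [h1, h2, hln x _ (Or.inr (by omega))]
    exact H.minimal (j + 1) hj x hx h3
  by_cases hcond : Y ≠ [] ∨ k₁ ≠ s.lvl v (j + 1)
  · have hYnd : Y.Nodup := by
      have := H.nodup (j + 1) hj.le v hvS
      rw [vis, hW, pend_cons_self] at this
      exact (List.nodup_append.1 (List.nodup_append.1 this).2.1).1
    rw [if_pos ⟨hj, hcond⟩]
    -- When the threshold of `v` falls, nodes of smaller rank become visible without being
    -- announced. The counters are therefore claimed to drop exactly on `Y` only at ranks not below
    -- the old threshold; this suffices because no neighbour of `v` has a smaller threshold at the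
    -- next level.
    have hcc : ∀ x ∈ s.adj v, ∀ y, s.lvl v (j + 1) ≤ r y →
        c' x y = c x y - if y ∈ Y then 1 else 0 := by
      intro x hx y hy
      obtain ⟨a1, a2⟩ := hsymm x (hsub x hx)
      have hch := mult_change a1 (a2.2 hx) (X := vis (W (j + 1)) s (j + 1))
        (X' := vis R s₁ (j + 1)) (v := x) (x := y) fun w hw => by rw [c1 w hw]
      have d2 := c2 y hy
      have d3 := c3 y hy
      change c' x y + _ = c x y + _ at hch
      by_cases hyY : y ∈ Y
      · rw [if_pos (d2.2 (Or.inl hyY)), if_neg (d3 hyY)] at hch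
        rw [if_pos hyY]
        omega
      · rw [if_neg hyY]
        by_cases hyv : y ∈ vis R s₁ (j + 1) v
        · rw [if_pos (d2.2 (Or.inr hyv)), if_pos hyv] at hch
          omega
        · rw [if_neg (fun h => (d2.1 h).elim hyY hyv), if_neg hyv] at hch
          omega
    have hkx : ∀ x ∈ s.adj v, s.lvl v (j + 1) ≤ s.lvl x (j + 2) := by
      intro x hx
      exact (H.node (j + 1) hj x (hsub x hx)).le _
        (List.mem_map.2 ⟨v, (hsymm x (hsub x hx)).2.2 hx, rfl⟩)
    have hl2 : ∀ x, s₁.lvl x (j + 1 + 1) = s.lvl x (j + 2) := fun x => hln x _ (Or.inr (by omega))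
    obtain ⟨buf, dep, ties, W₂, f1, f2, f3, f4, f5, f6, f7, f8⟩ := notify_loop
      (r := r) (N := N) (s := s₁) (W := W (j + 2)) (S := S) (j := j + 1) hYnd
      (old := if k₁ ≠ s.lvl v (j + 1) then some (s.lvl v (j + 1)) else none) hnd hsub
      (c := c) (c' := c') (ks := ks) (ks' := ks') (pot := write pot v (j + 1) pot₁) hnode
      (fun x hx y hy => hcc x hx y ((hkx x hx).trans (by rwa [hl2] at hy)))
      -- Without ties at `x`, the old threshold of `v` is strictly below that of `x`, so rank `k -
      -- 1` at `x` is still in the range of `hcc`. With a tie, `D` at `x` was not valid anyway.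
      (fun x hx hxk y hy => by
        refine hcc x hx y ?_
        have h1 := hkx x hx
        rw [hl2] at hy hxk
        have h2 : s.lvl v (j + 1) ≠ s.lvl x (j + 2) := fun h =>
          hxk (List.mem_map.2 ⟨v, (hsymm x (hsub x hx)).2.2 hx, h⟩)
        omega)
      (fun x hx κ hκ => by
        obtain ⟨w, hw, rfl⟩ := List.mem_map.1 hκ
        rw [hl2]
        exact (hlle w _).trans ((H.node (j + 1) hj x (hsub x hx)).le _
          (List.mem_map.2 ⟨w, hw, rfl⟩)))
      -- A lowered threshold of `v` lies strictly below that of `x`, so `v` ceases to be a tie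
      -- exactly if its old threshold was one.
      (fun x hx => by
        obtain ⟨a1, a2⟩ := hsymm x (hsub x hx)
        have hch := count_map_change a1 (a2.2 hx) (K := fun w => s.lvl w (j + 1))
          (K' := fun w => s₁.lvl w (j + 1)) (fun y hy => hln y _ (Or.inl hy))
          (s₁.lvl x (j + 1 + 1))
        have h1 := hkx x hx
        rw [hl2] at hch ⊢
        rw [hlv] at hch
        change (ks' x).count _ + _ = (ks x).count _ + _ at hch
        by_cases hkk : k₁ = s.lvl v (j + 1)
        · rw [if_neg (by simp [hkk])]
          rw [hkk] at hch
          omega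
        · rw [if_pos hkk]
          rw [if_neg (show ¬ k₁ = s.lvl x (j + 2) by omega)] at hch
          simp only [Option.some.injEq]
          split_ifs at hch ⊢ <;> omega)
      (fun x hx hxL => hout x fun h => hxL ((hsymm x hx).2.1 h))
    have hvis : vis R { s₁ with buf := buf, dep := dep, ties := ties } (j + 1) =
        vis R s₁ (j + 1) := by
      funext x
      unfold vis
      dsimp only
      rw [(f3 x (j + 1) (Or.inr (by omega))).1]
    refine ⟨buf, dep, ties, W₂, (s.adj v).length, ?_, ?_, ?_, ?_, ?_, ?_, ?_, f6, le_rfl,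
      Or.inr hcond, ?_⟩
    · rw [← f1, ← f8]
    · intro x hx
      unfold NodeAt
      rw [hvis]
      exact f2 x hx
    · intro x hx hxW
      rw [f7, not_or] at hxW
      obtain ⟨o1, o2⟩ := hout x fun h => hxW.1 ((hsymm x hx).2.1 h)
      refine ⟨?_, hxW.2, ?_⟩
      · unfold MinimalAt
        rw [hvis]
        exact hmin x hx o1 o2 hxW.2
      · rw [(f3 x (j + 2) (Or.inl hxW.1)).1]
        exact (hne x _ (Or.inr (by omega))).1
    · exact fun x i hi => f3 x i (Or.inr hi)
    · intro x hx
      rw [(f3 x (j + 2) (Or.inl fun h => hx (hsub x h))).1]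
      exact (hne x _ (Or.inr (by omega))).1
    · intro x
      have := f4 x
      rwa [(hne x (j + 1 + 1) (Or.inr (by omega))).1] at this
    · intro x
      have := f5 x
      rwa [(hne x (j + 1 + 1) (Or.inr (by omega))).1] at this
    · intro x hx
      rw [f7] at hx
      rcases hx with hx | hx
      · exact hsub x hx
      · exact H.stack_mem _ x hx
  -- Nothing was removed and the threshold is the same, so the recomputed buffer has the same nodes
  -- (`c4`) and the next level has nothing to learn.
  · rw [if_neg (fun h => hcond h.2)]
    push Not at hcond
    obtain ⟨rfl, hkk⟩ := hcond
    have hcc : ∀ x, c' x = c x := by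
      intro x
      refine funext fun y => mult_congr fun w hw => ?_
      by_cases hwv : w = v
      · subst hwv
        have : s₁.buf w (j + 1) = B₁ := by rw [hs₁]; exact write_same _ _ _ _
        unfold vis
        rw [this, hW, pend_cons_self, List.mem_append, List.mem_append, (c4 hkk).2 y]
        simp
      · rw [c1 w hwv]
    have hkks : ∀ x, ks' x = ks x := by
      intro x
      refine List.map_congr_left fun w hw => ?_
      by_cases hwv : w = v
      · rw [hwv, hlv, hkk]
      · exact hln w _ (Or.inl hwv)
    refine ⟨s₁.buf, s₁.dep, s₁.ties, W (j + 2), 0, ?_, ?_, ?_, fun _ _ _ => ⟨rfl, rfl, rfl⟩,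
      fun x _ => ?_, fun x => ?_, fun x => ?_, rfl, Nat.zero_le _, Or.inl rfl, H.stack_mem _⟩
    · rw [Nat.zero_mul]
      rfl
    · intro x hx
      have h1 := hnode x hx
      rw [← hcc x, ← hkks x] at h1
      exact h1
    · intro x hx hxW
      exact ⟨hmin x hx (hcc x) (hkks x) hxW, hxW, (hne x _ (Or.inr (by omega))).1⟩
    · exact (hne x _ (Or.inr (by omega))).1
    · rw [(hne x (j + 2) (Or.inr (by omega))).1]
    · rw [(hne x (j + 2) (Or.inr (by omega))).1]

end KHCore

/-! ### Amortized cost of processing one stack entry -/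

namespace KHCore

variable {n : ℕ}

/-- Only the summand of `(v, j + 1)`, two stack lengths and the keys can change; elsewhere visible
lists keep their lengths. Both sides are arranged to avoid subtraction. -/
theorem potential_step {N h : ℕ} {dg : Fin n → ℕ} {S : Finset (Fin n)} {W : ℕ → Stack n}
    {pot : Fin n → ℕ → ℕ} {s s' : Store n} {j : ℕ} (hj : j < h) {v : Fin n} (hv : v ∈ S)
    {Y : List (Fin n)} {R : Stack n} (hW : W (j + 1) = (v, Y) :: R) {W₂ : Stack n} {pot₁ q : ℕ}
    (hvis : ∀ x ∈ S, ∀ i ∈ Finset.Icc 1 h, x ≠ v ∨ i ≠ j + 1 →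
      (vis (Function.update (Function.update W (j + 1) R) (j + 2) W₂ i) s' i x).length =
        (vis (W i) s i x).length)
    (hW₂ : W₂.length = (W (j + 2)).length + q) (hq : h < j + 2 → q = 0) :
    potential N h dg S (Function.update (Function.update W (j + 1) R) (j + 2) W₂)
        (write pot v (j + 1) pot₁) s' +
      dg v * (37 * (N + 1) * pot v (j + 1) +
        9 * ((s.buf v (j + 1)).length + Y.length + (pend R v).length)) + 6 + ∑ x ∈ S, s.key x =
    potential N h dg S W pot s +
      dg v * (37 * (N + 1) * pot₁ + 9 * ((s'.buf v (j + 1)).length + (pend R v).length)) +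
      6 * q + ∑ x ∈ S, s'.key x := by
  set W' := Function.update (Function.update W (j + 1) R) (j + 2) W₂ with hW'
  have w1 : W' (j + 1) = R := by simp [hW']
  have w2 : W' (j + 2) = W₂ := by simp [hW']
  have w3 : ∀ i, i ≠ j + 1 → i ≠ j + 2 → W' i = W i := fun i h1 h2 => by simp [hW', h1, h2]
  have hj1 : j + 1 ∈ Finset.Icc 1 h := Finset.mem_Icc.2 ⟨by omega, by omega⟩
  have h1 := sum_sum_change hv hj1
    (f := fun x i => dg x * (37 * (N + 1) * pot x i + 9 * (vis (W i) s i x).length))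
    (g := fun x i => dg x * (37 * (N + 1) * write pot v (j + 1) pot₁ x i +
      9 * (vis (W' i) s' i x).length))
    (fun x hx i hi hne => by rw [hvis x hx i hi hne, write_ne _ _ hne])
  simp only [write_same] at h1
  have h2 : (vis (W (j + 1)) s (j + 1) v).length =
      (s.buf v (j + 1)).length + Y.length + (pend R v).length := by
    rw [vis, hW, pend_cons_self]
    simp
    omega
  have h3 : (vis (W' (j + 1)) s' (j + 1) v).length =
      (s'.buf v (j + 1)).length + (pend R v).length := by
    rw [vis, w1]
    simp
  rw [h2, h3] at h1
  have h4 := sum_change hj1 (f := fun i => (W i).length)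
    (g := fun i => (Function.update W (j + 1) R i).length)
    (fun i _ hi => by rw [Function.update_of_ne hi])
  have h5 : ∑ i ∈ Finset.Icc 1 h, (W' i).length =
      ∑ i ∈ Finset.Icc 1 h, (Function.update W (j + 1) R i).length + q := by
    by_cases hh : h < j + 2
    · rw [hq hh, add_zero]
      refine Finset.sum_congr rfl fun i hi => ?_
      rw [Finset.mem_Icc] at hi
      rw [hW', Function.update_of_ne (by omega)]
    · have hj2 : j + 2 ∈ Finset.Icc 1 h := Finset.mem_Icc.2 ⟨by omega, by omega⟩
      have h6 := sum_change hj2 (f := fun i => (Function.update W (j + 1) R i).length)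
        (g := fun i => (W' i).length) (fun i _ hi => by rw [hW', Function.update_of_ne hi])
      simp only [w2] at h6
      rw [Function.update_of_ne (by omega)] at h6
      omega
  simp only [Function.update_self, hW, List.length_cons] at h4
  unfold potential
  omega

theorem bucketIndex_eq {M : ℝ} {N : ℕ} (hN : ⌊M⌋₊ = N) (b k : ℕ) :
    bucketIndex M b k = k * (N + 1) + b := by
  rw [bucketIndex, hN]

theorem size_le {h : ℕ} {s : Store n} {v : Fin n} : size h s v ≤ (s.buf v h).length := by
  unfold size
  exact (List.length_erase_le).trans (by simp)

/-- The pointer acts as a negative term of the potential: moving it back has to be paid for here,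
and its advance will pay for `seek`. The extra `1` on the left is the step of the loop over the
stack. -/
theorem process_spec {r : Fin n → ℕ} {N h : ℕ} {M : ℝ} (hM : 0 ≤ M) (hN : ⌊M⌋₊ = N)
    (hN1 : 1 ≤ N) {S : Finset (Fin n)}
    {A : ℕ → Fin n → List (Fin n)} {W : ℕ → Stack n} {pot : Fin n → ℕ → ℕ} {s : Store n}
    (H : Levels r N h S A W pot s) (Q : Queue S s) (F : Fresh M h S (W h) s)
    {j : ℕ} (hj : j < h) (hWj : W j = []) {v : Fin n}
    {Y : List (Fin n)} {R : Stack n} (hW : W (j + 1) = (v, Y) :: R)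
    (hadj : ∀ x ∈ S, s.adj x = A j x) (hsub : ∀ x ∈ S, ∀ w ∈ s.adj x, w ∈ S)
    (hnd : ∀ x ∈ S, (s.adj x).Nodup) {dg : Fin n → ℕ}
    (hdg : ∀ x ∈ S, (s.adj x).length ≤ dg x)
    (hsymm : j + 1 < h → ∀ x ∈ S, (A (j + 1) x).Nodup ∧ (v ∈ A (j + 1) x ↔ x ∈ s.adj v)) :
    ∃ s' W₂ pot', (process r M h j (v, Y) (s, W (j + 2))).val = (s', W₂) ∧
      Levels r N h S A (Function.update (Function.update W (j + 1) R) (j + 2) W₂) pot' s' ∧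
      Queue S s' ∧
      Fresh M h S (Function.update (Function.update W (j + 1) R) (j + 2) W₂ h) s' ∧
      s'.adj = s.adj ∧ (∀ x, x ∉ S → ∀ i, s'.buf x i = s.buf x i) ∧
      1 + (process r M h j (v, Y) (s, W (j + 2))).steps +
        potential N h dg S (Function.update (Function.update W (j + 1) R) (j + 2) W₂) pot' s' +
        s.ptr ≤ potential N h dg S W pot s + s'.ptr := by
  have hvS : v ∈ S := H.stack_mem (j + 1) v (by simp [hW])
  obtain ⟨B₁, D₁, k₁, m₁, pot₁, g1, node₁, min₁, hk, g2⟩ := recompute_spec hM hN hN1 H hj hWj hvS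
    (hadj v hvS) (hsub v hvS) (hdg v hvS)
  set C : Timed (Store n) := (if ((s.buf v (j + 1)).length + (s.dep v (j + 1)).length : ℝ) ≤ M ∧
      s.ties v (j + 1) = 0 then compute r M v j s else pure s) with hC
  set s₁ : Store n := { s with
          buf := write s.buf v (j + 1) B₁
          lvl := write s.lvl v (j + 1) k₁
          ties := write s.ties v (j + 1) m₁
          dep := write s.dep v (j + 1) D₁ } with hs₁
  have hne : ∀ x i, (x ≠ v ∨ i ≠ j + 1) →
      s₁.buf x i = s.buf x i ∧ s₁.dep x i = s.dep x i ∧ s₁.ties x i = s.ties x i := by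
    intro x i hx
    exact ⟨write_ne _ _ hx, write_ne _ _ hx, write_ne _ _ hx⟩
  have hln : ∀ x i, (x ≠ v ∨ i ≠ j + 1) → s₁.lvl x i = s.lvl x i := fun x i hx => write_ne _ _ hx
  have hb1 : s₁.buf v (j + 1) = B₁ := write_same _ _ _ _
  have hl1 : s₁.lvl v (j + 1) = k₁ := write_same _ _ _ _
  obtain ⟨c1, -, -, c4⟩ := H.change hj hW node₁ hk hb1 (fun x hx => (hne x _ (Or.inl hx)).1)
  have hB₁N : B₁.length ≤ N := node₁.length_le
  have hlenk : k₁ = s.lvl v (j + 1) → B₁.length = (s.buf v (j + 1)).length := fun h => (c4 h).1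
  rcases Nat.lt_or_ge (j + 1) h with hjh | hjh
  · obtain ⟨buf, dep, ties, W₂, q, i1, i2, i3, i4, i5, i6, i7, i8, i9, i10, i11⟩ :=
      inform_spec H hjh hW node₁ hk hs₁ (hnd v hvS) (hsub v hvS) (hsymm hjh)
    set s' : Store n := { s₁ with buf := buf, dep := dep, ties := ties } with hs'
    have hproc : (process r M h j (v, Y) (s, W (j + 2))).val = (s', W₂) ∧
        (process r M h j (v, Y) (s, W (j + 2))).steps = 1 + (C.steps + q * (Y.length + 2)) := by
      rw [process_eq]
      simp only [bind_val, bind_steps, ← hC, g1]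
      rw [if_neg (show ¬ j + 1 = h by omega)]
      simp only [pure_val, pure_steps]
      rw [i1]
      exact ⟨rfl, by simp⟩
    have hperm : ∀ x, (vis W₂ s' (j + 2) x).Perm (vis (W (j + 2)) s (j + 2) x) := i6
    have hL : Levels r N h S A (Function.update (Function.update W (j + 1) R) (j + 2) W₂)
        (write pot v (j + 1) pot₁) s' := by
      refine H.step hj hW node₁ min₁ hk rfl ?_ ?_ hperm i11 (fun h => by omega)
        (fun _ => i2) (fun _ x hx hxW => (i3 x hx hxW).1)
      · obtain ⟨e1, e2, e3⟩ := i4 v (j + 1) (by omega)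
        exact ⟨e1.trans (write_same _ _ _ _), e2.trans (write_same _ _ _ _),
          e3.trans (write_same _ _ _ _)⟩
      · intro x i h1 h2
        obtain ⟨e1, e2, e3⟩ := i4 x i h1
        obtain ⟨d1, d2, d3⟩ := hne x i h2
        exact ⟨e1.trans d1, e2.trans d2, e3.trans d3⟩
    have hbufv : s'.buf v (j + 1) = B₁ := ((i4 v (j + 1) (by omega)).1).trans hb1
    refine ⟨s', W₂, _, hproc.1, hL, ?_, ?_, rfl, ?_, ?_⟩
    · exact ⟨Q.mem, Q.nodup, Q.key_lt, Q.ptr_le⟩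
    · have hlh : ∀ x, s'.lvl x h = s.lvl x h := fun x => hln x h (Or.inr (by omega))
      by_cases hh : h = j + 2
      · subst hh
        have hsz : ∀ x, size (j + 2) s' x ≤ size (j + 2) s x := fun x =>
          ((i7 x).erase x).length_le
        rw [Function.update_self]
        refine ⟨fun x hx => ?_, fun x hx hxW => ?_⟩
        · refine le_trans ?_ (F.le x hx)
          rw [hlh, bucketIndex_eq hN, bucketIndex_eq hN]
          exact Nat.add_le_add_left (hsz x) _
        · obtain ⟨-, e2, e3⟩ := i3 x hx hxW
          have : size (j + 2) s' x = size (j + 2) s x := by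
            unfold size
            rw [show s'.buf x (j + 2) = s.buf x (j + 2) from e3]
          rw [hlh, this]
          exact F.eq x hx e2
      · have hsz : ∀ x, size h s' x = size h s x := fun x => by
          unfold size
          rw [show s'.buf x h = s.buf x h from
            ((i4 x h hh).1).trans (hne x h (Or.inr (by omega))).1]
        rw [Function.update_of_ne hh, Function.update_of_ne (by omega)]
        refine ⟨fun x hx => ?_, fun x hx hxW => ?_⟩
        · rw [hlh, hsz]
          exact F.le x hx
        · rw [hlh, hsz]
          exact F.eq x hx hxW
    · intro x hx i
      by_cases hi : i = j + 2
      · subst hi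
        exact i5 x hx
      · exact ((i4 x i hi).1).trans (hne x i (Or.inl fun h => hx (h ▸ hvS))).1
    · have hpot := potential_step (N := N) (dg := dg) (s := s) (s' := s') hj hvS hW
        (W₂ := W₂) (pot := pot) (pot₁ := pot₁) (q := q) (fun x hx i hi hxi => by
          by_cases h1 : i = j + 2
          · subst h1
            rw [Function.update_self]
            exact (hperm x).length_eq
          · rw [Function.update_of_ne h1]
            by_cases h2 : i = j + 1
            · subst h2
              have hxv : x ≠ v := hxi.resolve_right (by simp)
              rw [Function.update_self, ← c1 x hxv]
              unfold vis
              rw [show s'.buf x (j + 1) = s₁.buf x (j + 1) from (i4 x (j + 1) h1).1]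
            · rw [Function.update_of_ne h2]
              unfold vis
              rw [show s'.buf x i = s.buf x i from
                ((i4 x i h1).1).trans (hne x i hxi).1]) i8 (fun h => by omega)
      rw [hbufv] at hpot
      rw [hproc.2]
      have hkeys : ∑ x ∈ S, s'.key x = ∑ x ∈ S, s.key x := rfl
      have hptr : s'.ptr = s.ptr := rfl
      rw [hkeys] at hpot
      rw [hptr]
      have hq : q ≤ dg v := i9.trans (hdg v hvS)
      have hqY : q * Y.length ≤ dg v * Y.length := Nat.mul_le_mul_right _ hq
      have e1 : dg v * (37 * (N + 1) * pot v (j + 1) +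
          9 * ((s.buf v (j + 1)).length + Y.length + (pend R v).length)) =
          37 * (dg v * (N + 1) * pot v (j + 1)) + 9 * (dg v * (s.buf v (j + 1)).length) +
          9 * (dg v * Y.length) + 9 * (dg v * (pend R v).length) := by ring
      have e2 : dg v * (37 * (N + 1) * pot₁ + 9 * (B₁.length + (pend R v).length)) =
          37 * (dg v * (N + 1) * pot₁) + 9 * (dg v * B₁.length) +
          9 * (dg v * (pend R v).length) := by ring
      rw [e1, e2] at hpot
      have e3 : dg v * (N + 1) = dg v * N + dg v := by ring
      have e4 : q * (Y.length + 2) = q * Y.length + 2 * q := by ring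
      rw [e4]
      -- In the first case a unit of `pot` releases `37 * dg v * (N + 1)`: `20` shares for
      -- `compute`, `9` for a buffer refilled with up to `N` nodes, and at most `8` for the
      -- neighbours (two steps and `6` for the new stack entry each). In the second case the length
      -- of the buffer is unchanged; if neighbours are informed, `Y` is non-empty and each of its
      -- nodes releases `9 * dg v`, one share for the decrements and `8` for the neighbours as
      -- before. The `6` of the popped entry covers the constants.
      rcases g2 with ⟨g2, g3⟩ | ⟨g2, g3, g4⟩
      · have h1 : dg v * (N + 1) * (pot₁ + 1) ≤ dg v * (N + 1) * pot v (j + 1) :=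
          Nat.mul_le_mul_left _ g2
        have h2 : dg v * B₁.length ≤ dg v * N := Nat.mul_le_mul_left _ hB₁N
        rw [Nat.mul_add, Nat.mul_one] at h1
        omega
      · rw [g2, hlenk g3] at hpot
        rw [g2]
        rcases i10 with rfl | h5 | h5
        · omega
        · have h6 : 1 ≤ Y.length := List.length_pos_iff.2 h5
          have h7 : q * 1 ≤ q * Y.length := Nat.mul_le_mul_left _ h6
          omega
        · exact absurd g3 h5
  · have hjh' : j + 1 = h := by omega
    subst hjh'
    have hW2 : W (j + 2) = [] := H.top_stack _ (by omega)
    have hrq := requeue_spec (s := s₁) (S := S) ⟨Q.mem, Q.nodup, Q.key_lt, Q.ptr_le⟩ M (j + 1) v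
    set p := bucketIndex M (size (j + 1) s₁ v) (s₁.lvl v (j + 1)) with hp
    obtain ⟨bucket, q1, q2, q3⟩ := hrq
    set s' := (requeue M (j + 1) v s₁).val with hs'
    rw [Finset.insert_eq_of_mem hvS] at q2
    -- Keys never rise: a smaller threshold outweighs any sample of at most `N` nodes, and an equal
    -- threshold means equal nodes. In particular `requeue` allocates no bucket here.
    have hpk : p ≤ s.key v := by
      refine le_trans ?_ (F.le v hvS)
      rw [hp, bucketIndex_eq hN, bucketIndex_eq hN, hl1]
      rcases hk.lt_or_eq with hlt | heq
      · have h1 : size (j + 1) s₁ v ≤ N := size_le.trans (by rw [hb1]; exact hB₁N)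
        have h2 : (k₁ + 1) * (N + 1) ≤ s.lvl v (j + 1) * (N + 1) := Nat.mul_le_mul_right _ hlt
        nlinarith
      · rw [heq]
        refine Nat.add_le_add_left (le_of_eq ?_) _
        unfold size
        rw [hb1]
        refine List.Perm.length_eq (List.Perm.erase v ?_)
        exact (List.perm_ext_iff_of_nodup node₁.lists.nodup
          (H.node j hj v hvS).lists.nodup).2 (c4 heq).2
    have hproc : (process r M (j + 1) j (v, Y) (s, W (j + 2))).val = (s', W (j + 2)) ∧
        (process r M (j + 1) j (v, Y) (s, W (j + 2))).steps = 1 + (C.steps + 1) := by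
      rw [process_eq]
      simp only [bind_val, bind_steps, ← hC, g1, if_true]
      rw [if_neg (by omega)]
      refine ⟨rfl, ?_⟩
      rw [q3]
      have := Q.key_lt v hvS
      have h2 : s₁.top = s.top := rfl
      simp only [tick_steps, pure_steps]
      omega
    have hbuf : s'.buf = s₁.buf := by rw [q1]
    have hlvl : s'.lvl = s₁.lvl := by rw [q1]
    have hdep : s'.dep = s₁.dep := by rw [q1]
    have hties : s'.ties = s₁.ties := by rw [q1]
    have hkey : s'.key = Function.update s.key v p := by rw [q1]
    have hest : s'.est = Function.update s.est v
      (estimate M (size (j + 1) s₁ v) (s₁.lvl v (j + 1))) := by rw [q1]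
    have hptr : s'.ptr = min s.ptr p := by rw [q1]
    have hL : Levels r N (j + 1) S A
        (Function.update (Function.update W (j + 1) R) (j + 2) (W (j + 2)))
        (write pot v (j + 1) pot₁) s' := by
      refine H.step hj hW node₁ min₁ hk (by rw [hlvl]) ?_ ?_ ?_ (H.stack_mem _) (fun _ => hW2)
        (fun h => by omega) (fun h => by omega)
      · rw [hbuf, hdep, hties]
        exact ⟨write_same _ _ _ _, write_same _ _ _ _, write_same _ _ _ _⟩
      · intro x i h1 h2
        rw [hbuf, hdep, hties]
        exact hne x i h2
      · intro x
        unfold vis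
        rw [hbuf, (hne x (j + 2) (Or.inr (by omega))).1]
    refine ⟨s', W (j + 2), _, hproc.1, hL, q2, ?_, ?_, ?_, ?_⟩
    · rw [Function.update_of_ne (by omega), Function.update_self]
      have hsz' : ∀ x, size (j + 1) s' x = size (j + 1) s₁ x := fun x => by
        unfold size
        rw [hbuf]
      have hsz : ∀ x, x ≠ v → size (j + 1) s₁ x = size (j + 1) s x := fun x hx => by
        unfold size
        rw [(hne x (j + 1) (Or.inl hx)).1]
      have hall : ∀ x ∈ S, x ∉ R.map Prod.fst → s'.key x =
          bucketIndex M (size (j + 1) s' x) (s'.lvl x (j + 1)) ∧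
          s'.est x = estimate M (size (j + 1) s' x) (s'.lvl x (j + 1)) := by
        intro x hx hxR
        rw [hsz', hlvl, hkey, hest]
        by_cases hxv : x = v
        · subst hxv
          rw [Function.update_self, Function.update_self]
          exact ⟨rfl, rfl⟩
        · rw [Function.update_of_ne hxv, Function.update_of_ne hxv, hsz x hxv,
            hln x _ (Or.inl hxv)]
          refine F.eq x hx ?_
          rw [hW, List.map_cons, List.mem_cons, not_or]
          exact ⟨hxv, hxR⟩
      refine ⟨fun x hx => ?_, hall⟩
      rw [hsz', hlvl, hkey]
      by_cases hxv : x = v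
      · subst hxv
        rw [Function.update_self]
      · rw [Function.update_of_ne hxv, hsz x hxv, hln x _ (Or.inl hxv)]
        exact F.le x hx
    · rw [q1]
    · intro x hx i
      rw [hbuf]
      exact (hne x i (Or.inl fun h => hx (h ▸ hvS))).1
    · have hpot := potential_step (N := N) (dg := dg) (s := s) (s' := s') hj hvS hW
        (W₂ := W (j + 2)) (pot := pot) (pot₁ := pot₁) (q := 0) (fun x hx i hi hxi => by
          rw [Finset.mem_Icc] at hi
          rw [Function.update_of_ne (by omega)]
          by_cases h2 : i = j + 1
          · subst h2
            have hxv : x ≠ v := hxi.resolve_right (by simp)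
            rw [Function.update_self, ← c1 x hxv]
            unfold vis
            rw [hbuf]
          · rw [Function.update_of_ne h2]
            unfold vis
            rw [hbuf, (hne x i hxi).1]) rfl (fun _ => rfl)
      have hk2 := sum_change hvS (f := s.key) (g := s'.key) fun x _ hx => by
        rw [hkey, Function.update_of_ne hx]
      rw [show s'.key v = p by rw [hkey, Function.update_self]] at hk2
      rw [hbuf, hb1] at hpot
      rw [hproc.2, hptr]
      have hpk' := Q.ptr_le v hvS
      -- As the pointer was at most the old key of `v`, it retreats by no more than that key falls.
      have hmin : s.ptr + p ≤ min s.ptr p + s.key v := by omega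
      have e1 : dg v * (37 * (N + 1) * pot v (j + 1) +
          9 * ((s.buf v (j + 1)).length + Y.length + (pend R v).length)) =
          37 * (dg v * (N + 1) * pot v (j + 1)) + 9 * (dg v * (s.buf v (j + 1)).length) +
          9 * (dg v * Y.length) + 9 * (dg v * (pend R v).length) := by ring
      have e2 : dg v * (37 * (N + 1) * pot₁ + 9 * (B₁.length + (pend R v).length)) =
          37 * (dg v * (N + 1) * pot₁) + 9 * (dg v * B₁.length) +
          9 * (dg v * (pend R v).length) := by ring
      rw [e1, e2] at hpot
      have e3 : dg v * (N + 1) = dg v * N + dg v := by ring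
      rcases g2 with ⟨g2, g3⟩ | ⟨g2, g3, g4⟩
      · have h1 : dg v * (N + 1) * (pot₁ + 1) ≤ dg v * (N + 1) * pot v (j + 1) :=
          Nat.mul_le_mul_left _ g2
        have h2 : dg v * B₁.length ≤ dg v * N := Nat.mul_le_mul_left _ hB₁N
        rw [Nat.mul_add, Nat.mul_one] at h1
        omega
      · rw [g2, hlenk g3] at hpot
        rw [g2]
        omega

end KHCore

namespace KHCore

variable {n : ℕ}

/-! ## Deleting a node -/

/-- The adjacency lists of the subgraph induced by `S`. -/
def adjOf (G : SimpleGraph (Fin n)) [DecidableRel G.Adj] (S : Finset (Fin n)) (v : Fin n) :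
    List (Fin n) :=
  if v ∈ S then (List.finRange n).filter (fun w => decide (G.Adj v w ∧ w ∈ S)) else []

variable (G : SimpleGraph (Fin n)) [DecidableRel G.Adj]

theorem mem_adjOf {S : Finset (Fin n)} {v w : Fin n} :
    w ∈ adjOf G S v ↔ v ∈ S ∧ w ∈ S ∧ G.Adj v w := by
  unfold adjOf
  split_ifs with h
  · simp [h]; tauto
  · simp [h]

theorem adjOf_nodup (S : Finset (Fin n)) (v : Fin n) : (adjOf G S v).Nodup := by
  unfold adjOf
  split_ifs
  · exact (List.nodup_finRange n).filter _
  · exact List.nodup_nil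

theorem adjOf_erase_of_mem {S : Finset (Fin n)} {u x : Fin n} (hx : x ∈ adjOf G S u) :
    adjOf G (S.erase u) x = (adjOf G S x).erase u := by
  rw [(adjOf_nodup G S x).erase_eq_filter]
  obtain ⟨-, h2, h3⟩ := (mem_adjOf G).1 hx
  unfold adjOf
  rw [if_pos h2, if_pos (Finset.mem_erase.2 ⟨h3.ne', h2⟩), List.filter_filter]
  refine List.filter_congr fun w _ => ?_
  simp only [Finset.mem_erase]
  by_cases hw : w = u <;> simp [hw]

theorem adjOf_erase_of_notMem {S : Finset (Fin n)} {u x : Fin n} (hu : u ∈ S) (hxu : x ≠ u)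
    (hx : x ∉ adjOf G S u) : adjOf G (S.erase u) x = adjOf G S x := by
  unfold adjOf
  by_cases h : x ∈ S
  · rw [if_pos h, if_pos (Finset.mem_erase.2 ⟨hxu, h⟩)]
    refine List.filter_congr fun w _ => ?_
    simp only [Finset.mem_erase, decide_eq_decide]
    constructor
    · tauto
    · rintro ⟨h1, h2⟩
      refine ⟨h1, ?_, h2⟩
      rintro rfl
      exact hx ((mem_adjOf G).2 ⟨hu, h, h1.symm⟩)
  · rw [if_neg h, if_neg (fun h' => h (Finset.mem_of_mem_erase h'))]

theorem foldl_erase (u : Fin n) {A : List (Fin n)} (hA : A.Nodup) (s : Store n) :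
    A.foldl (fun s w => { s with adj := Function.update s.adj w ((s.adj w).erase u) }) s =
      { s with adj := fun w => if w ∈ A then (s.adj w).erase u else s.adj w } := by
  induction A generalizing s with
  | nil => simp
  | cons a A ih =>
    have hA' := List.nodup_cons.1 hA
    rw [List.foldl_cons, ih hA'.2]
    congr 1
    funext w
    by_cases hw : w = a
    · subst hw
      simp [hA'.1]
    · simp [hw]

theorem adj_after {S : Finset (Fin n)} {u : Fin n} (hu : u ∈ S) :
    Function.update (fun w => if w ∈ adjOf G S u then (adjOf G S w).erase u else adjOf G S w) u []
      = adjOf G (S.erase u) := by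
  funext x
  by_cases hx : x = u
  · subst hx
    rw [Function.update_self]
    unfold adjOf
    rw [if_neg (Finset.notMem_erase _ _)]
  · rw [Function.update_of_ne hx]
    split_ifs with h
    · exact (adjOf_erase_of_mem G h).symm
    · exact (adjOf_erase_of_notMem G hu hx h).symm

/-- Level `j + 1` is informed about the deletion of `u`. -/
theorem Levels.delete {r : Fin n → ℕ} {N h : ℕ} {S : Finset (Fin n)} {u : Fin n} (hu : u ∈ S)
    {W : ℕ → Stack n} {pot : Fin n → ℕ → ℕ} {s : Store n} {j : ℕ} (hj : j < h)
    (H : Levels r N h (S.erase u) (fun i => if i < j then adjOf G (S.erase u) else adjOf G S) W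
      pot s) (hWj : W j = []) (hnd : (keys (s.buf u j)).Nodup) :
    ∃ s' W₁, (forEach (notify j (keys (s.buf u j)) (some (s.lvl u j))) (adjOf G S u)
        (s, W (j + 1))).val = (s', W₁) ∧
      (forEach (notify j (keys (s.buf u j)) (some (s.lvl u j))) (adjOf G S u)
        (s, W (j + 1))).steps = (adjOf G S u).length * ((s.buf u j).length + 2) ∧
      Levels r N h (S.erase u) (fun i => if i < j + 1 then adjOf G (S.erase u) else adjOf G S)
        (Function.update W (j + 1) W₁) pot { s' with buf := write s'.buf u j [] } ∧
      (∀ i, i ≠ j → s'.buf u i = s.buf u i) ∧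
      s'.adj = s.adj ∧ s'.lvl = s.lvl ∧ s'.est = s.est ∧ s'.bucket = s.bucket ∧ s'.key = s.key ∧
      s'.ptr = s.ptr ∧ s'.top = s.top ∧
      W₁.length = (W (j + 1)).length + (adjOf G S u).length ∧
      (∀ x ∈ S.erase u, ∀ i, ((vis (Function.update W (j + 1) W₁ i)
        { s' with buf := write s'.buf u j [] } i x).Perm (vis (W i) s i x))) ∧
      (∀ x ∈ S.erase u, ∀ i, (keys (s'.buf x i)).Sublist (keys (s.buf x i))) ∧
      (∀ x ∈ S.erase u, x ∉ W₁.map Prod.fst → x ∉ (W (j + 1)).map Prod.fst ∧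
        ∀ i, s'.buf x i = s.buf x i) ∧
      (∀ x i, i ≠ j + 1 → s'.buf x i = s.buf x i) := by
  set S' := S.erase u with hS'
  set L := adjOf G S u with hL
  have hLS : ∀ x ∈ L, x ∈ S' := fun x hx => by
    obtain ⟨-, h2, h3⟩ := (mem_adjOf G).1 hx
    exact Finset.mem_erase.2 ⟨h3.ne', h2⟩
  have huL : u ∉ L := fun h => ((mem_adjOf G).1 h).2.2.ne rfl
  have hmemL : ∀ x ∈ S', x ∈ L ↔ u ∈ adjOf G S x := by
    intro x hx
    rw [hL, mem_adjOf, mem_adjOf, G.adj_comm]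
    tauto
  have hcase : ∀ x ∈ S', x ∉ L → adjOf G S' x = adjOf G S x := fun x hx hxL =>
    adjOf_erase_of_notMem G hu (Finset.ne_of_mem_erase hx) hxL
  -- Removing `u` from the adjacency lists affects counters and ties as if `u` lost its whole buffer
  -- and its threshold, so the general loop applies with these as `Y` and `old`.
  obtain ⟨buf, dep, ties, W₁, f1, f2, f3, f4, f5, f6, f7, f8⟩ := notify_loop
    (r := r) (N := N) (s := s) (W := W (j + 1)) (S := S') (j := j) hnd
    (old := some (s.lvl u j)) (adjOf_nodup G S u) hLS
    (c := fun x => mult (adjOf G S x) (vis (W j) s j) x)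
    (c' := fun x => mult (adjOf G S' x) (vis (W j) s j) x)
    (ks := fun x => (adjOf G S x).map fun w => s.lvl w j)
    (ks' := fun x => (adjOf G S' x).map fun w => s.lvl w j) (pot := pot)
    (fun x hx => by
      have := H.node j hj x hx
      rw [if_neg (lt_irrefl j)] at this
      exact this)
    (fun x hx y _ => by
      rw [adjOf_erase_of_mem G hx, mult_erase ((hmemL x (hLS x hx)).1 hx), hWj, vis_nil])
    (fun x hx _ y _ => by
      rw [adjOf_erase_of_mem G hx, mult_erase ((hmemL x (hLS x hx)).1 hx), hWj, vis_nil])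
    (fun x hx κ hκ => by
      have := H.node j hj x (hLS x hx)
      rw [if_neg (lt_irrefl j)] at this
      refine this.le κ ?_
      rw [adjOf_erase_of_mem G hx] at hκ
      obtain ⟨w, hw, rfl⟩ := List.mem_map.1 hκ
      exact List.mem_map.2 ⟨w, List.mem_of_mem_erase hw, rfl⟩)
    (fun x hx => by
      rw [adjOf_erase_of_mem G hx, count_map_erase ((hmemL x (hLS x hx)).1 hx)]
      simp only [Option.some.injEq]
      split_ifs <;> rfl)
    (fun x hx hxL => by
      rw [hcase x hx hxL]
      exact ⟨rfl, rfl⟩)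
  set s' : Store n := { s with buf := buf, dep := dep, ties := ties } with hs'
  set s₂ : Store n := { s' with buf := write s'.buf u j [] } with hs₂
  have w1 : Function.update W (j + 1) W₁ (j + 1) = W₁ := Function.update_self _ _ _
  have w3 : ∀ i, i ≠ j + 1 → Function.update W (j + 1) W₁ i = W i := fun i hi =>
    Function.update_of_ne hi _ _
  have hb2 : ∀ x ∈ S', ∀ i, s₂.buf x i = buf x i := fun x hx i =>
    write_ne _ _ (Or.inl (Finset.ne_of_mem_erase hx))
  have hb3 : ∀ x i, i ≠ j → s₂.buf x i = buf x i := fun x i hi => write_ne _ _ (Or.inr hi)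
  have hperm1 : ∀ x, (vis W₁ s₂ (j + 1) x).Perm (vis (W (j + 1)) s (j + 1) x) := fun x => by
    unfold vis
    rw [hb3 x (j + 1) (by omega)]
    exact f4 x
  have hbuf : ∀ x i, i ≠ j + 1 → buf x i = s.buf x i := fun x i hi => (f3 x i (Or.inr hi)).1
  have hperm : ∀ x ∈ S', ∀ i, (vis (Function.update W (j + 1) W₁ i) s₂ i x).Perm
      (vis (W i) s i x) := by
    intro x hx i
    by_cases hi : i = j + 1
    · subst hi
      rw [w1]
      exact hperm1 x
    · rw [w3 i hi]
      unfold vis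
      rw [hb2 x hx, hbuf x i hi]
  have hvis : ∀ i, i ≠ j → ∀ x, (vis (Function.update W (j + 1) W₁ i) s₂ i x).Perm
      (vis (W i) s i x) := by
    intro i hij x
    by_cases hi : i = j + 1
    · subst hi
      rw [w1]
      exact hperm1 x
    · rw [w3 i hi]
      unfold vis
      rw [hb3 x i hij, hbuf x i hi]
  have hmult : ∀ x, mult (adjOf G S' x) (vis (Function.update W (j + 1) W₁ j) s₂ j) x =
      mult (adjOf G S' x) (vis (W j) s j) x := fun x =>
    funext fun y => mult_congr fun w hw =>
      (hperm w ((mem_adjOf G).1 hw).2.1 j).mem_iff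
  refine ⟨s', W₁, f1, by rw [f8, keys_length], ?_, fun i hi => ?_, rfl, rfl, rfl, rfl, rfl, rfl,
    rfl, f6, hperm, ?_, ?_, hbuf⟩
  · refine ⟨?_, ?_, ?_, ?_, ?_, ?_, ?_, ?_, ?_⟩
    · intro i hi x hx
      by_cases hij : i = j
      · subst hij
        rw [if_pos (Nat.lt_succ_self i)]
        unfold NodeAt
        rw [hmult, hb2 x hx]
        exact f2 x hx
      · rw [if_congr (show i < j + 1 ↔ i < j by omega) rfl rfl]
        obtain ⟨e1, e2, e3⟩ := f3 x (i + 1) (Or.inr (by omega))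
        exact (H.node i hi x hx).congr (fun w _ y => (hvis i hij w).mem_iff) (fun _ _ => rfl)
          ((hb2 x hx _).trans e1) e2 rfl e3 rfl
    · intro i hi x hx hxW
      by_cases hij : i = j
      · subst hij
        rw [w1, f7, not_or] at hxW
        have := H.minimal i hi x hx hxW.2
        rw [if_pos (Nat.lt_succ_self i)]
        rw [if_neg (lt_irrefl i)] at this
        unfold MinimalAt
        rw [hmult, hcase x hx hxW.1]
        exact this
      · rw [if_congr (show i < j + 1 ↔ i < j by omega) rfl rfl]
        rw [w3 (i + 1) (by omega)] at hxW
        exact (H.minimal i hi x hx hxW).congr (fun w _ y => (hvis i hij w).mem_iff)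
          (fun _ _ => rfl) rfl
    · exact fun i hi x hx => (hperm x hx i).nodup_iff.2 (H.nodup i hi x hx)
    · intro i hi x hx y hy
      by_cases hij : i = j + 1
      · subst hij
        have h1 : y ∈ vis (W (j + 1)) s (j + 1) x :=
          (hperm x hx (j + 1)).mem_iff.1 (List.mem_append.2 (Or.inr hy))
        rcases List.mem_append.1 h1 with h2 | h2
        · exact ((Node.mem_keys (H.node j hj x hx)).1 h2).1
        · exact H.rank _ hi x hx y h2
      · rw [w3 i hij] at hy
        exact H.rank i hi x hx y hy
    · intro i x hx
      by_cases hij : i = j + 1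
      · subst hij
        rw [w1, f7] at hx
        exact hx.elim (hLS x) (H.stack_mem _ x)
      · rw [w3 i hij] at hx
        exact H.stack_mem i x hx
    · intro x hx
      rw [hb2 x hx, hbuf x 0 (by omega)]
      exact H.base_buf x hx
    · exact H.base_lvl
    · rw [w3 0 (by omega)]
      exact H.base_stack
    · intro i hi
      rw [w3 i (by omega)]
      exact H.top_stack i hi
  · exact (f3 u i (Or.inl huL)).1
  · intro x hx i
    by_cases hi : i = j + 1
    · subst hi
      exact f5 x
    · rw [show s'.buf x i = s.buf x i from hbuf x i hi]
  · intro x hx hxW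
    rw [f7, not_or] at hxW
    exact ⟨hxW.2, fun i => (f3 x i (Or.inl hxW.1)).1⟩

end KHCore

/-! ### Deleting a node: the loops over the stack and over the levels -/

namespace KHCore

variable {n : ℕ} (G : SimpleGraph (Fin n)) [DecidableRel G.Adj]

theorem Levels.congr {r : Fin n → ℕ} {N h : ℕ} {S : Finset (Fin n)}
    {A A' : ℕ → Fin n → List (Fin n)} {W : ℕ → Stack n} {pot pot' : Fin n → ℕ → ℕ} {s s' : Store n}
    (H : Levels r N h S A W pot s) (hA : ∀ i < h, A' i = A i)
    (hb : ∀ i ≤ h, ∀ v, s'.buf v i = s.buf v i) (hd : ∀ i ≤ h, ∀ v, s'.dep v i = s.dep v i)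
    (hl : ∀ i ≤ h, ∀ v, s'.lvl v i = s.lvl v i) (ht : ∀ i ≤ h, ∀ v, s'.ties v i = s.ties v i)
    (hp : ∀ i ≤ h, ∀ v, pot' v i = pot v i) : Levels r N h S A' W pot' s' := by
  have hvis : ∀ i ≤ h, ∀ x, vis (W i) s' i x = vis (W i) s i x := fun i hi x => by
    unfold vis
    rw [hb i hi]
  refine ⟨fun i hi v hv => ?_, fun i hi v hv hvW => ?_, fun i hi v hv => ?_, fun i hi v hv => ?_,
    H.stack_mem, fun v hv => ?_, fun v hv => ?_, H.base_stack, H.top_stack⟩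
  · rw [hA i hi]
    exact (H.node i hi v hv).congr (fun w _ x => by rw [hvis i hi.le]) (fun w _ => hl i hi.le w)
      (hb _ hi v) (hd _ hi v) (hl _ hi v) (ht _ hi v) (hp _ hi v)
  · rw [hA i hi]
    exact (H.minimal i hi v hv hvW).congr (fun w _ x => by rw [hvis i hi.le])
      (fun w _ => hl i hi.le w) (hl _ hi v)
  · rw [hvis i hi]
    exact H.nodup i hi v hv
  · rw [hl i hi]
    exact H.rank i hi v hv
  · rw [hb 0 (Nat.zero_le _)]
    exact H.base_buf v hv
  · rw [hl 0 (Nat.zero_le _)]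
    exact H.base_lvl v hv

theorem Levels.mono {r : Fin n → ℕ} {N h : ℕ} {S S' : Finset (Fin n)}
    {A : ℕ → Fin n → List (Fin n)} {pot : Fin n → ℕ → ℕ} {s : Store n}
    (H : Levels r N h S A (fun _ => []) pot s) (hS : S' ⊆ S) :
    Levels r N h S' A (fun _ => []) pot s :=
  ⟨fun i hi v hv => H.node i hi v (hS hv), fun i hi v hv => H.minimal i hi v (hS hv),
    fun i hi v hv => H.nodup i hi v (hS hv), fun i hi v hv => H.rank i hi v (hS hv), by simp,
    fun v hv => H.base_buf v (hS hv), fun v hv => H.base_lvl v (hS hv), rfl, fun _ _ => rfl⟩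

/-- Processing the stack of level `j + 1`. -/
theorem process_loop {r : Fin n → ℕ} {N h : ℕ} {M : ℝ} (hM : 0 ≤ M) (hN : ⌊M⌋₊ = N)
    (hN1 : 1 ≤ N) {S S' : Finset (Fin n)} (hSS : S' ⊆ S) {j : ℕ} (hj : j < h) {dg : Fin n → ℕ}
    (hdg : ∀ x ∈ S', (adjOf G S' x).length ≤ dg x)
    {A : ℕ → Fin n → List (Fin n)} (hA : A = fun i => if i < j + 1 then adjOf G S' else adjOf G S)
    {R : Stack n} {pot : Fin n → ℕ → ℕ} {s : Store n} (hadj : s.adj = adjOf G S')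
    (H : Levels r N h S' A (fun i => if i = j + 1 then R else []) pot s) (Q : Queue S' s)
    (F : Fresh M h S' (if h = j + 1 then R else []) s) :
    ∃ s' W₂ pot', (forEach (process r M h j) R (s, [])).val = (s', W₂) ∧
      Levels r N h S' A (fun i => if i = j + 2 then W₂ else []) pot' s' ∧ Queue S' s' ∧
      Fresh M h S' (if h = j + 2 then W₂ else []) s' ∧ s'.adj = adjOf G S' ∧
      (∀ x, x ∉ S' → ∀ i, s'.buf x i = s.buf x i) ∧
      (forEach (process r M h j) R (s, [])).steps +
        potential N h dg S' (fun i => if i = j + 2 then W₂ else []) pot' s' + s.ptr ≤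
        potential N h dg S' (fun i => if i = j + 1 then R else []) pot s + s'.ptr := by
  have key := forEach_rule (body := process r M h j)
    (fun R' sW t => ∃ pot', Levels r N h S' A
        (fun i => if i = j + 1 then R' else if i = j + 2 then sW.2 else []) pot' sW.1 ∧
      Queue S' sW.1 ∧
      Fresh M h S' (if h = j + 1 then R' else if h = j + 2 then sW.2 else []) sW.1 ∧
      sW.1.adj = adjOf G S' ∧ (∀ x, x ∉ S' → ∀ i, sW.1.buf x i = s.buf x i) ∧
      t + potential N h dg S' (fun i => if i = j + 1 then R' else if i = j + 2 then sW.2 else [])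
        pot' sW.1 + s.ptr ≤
        potential N h dg S' (fun i => if i = j + 1 then R else []) pot s + sW.1.ptr)
    ?_ R (s, []) 0 ?_
  · obtain ⟨pot', h1, h2, h3, h4, h5, h6⟩ := key
    have e : (fun i => if i = j + 1 then [] else if i = j + 2 then
        (forEach (process r M h j) R (s, [])).val.2 else []) =
        fun i => if i = j + 2 then (forEach (process r M h j) R (s, [])).val.2 else [] := by
      funext i
      split_ifs <;> first | rfl | omega
    have e' := congrFun e h
    rw [e] at h1 h6
    rw [e'] at h3
    refine ⟨_, _, pot', rfl, h1, h2, h3, h4, h5, ?_⟩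
    rw [zero_add] at h6
    exact h6
  · rintro ⟨v, Y⟩ R' ⟨s₁, W₂⟩ t ⟨pot', h1, h2, h3, h4, h5, h6⟩
    dsimp only at h1 h2 h3 h4 h5 h6
    set W : ℕ → Stack n := fun i => if i = j + 1 then (v, Y) :: R' else if i = j + 2 then W₂ else []
      with hW
    have w0 : W j = [] := by simp [hW]
    have w1 : W (j + 1) = (v, Y) :: R' := by simp [hW]
    have w2 : W (j + 2) = W₂ := by simp [hW]
    have hv : v ∈ S' := h1.stack_mem (j + 1) v (by simp [w1])
    obtain ⟨s', W₃, pot₃, g1, g2, g3, g4, g5, g6, g7⟩ := process_spec hM hN hN1 h1 h2 h3 hj w0 w1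
      (dg := dg)
      (fun x _ => by rw [h4, hA]; simp)
      (fun x hx w hw => by rw [h4] at hw; exact ((mem_adjOf G).1 hw).2.1)
      (fun x _ => by rw [h4]; exact adjOf_nodup G S' x)
      (fun x hx => by rw [h4]; exact hdg x hx)
      -- Beyond level `j + 1` the invariant still refers to the graph on `S`, while `s.adj` is the
      -- reduced one. Both have the same edges between surviving nodes.
      (fun _ x hx => by
        rw [h4, hA]
        simp only [lt_irrefl, if_false]
        refine ⟨adjOf_nodup G S x, ?_⟩
        rw [mem_adjOf, mem_adjOf, G.adj_comm]
        exact ⟨fun h => ⟨hv, hx, h.2.2⟩, fun h => ⟨hSS hx, hSS hv, h.2.2⟩⟩)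
    rw [w2] at g1 g7
    have e : Function.update (Function.update W (j + 1) R') (j + 2) W₃ =
        fun i => if i = j + 1 then R' else if i = j + 2 then W₃ else [] := by
      funext i
      by_cases hi2 : i = j + 2
      · subst hi2
        simp
      · by_cases hi1 : i = j + 1
        · subst hi1
          simp
        · simp [hi1, hi2, hW]
    have e' := congrFun e h
    rw [e] at g2 g7
    rw [e'] at g4
    rw [g1]
    refine ⟨pot₃, g2, g3, g4, g5.trans h4, fun x hx i => (g6 x hx i).trans (h5 x hx i), ?_⟩
    dsimp only
    omega
  · refine ⟨pot, ?_, Q, ?_, hadj, fun _ _ _ => rfl, ?_⟩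
    · convert H using 3
      split_ifs <;> rfl
    · convert F using 2
      split_ifs <;> rfl
    · have e : (fun i => if i = j + 1 then R else if i = j + 2 then ([] : Stack n) else []) =
          fun i => if i = j + 1 then R else [] := by
        funext i
        split_ifs <;> rfl
      dsimp only
      rw [e]
      omega

theorem potential_congr {N h : ℕ} {dg : Fin n → ℕ} {S : Finset (Fin n)} {W W' : ℕ → Stack n}
    {pot : Fin n → ℕ → ℕ} {s s' : Store n}
    (hvis : ∀ x ∈ S, ∀ i, (vis (W' i) s' i x).length = (vis (W i) s i x).length)
    (hkey : s'.key = s.key) :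
    potential N h dg S W' pot s' + 6 * ∑ i ∈ Finset.Icc 1 h, (W i).length =
      potential N h dg S W pot s + 6 * ∑ i ∈ Finset.Icc 1 h, (W' i).length := by
  have h1 : ∑ v ∈ S, ∑ i ∈ Finset.Icc 1 h,
      dg v * (37 * (N + 1) * pot v i + 9 * (vis (W' i) s' i v).length) =
      ∑ v ∈ S, ∑ i ∈ Finset.Icc 1 h,
      dg v * (37 * (N + 1) * pot v i + 9 * (vis (W i) s i v).length) :=
    Finset.sum_congr rfl fun x hx => Finset.sum_congr rfl fun i _ => by rw [hvis x hx i]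
  unfold potential
  rw [h1, hkey]
  omega

theorem Queue.congr {S : Finset (Fin n)} {s s' : Store n} (Q : Queue S s)
    (hb : s'.bucket = s.bucket) (hk : s'.key = s.key) (hp : s'.ptr = s.ptr) (ht : s'.top = s.top) :
    Queue S s' := by
  refine ⟨?_, ?_, ?_, ?_⟩
  · rw [hb, hk]; exact Q.mem
  · rw [hb]; exact Q.nodup
  · rw [hk, ht]; exact Q.key_lt
  · rw [hk, hp]; exact Q.ptr_le

/-- The cost of a deletion which is not paid by the potential. -/
def deleteCharge (N h d : ℕ) : ℕ := 1 + d + h * (1 + N + d * (N + 8))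

/-- Before round `j`, the steps between levels below `j` refer to the graph without `u` and the
others to the graph with `u`; round `j` announces the loss of `u` to level `j + 1` and then empties
the stack there. A round adds one step of the loop, at most `N` for reading the buffer of `u`, `d *
(N + 2)` for the notifications and `6 * d` of potential for the entries they push; all else is paid
by the potential. -/
theorem update_spec {r : Fin n → ℕ} {N h : ℕ} {M : ℝ} (hM : 0 ≤ M) (hN : ⌊M⌋₊ = N)
    (hN1 : 1 ≤ N) {S : Finset (Fin n)} {u : Fin n} (hu : u ∈ S) {dg : Fin n → ℕ}
    (hdg : ∀ T x, (adjOf G T x).length ≤ dg x)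
    {pot : Fin n → ℕ → ℕ} {s : Store n} (hadj : s.adj = adjOf G S)
    (H : Levels r N h S (fun _ => adjOf G S) (fun _ => []) pot s) (Q : Queue (S.erase u) s)
    (F : Fresh M h (S.erase u) [] s) :
    ∃ pot', Levels r N h (S.erase u) (fun _ => adjOf G (S.erase u)) (fun _ => []) pot'
        (update r M h u s).val ∧ Queue (S.erase u) (update r M h u s).val ∧
      Fresh M h (S.erase u) [] (update r M h u s).val ∧
      (update r M h u s).val.adj = adjOf G (S.erase u) ∧
      (update r M h u s).steps +
        potential N h dg (S.erase u) (fun _ => []) pot' (update r M h u s).val + s.ptr ≤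
        potential N h dg (S.erase u) (fun _ => []) pot s + (update r M h u s).val.ptr +
        deleteCharge N h (dg u) := by
  set S' := S.erase u with hS'
  set L := adjOf G S u with hL
  set d := dg u with hd
  have hLd : L.length ≤ d := hdg S u
  set s₀ : Store n := { s with adj := adjOf G S' } with hs₀
  set body := fun j (sU : Store n × Stack n) => (do
      let Y ← scan (fun e => some e.1) (sU.1.buf u j)
      let sU ← forEach (notify j Y (some (sU.1.lvl u j))) L sU
      let s := { sU.1 with buf := write sU.1.buf u j [] }
      forEach (process r M h j) sU.2 (s, []) : Timed (Store n × Stack n)) with hbody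
  have hup : (update r M h u s).val = (forEach body (List.range h) (s₀, [])).val.1 ∧
      (update r M h u s).steps = 1 + (L.length + (forEach body (List.range h) (s₀, [])).steps) := by
    have h1 : (forEach (fun w (s : Store n) =>
        pure { s with adj := Function.update s.adj w ((s.adj w).erase u) }) (s.adj u) s :
          Timed (Store n)).val =
        { s with adj := fun w => if w ∈ L then (adjOf G S w).erase u else adjOf G S w } := by
      rw [forEach_pure_val, foldl_erase u (by rw [hadj]; exact adjOf_nodup G S u), hadj]
    have h2 := adj_after G hu
    unfold update
    simp only [bind_val, bind_steps, pure_steps, pure_val, tick_steps, h1, forEach_pure_steps]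
    rw [h2, hadj]
    exact ⟨rfl, rfl⟩
  have hbu : ∀ i ≤ h, (keys (s.buf u i)).Nodup ∧ (s.buf u i).length ≤ N := by
    intro i hi
    rcases Nat.eq_zero_or_pos i with rfl | hpos
    · rw [H.base_buf u hu]
      simpa using hN1
    · obtain ⟨q, rfl⟩ : ∃ q, i = q + 1 := ⟨i - 1, by omega⟩
      have := H.node q (by omega) u hu
      exact ⟨this.lists.nodup, this.length_le⟩
  have key := forEach_rule (body := body)
    (fun R sU t => ∃ j, j ≤ h ∧ R = List.range' j (h - j) ∧ ∃ pot',
      Levels r N h S' (fun i => if i < j then adjOf G S' else adjOf G S)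
        (fun i => if i = j + 1 then sU.2 else []) pot' sU.1 ∧
      Queue S' sU.1 ∧ Fresh M h S' (if h = j + 1 then sU.2 else []) sU.1 ∧
      sU.1.adj = adjOf G S' ∧ (∀ i, j ≤ i → sU.1.buf u i = s.buf u i) ∧
      t + potential N h dg S' (fun i => if i = j + 1 then sU.2 else []) pot' sU.1 + s.ptr ≤
        potential N h dg S' (fun _ => []) pot s + sU.1.ptr + j * (1 + N + d * (N + 8)))
    ?_ (List.range h) (s₀, []) 0 ?_
  · obtain ⟨j, hj, hR, pot', h1, h2, h3, h4, h5, h6⟩ := key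
    have hjh : j = h := by
      have := congrArg List.length hR
      simp at this
      omega
    subst hjh
    -- Nothing is pushed beyond level `h`, so the last stack is empty.
    have hnil := h1.top_stack (j + 1) (by omega)
    rw [if_pos rfl] at hnil
    have e : (fun i => if i = j + 1 then (forEach body (List.range j) (s₀, [])).val.2 else []) =
        fun _ => ([] : Stack n) := by
      funext i
      rw [hnil, ite_self]
    rw [e] at h1 h6
    rw [hup.1, hup.2]
    refine ⟨pot', h1.congr (fun i hi => by simp [hi]) (fun _ _ _ => rfl) (fun _ _ _ => rfl)
      (fun _ _ _ => rfl) (fun _ _ _ => rfl) (fun _ _ _ => rfl), h2, ?_, h4, ?_⟩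
    · rwa [if_neg (by omega)] at h3
    · unfold deleteCharge
      omega
  · rintro a R ⟨s₁, W₁⟩ t ⟨j, hj, hR, pot', h1, h2, h3, h4, h5, h6⟩
    dsimp only at h1 h2 h3 h4 h5 h6
    obtain ⟨k, hk⟩ : ∃ k, h - j = k + 1 := ⟨h - j - 1, by
      have := congrArg List.length hR
      simp at this
      omega⟩
    rw [hk, List.range'_succ] at hR
    obtain ⟨rfl, hR⟩ := List.cons.inj hR
    have hjh : a < h := by omega
    set W : ℕ → Stack n := fun i => if i = a + 1 then W₁ else [] with hW
    have w1 : W (a + 1) = W₁ := by simp [hW]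
    have hbua := hbu a hj
    rw [← h5 a le_rfl] at hbua
    obtain ⟨s₂, W₂, g1, g2, g3, g4, g5, g6, g7, g8, g9, g10, g11, g12, g13, g14, g15, g16⟩ :=
      h1.delete G hu hjh (by simp [hW]) hbua.1
    rw [w1] at g1 g2 g12 g15
    have eW : Function.update W (a + 1) W₂ = fun i => if i = a + 1 then W₂ else [] := by
      funext i
      by_cases hi : i = a + 1
      · subst hi
        simp
      · simp [hi, hW]
    set s₃ : Store n := { s₂ with buf := write s₂.buf u a [] } with hs₃
    have hb3 : ∀ x ∈ S', ∀ i, s₃.buf x i = s₂.buf x i := fun x hx i =>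
      write_ne _ _ (Or.inl (Finset.ne_of_mem_erase hx))
    rw [eW] at g3 g13
    have hQ : Queue S' s₃ := h2.congr g8 g9 g10 g11
    have hF : Fresh M h S' (if h = a + 1 then W₂ else []) s₃ := by
      have hsz : ∀ x ∈ S', size h s₃ x ≤ size h s₁ x := fun x hx => by
        unfold size
        rw [hb3 x hx]
        exact ((g14 x hx h).erase x).length_le
      refine ⟨fun x hx => ?_, fun x hx hxW => ?_⟩
      · rw [show s₃.lvl = s₁.lvl from g6, show s₃.key = s₁.key from g9]
        refine le_trans ?_ (h3.le x hx)
        rw [bucketIndex_eq hN, bucketIndex_eq hN]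
        exact Nat.add_le_add_left (hsz x hx) _
      · have hsame : x ∉ (if h = a + 1 then W₁ else []).map Prod.fst ∧
            s₂.buf x h = s₁.buf x h := by
          by_cases hh : h = a + 1
          · rw [if_pos hh] at hxW ⊢
            obtain ⟨i1, i2⟩ := g15 x hx hxW
            exact ⟨i1, i2 h⟩
          · rw [if_neg hh]
            exact ⟨by simp, g16 x h hh⟩
        have hsz : size h s₃ x = size h s₁ x := by
          unfold size
          rw [hb3 x hx, hsame.2]
        rw [hsz, show s₃.lvl = s₁.lvl from g6, show s₃.key = s₁.key from g9,
          show s₃.est = s₁.est from g7]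
        exact h3.eq x hx hsame.1
    obtain ⟨s₄, W₃, pot₃, f1, f2, f3, f4, f5, f6, f7⟩ := process_loop G hM hN hN1
      (Finset.erase_subset u S) hjh (dg := dg) (fun x _ => hdg _ x) rfl
      (show s₃.adj = _ from g5.trans h4) g3 hQ hF
    have hpc := potential_congr (N := N) (h := h) (dg := dg) (pot := pot') (S := S')
      (W := W) (W' := fun i => if i = a + 1 then W₂ else []) (s := s₁) (s' := s₃)
      (fun x hx i => (g13 x hx i).length_eq) g9
    have hsum : ∑ i ∈ Finset.Icc 1 h, (if i = a + 1 then W₂ else []).length =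
        ∑ i ∈ Finset.Icc 1 h, (W i).length + L.length := by
      have hmem : a + 1 ∈ Finset.Icc 1 h := Finset.mem_Icc.2 ⟨by omega, by omega⟩
      have := sum_change hmem (f := fun i => (W i).length)
        (g := fun i => (if i = a + 1 then W₂ else []).length)
        (fun i _ hi => by simp [hi, hW])
      have e1 : (if a + 1 = a + 1 then W₂ else []).length = W₁.length + L.length := by
        rw [if_pos rfl]
        exact g12
      rw [e1, w1] at this
      omega
    have hval : (body a (s₁, W₁)).val = (s₄, W₃) ∧ (body a (s₁, W₁)).steps =
        (s₁.buf u a).length + (L.length * ((s₁.buf u a).length + 2) +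
          (forEach (process r M h a) W₂ (s₃, [])).steps) := by
      have hsc : (s₁.buf u a).filterMap (fun e => some e.1) = keys (s₁.buf u a) := by
        simp [keys]
      simp only [hbody, bind_val, bind_steps, scan_val, scan_steps, hsc]
      rw [g1, g2]
      exact ⟨f1, rfl⟩
    rw [hval.1]
    refine ⟨a + 1, hjh, ?_, pot₃, f2, f3, f4, f5, fun i hi => ?_, ?_⟩
    · rw [hR]
      congr 1
      omega
    · dsimp only
      rw [f6 u (Finset.notMem_erase _ _) i, hs₃]
      dsimp only
      rw [write_ne _ _ (Or.inr (by omega)), g4 i (by omega), h5 i (by omega)]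
    · dsimp only
      rw [hsum] at hpc
      rw [hval.2]
      have hp3 : s₃.ptr = s₁.ptr := g10
      rw [hp3] at f7
      have h7 := hbua.2
      have h8 : L.length * ((s₁.buf u a).length + 2) ≤ d * (N + 2) :=
        Nat.mul_le_mul hLd (by omega)
      have h9 : (a + 1) * (1 + N + d * (N + 8)) =
          a * (1 + N + d * (N + 8)) + 1 + N + d * (N + 2) + 6 * d := by ring
      have f8 : (forEach (process r M h a) W₂ (s₃, [])).steps +
          potential N h dg S' (fun i => if i = a + 1 + 1 then W₃ else []) pot₃ s₄ + s₁.ptr ≤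
          potential N h dg S' (fun i => if i = a + 1 then W₂ else []) pot' s₃ + s₄.ptr := f7
      rw [h9]
      have h10 : 6 * L.length ≤ 6 * d := Nat.mul_le_mul_left 6 hLd
      omega
  · refine ⟨0, Nat.zero_le _, by rw [List.range_eq_range', Nat.sub_zero], pot, ?_, ?_, ?_, rfl,
      fun _ _ => rfl, ?_⟩
    · have e : (fun i => if i = 0 + 1 then ([] : Stack n) else []) = fun _ => [] := by
        funext i
        rw [ite_self]
      dsimp only
      rw [e]
      exact (H.mono (Finset.erase_subset u S)).congr (fun i _ => by simp) (fun _ _ _ => rfl) (fun _ _ _ => rfl)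
        (fun _ _ _ => rfl) (fun _ _ _ => rfl) (fun _ _ _ => rfl)
    · exact Q.congr rfl rfl rfl rfl
    · dsimp only
      rw [ite_self]
      exact ⟨F.le, F.eq⟩
    · have e : (fun i => if i = 0 + 1 then ([] : Stack n) else []) = fun _ => [] := by
        funext i
        rw [ite_self]
      dsimp only
      rw [e]
      have : potential N h dg S' (fun _ => []) pot s₀ = potential N h dg S' (fun _ => []) pot s :=
        rfl
      have h2 : s₀.ptr = s.ptr := rfl
      rw [this, h2]
      omega

end KHCore

namespace KHCore

variable {n : ℕ}

/-! ## The estimates as functions of the remaining graph -/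

/-- The smallest threshold at which at most `N` nodes of `B` are sampled. -/
noncomputable def threshold (r : Fin n → ℕ) (N : ℕ) (B : Finset (Fin n)) : ℕ :=
  sInf {k | (B.filter fun x => k ≤ r x).card ≤ N}

theorem threshold_spec (r : Fin n → ℕ) (N : ℕ) (B : Finset (Fin n)) :
    (B.filter fun x => threshold r N B ≤ r x).card ≤ N := by
  have hne : {k | (B.filter fun x => k ≤ r x).card ≤ N}.Nonempty := by
    refine ⟨(B.sup r) + 1, ?_⟩
    have h0 : (B.filter fun x => B.sup r + 1 ≤ r x) = ∅ := Finset.filter_eq_empty_iff.2 fun x hx => by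
      have := Finset.le_sup (f := r) hx
      omega
    change (B.filter fun x => B.sup r + 1 ≤ r x).card ≤ N
    rw [h0]
    exact Nat.zero_le N
  exact Nat.sInf_mem hne

theorem threshold_le {r : Fin n → ℕ} {N : ℕ} {B : Finset (Fin n)} {k : ℕ}
    (h : (B.filter fun x => k ≤ r x).card ≤ N) : threshold r N B ≤ k := Nat.sInf_le h

theorem threshold_mono {r : Fin n → ℕ} {N : ℕ} {B B' : Finset (Fin n)} (h : B ⊆ B') :
    threshold r N B ≤ threshold r N B' :=
  threshold_le (le_trans (Finset.card_le_card (Finset.filter_subset_filter _ h))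
    (threshold_spec r N B'))

/-- The number of nodes of `B` other than `v` which are sampled. -/
noncomputable def sampleSize (r : Fin n → ℕ) (N : ℕ) (B : Finset (Fin n)) (v : Fin n) : ℕ :=
  ((B.filter fun x => threshold r N B ≤ r x).erase v).card

theorem sampleSize_le (r : Fin n → ℕ) (N : ℕ) (B : Finset (Fin n)) (v : Fin n) :
    sampleSize r N B v ≤ N :=
  (Finset.card_le_card (Finset.erase_subset _ _)).trans (threshold_spec r N B)

/-- The estimate of `|B \ {v}|`. -/
noncomputable def sizeEstimate (r : Fin n → ℕ) (M : ℝ) (B : Finset (Fin n)) (v : Fin n) : ℝ :=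
  estimate M (sampleSize r ⌊M⌋₊ B v) (threshold r ⌊M⌋₊ B)

theorem estimate_nonneg (M : ℝ) (b k : ℕ) : 0 ≤ estimate M b k := by
  have h : (0 : ℝ) ≤ (b : ℝ) * 2 ^ k := by positivity
  unfold estimate
  split_ifs
  · exact le_trans h (le_max_left _ _)
  · exact h

/-- A larger set has a larger threshold, or the same threshold and at least as many sampled nodes,
hence a bucket index at least as large. The term `M * 2 ^ (k - 1)` in the estimate is what keeps it
from falling when the threshold rises. -/
theorem sizeEstimate_mono {r : Fin n → ℕ} {M : ℝ} (hM : 0 ≤ M) {B B' : Finset (Fin n)}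
    (h : B ⊆ B') (v : Fin n) : sizeEstimate r M B v ≤ sizeEstimate r M B' v := by
  refine (estimate_le_of_bucketIndex_le hM (sampleSize_le _ _ _ _) (sampleSize_le _ _ _ _) ?_).2
  unfold bucketIndex
  rcases (threshold_mono (r := r) (N := ⌊M⌋₊) h).lt_or_eq with hlt | heq
  · have h1 := sampleSize_le r ⌊M⌋₊ B v
    have h2 := Nat.mul_le_mul_right (⌊M⌋₊ + 1) (Nat.succ_le_of_lt hlt)
    rw [Nat.succ_mul] at h2
    omega
  · rw [heq]
    refine Nat.add_le_add_left (Finset.card_le_card (Finset.erase_subset_erase _ ?_)) _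
    rw [heq]
    exact Finset.filter_subset_filter _ h

variable (G : SimpleGraph (Fin n)) [DecidableRel G.Adj]

/-- The nodes that can be reached from `v` by at most `i` edges in the graph induced by `S`. -/
def ball (S : Finset (Fin n)) : ℕ → Fin n → Finset (Fin n)
  | 0, v => {v}
  | i + 1, v => insert v ((adjOf G S v).toFinset.biUnion (ball S i))

theorem mem_ball_succ {S : Finset (Fin n)} {i : ℕ} {v x : Fin n} :
    x ∈ ball G S (i + 1) v ↔ x = v ∨ ∃ w ∈ adjOf G S v, x ∈ ball G S i w := by
  simp [ball]

theorem self_mem_ball (S : Finset (Fin n)) (i : ℕ) (v : Fin n) : v ∈ ball G S i v := by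
  cases i <;> simp [ball]

theorem ball_mono {S S' : Finset (Fin n)} (h : S ⊆ S') (i : ℕ) (v : Fin n) :
    ball G S i v ⊆ ball G S' i v := by
  induction i generalizing v with
  | zero => exact Finset.Subset.refl _
  | succ i ih =>
    intro x hx
    rw [mem_ball_succ] at hx ⊢
    refine hx.imp id ?_
    rintro ⟨w, hw, hxw⟩
    obtain ⟨h1, h2, h3⟩ := (mem_adjOf G).1 hw
    exact ⟨w, (mem_adjOf G).2 ⟨h h1, h h2, h3⟩, ih w hxw⟩

theorem mult_pos {A : List (Fin n)} {X : Fin n → List (Fin n)} {v x : Fin n} :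
    0 < mult A X v x ↔ x = v ∨ ∃ w ∈ A, x ∈ X w := by
  unfold mult
  by_cases h : x = v
  · simp [h]
  · simp [h, List.countP_pos_iff]

variable {G} in
/-- The buffers and thresholds are determined by the remaining graph. -/
theorem Levels.eq_threshold {r : Fin n → ℕ} {N h : ℕ} (hN1 : 1 ≤ N) {S : Finset (Fin n)}
    {pot : Fin n → ℕ → ℕ} {s : Store n}
    (H : Levels r N h S (fun _ => adjOf G S) (fun _ => []) pot s) :
    ∀ i ≤ h, ∀ v ∈ S, s.lvl v i = threshold r N (ball G S i v) ∧
      ∀ x, x ∈ keys (s.buf v i) ↔ x ∈ ball G S i v ∧ s.lvl v i ≤ r x := by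
  intro i
  induction i with
  | zero =>
    intro _ v hv
    rw [H.base_lvl v hv, H.base_buf v hv]
    refine ⟨?_, by simp [ball, keys]⟩
    symm
    rw [← Nat.le_zero]
    refine threshold_le ((Finset.card_filter_le _ _).trans ?_)
    simpa [ball] using hN1
  | succ i ih =>
    intro hi v hv
    have hnode : NodeAt r N (adjOf G S) [] pot s i v := H.node i hi v hv
    have hmin : MinimalAt r N (adjOf G S) [] s i v := H.minimal i hi v hv (by simp)
    set c := mult (adjOf G S v) (vis [] s i) v with hc
    -- If `k` dominates the thresholds of all neighbours, the sampling at the level below has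
    -- discarded no node of rank at least `k`, so at these ranks the counters see the whole ball.
    have hiff : ∀ k, (∀ w ∈ adjOf G S v, s.lvl w i ≤ k) → ∀ x,
        (k ≤ r x ∧ 0 < c x ↔ x ∈ ball G S (i + 1) v ∧ k ≤ r x) := by
      intro k hk x
      rw [hc, mult_pos, mem_ball_succ]
      constructor
      · rintro ⟨h1, h2⟩
        refine ⟨h2.imp id ?_, h1⟩
        rintro ⟨w, hw, hx⟩
        rw [vis_nil] at hx
        exact ⟨w, hw, (((ih (by omega) w ((mem_adjOf G).1 hw).2.1).2 x).1 hx).1⟩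
      · rintro ⟨h1, h2⟩
        refine ⟨h2, h1.imp id ?_⟩
        rintro ⟨w, hw, hx⟩
        refine ⟨w, hw, ?_⟩
        rw [vis_nil]
        exact ((ih (by omega) w ((mem_adjOf G).1 hw).2.1).2 x).2 ⟨hx, (hk w hw).trans h2⟩
    have hcard : ∀ k, (∀ w ∈ adjOf G S v, s.lvl w i ≤ k) →
        (Finset.univ.filter fun x => k ≤ r x ∧ 0 < c x) =
          (ball G S (i + 1) v).filter fun x => k ≤ r x := by
      intro k hk
      ext x
      rw [Finset.mem_filter, Finset.mem_filter, hiff k hk x]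
      simp
    have hle : ∀ w ∈ adjOf G S v, s.lvl w i ≤ s.lvl v (i + 1) := fun w hw =>
      hnode.le _ (List.mem_map.2 ⟨w, hw, rfl⟩)
    refine ⟨le_antisymm ?_ ?_, fun x => ?_⟩
    -- The ball of a neighbour lies in the ball of `v`; by monotonicity the threshold of the latter
    -- dominates, and minimality can be applied to it.
    · have hthr : ∀ w ∈ adjOf G S v, s.lvl w i ≤ threshold r N (ball G S (i + 1) v) := by
        intro w hw
        rw [(ih (by omega) w ((mem_adjOf G).1 hw).2.1).1]
        refine threshold_mono fun x hx => ?_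
        rw [mem_ball_succ]
        exact Or.inr ⟨w, hw, hx⟩
      refine hmin _ (fun κ hκ => ?_) ?_
      · obtain ⟨w, hw, rfl⟩ := List.mem_map.1 hκ
        exact hthr w hw
      · rw [← hc, hcard _ hthr]
        exact threshold_spec r N _
    · refine threshold_le ?_
      rw [← hcard _ hle]
      exact Node.card_le hnode
    · rw [Node.mem_keys hnode, ← hc, hiff _ hle]

variable {G} in
theorem Levels.size_eq {r : Fin n → ℕ} {N h : ℕ} (hN1 : 1 ≤ N) {S : Finset (Fin n)}
    {pot : Fin n → ℕ → ℕ} {s : Store n}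
    (H : Levels r N h S (fun _ => adjOf G S) (fun _ => []) pot s) {v : Fin n} (hv : v ∈ S) :
    size h s v = sampleSize r N (ball G S h v) v := by
  have hnd : (keys (s.buf v h)).Nodup := by
    have := H.nodup h le_rfl v hv
    rwa [vis_nil] at this
  obtain ⟨h1, h2⟩ := H.eq_threshold hN1 h le_rfl v hv
  unfold size sampleSize
  rw [← List.toFinset_card_of_nodup (hnd.erase v)]
  congr 1
  ext x
  rw [List.mem_toFinset, hnd.mem_erase_iff, Finset.mem_erase, Finset.mem_filter, h2, h1]

variable {G} in
theorem Fresh.est_eq {r : Fin n → ℕ} {M : ℝ} {h : ℕ} (hN1 : 1 ≤ ⌊M⌋₊) {S : Finset (Fin n)}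
    {pot : Fin n → ℕ → ℕ} {s : Store n}
    (H : Levels r ⌊M⌋₊ h S (fun _ => adjOf G S) (fun _ => []) pot s) (F : Fresh M h S [] s)
    {v : Fin n} (hv : v ∈ S) : s.est v = sizeEstimate r M (ball G S h v) v := by
  rw [(F.eq v hv (by simp)).2, H.size_eq hN1 hv, (H.eq_threshold hN1 h le_rfl v hv).1]
  rfl

-- A threshold that is admissible for all nodes is admissible for every ball. This single `k` bounds
-- both the number of recomputations and the number of buckets.
variable {G} in
theorem Levels.lvl_le {r : Fin n → ℕ} {N h : ℕ} (hN1 : 1 ≤ N) {S : Finset (Fin n)}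
    {pot : Fin n → ℕ → ℕ} {s : Store n}
    (H : Levels r N h S (fun _ => adjOf G S) (fun _ => []) pot s) {k : ℕ}
    (hk : (Finset.univ.filter fun x => k ≤ r x).card ≤ N) {i : ℕ} (hi : i ≤ h) {v : Fin n}
    (hv : v ∈ S) : s.lvl v i ≤ k := by
  rw [(H.eq_threshold hN1 i hi v hv).1]
  exact threshold_le ((Finset.card_le_card (Finset.filter_subset_filter _ (Finset.subset_univ _))).trans
    hk)

variable {G} in
theorem Levels.buf_length_le {r : Fin n → ℕ} {N h : ℕ} (hN1 : 1 ≤ N) {S : Finset (Fin n)}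
    {A : ℕ → Fin n → List (Fin n)} {W : ℕ → Stack n} {pot : Fin n → ℕ → ℕ} {s : Store n}
    (H : Levels r N h S A W pot s) {i : ℕ} (hi : i ≤ h) {v : Fin n} (hv : v ∈ S) :
    (s.buf v i).length ≤ N := by
  rcases Nat.eq_zero_or_pos i with rfl | hpos
  · rw [H.base_buf v hv]
    simpa using hN1
  · obtain ⟨q, rfl⟩ : ∃ q, i = q + 1 := ⟨i - 1, by omega⟩
    exact (H.node q (by omega) v hv).length_le

end KHCore

namespace KHCore

variable {n : ℕ}

/-! ## The initial computation -/

variable (G : SimpleGraph (Fin n)) [DecidableRel G.Adj]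

theorem adjOf_univ (v : Fin n) : adjOf G Finset.univ v = (initialStore G).adj v := by
  simp [adjOf, initialStore]

/-- The potential right after the initial computation. -/
def freshPot (s : Store n) : Fin n → ℕ → ℕ := fun v i => 2 * s.lvl v i + 1

theorem init_base (r : Fin n → ℕ) (N : ℕ) :
    let res := forEach (fun v (s : Store n) => do
      let _ ← touch (List.range (r v + 1))
      let _ ← touch (s.adj v)
      pure { s with buf := write s.buf v 0 [(v, 1)], lvl := write s.lvl v 0 0 })
      (List.finRange n) (initialStore G)
    res.val.adj = adjOf G Finset.univ ∧ (∀ p, res.val.bucket p = []) ∧ res.val.ptr = 0 ∧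
      res.val.top = 0 ∧
      Levels r N 0 Finset.univ (fun _ => adjOf G Finset.univ) (fun _ => []) (freshPot res.val)
        res.val ∧
      res.steps = ∑ v, (r v + 2 + (adjOf G Finset.univ v).length) := by
  intro res
  have key := forEach_rule (body := fun v (s : Store n) => (do
      let _ ← touch (List.range (r v + 1))
      let _ ← touch (s.adj v)
      pure { s with buf := write s.buf v 0 [(v, 1)], lvl := write s.lvl v 0 0 } : Timed (Store n)))
    (fun L s t => s.adj = adjOf G Finset.univ ∧ (∀ p, s.bucket p = []) ∧ s.ptr = 0 ∧ s.top = 0 ∧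
      (∀ v, v ∈ L ∨ (s.buf v 0 = [(v, 1)] ∧ s.lvl v 0 = 0)) ∧
      t + (L.map fun v => r v + 2 + (adjOf G Finset.univ v).length).sum =
        ∑ v, (r v + 2 + (adjOf G Finset.univ v).length))
    ?_ (List.finRange n) (initialStore G) 0 ?_
  · obtain ⟨h1, h2, h3, h4, h5, h6⟩ := key
    refine ⟨h1, h2, h3, h4, ?_, by simpa using h6⟩
    have hb : ∀ v, res.val.buf v 0 = [(v, 1)] := fun v => ((h5 v).resolve_left (by simp)).1
    refine ⟨fun i hi => absurd hi (by omega), fun i hi => absurd hi (by omega), ?_, ?_, ?_,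
      fun v _ => hb v, fun v _ => ((h5 v).resolve_left (by simp)).2, rfl, fun _ _ => rfl⟩
    · intro i hi v _
      obtain rfl : i = 0 := by omega
      rw [vis_nil, hb]
      simp [keys]
    · intro i hi v _ x hx
      simp [pend_nil] at hx
    · simp
  · rintro v L s t ⟨h1, h2, h3, h4, h5, h6⟩
    refine ⟨h1, h2, h3, h4, fun x => ?_, ?_⟩
    · by_cases hxv : x = v
      · subst hxv
        exact Or.inr ⟨write_same _ _ _ _, write_same _ _ _ _⟩
      · rcases h5 x with h | ⟨h, h'⟩
        · exact Or.inl ((List.mem_cons.1 h).resolve_left hxv)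
        · exact Or.inr ⟨(write_ne _ _ (Or.inl hxv)).trans h, (write_ne _ _ (Or.inl hxv)).trans h'⟩
    · simp only [bind_steps, touch_steps, List.length_range, pure_steps, h1] at h6 ⊢
      rw [List.map_cons, List.sum_cons] at h6
      omega
  · refine ⟨funext fun v => (adjOf_univ G v).symm, fun _ => rfl, rfl, rfl, fun v => Or.inl (by simp),
      ?_⟩
    rw [zero_add, ← List.ofFn_eq_map, List.sum_ofFn]

/-- `compute` reads level `j` and writes only the cell of `v` at level `j + 1`, so neither the lower
levels nor the nodes already treated are disturbed. -/
theorem init_level {r : Fin n → ℕ} {N : ℕ} {M : ℝ} (hM : 0 ≤ M) (hN : ⌊M⌋₊ = N) (hN1 : 1 ≤ N)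
    {j : ℕ} {s₀ : Store n} (hadj : s₀.adj = adjOf G Finset.univ) (hb : ∀ p, s₀.bucket p = [])
    (hp : s₀.ptr = 0) (ht : s₀.top = 0)
    (H : Levels r N j Finset.univ (fun _ => adjOf G Finset.univ) (fun _ => []) (freshPot s₀) s₀) :
    let res := forEach (fun v s => compute r M v j s) (List.finRange n) s₀
    res.val.adj = adjOf G Finset.univ ∧ (∀ p, res.val.bucket p = []) ∧ res.val.ptr = 0 ∧
      res.val.top = 0 ∧
      Levels r N (j + 1) Finset.univ (fun _ => adjOf G Finset.univ) (fun _ => [])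
        (freshPot res.val) res.val ∧
      res.steps ≤ ∑ v, (20 * ((adjOf G Finset.univ v).length * (N + 1)) + 4) := by
  intro res
  have key := forEach_rule (body := fun v s => compute r M v j s)
    (fun L s t => s.adj = adjOf G Finset.univ ∧ (∀ p, s.bucket p = []) ∧ s.ptr = 0 ∧ s.top = 0 ∧
      Levels r N j Finset.univ (fun _ => adjOf G Finset.univ) (fun _ => []) (freshPot s) s ∧
      (∀ v, v ∈ L ∨ (NodeAt r N (adjOf G Finset.univ) [] (freshPot s) s j v ∧
        MinimalAt r N (adjOf G Finset.univ) [] s j v)) ∧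
      t + (L.map fun v => 20 * ((adjOf G Finset.univ v).length * (N + 1)) + 4).sum ≤
        ∑ v, (20 * ((adjOf G Finset.univ v).length * (N + 1)) + 4))
    ?_ (List.finRange n) s₀ 0 ?_
  · obtain ⟨h1, h2, h3, h4, h5, h6, h7⟩ := key
    refine ⟨h1, h2, h3, h4, ?_, by simpa using h7⟩
    have hnode : ∀ v, NodeAt r N (adjOf G Finset.univ) [] (freshPot res.val) res.val j v := fun v =>
      ((h6 v).resolve_left (by simp)).1
    refine ⟨fun i hi v hv => ?_, fun i hi v hv hvW => ?_, fun i hi v hv => ?_, ?_, ?_, h5.base_buf,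
      h5.base_lvl, rfl, fun _ _ => rfl⟩
    · rcases (Nat.lt_succ_iff.1 hi).lt_or_eq with h | rfl
      · exact h5.node i h v hv
      · exact hnode v
    · rcases (Nat.lt_succ_iff.1 hi).lt_or_eq with h | rfl
      · exact h5.minimal i h v hv hvW
      · exact ((h6 v).resolve_left (by simp)).2
    · rcases hi.lt_or_eq with h | rfl
      · exact h5.nodup i (by omega) v hv
      · rw [vis_nil]
        exact (hnode v).lists.nodup
    · intro i hi v _ x hx
      simp [pend_nil] at hx
    · simp
  · rintro v L s t ⟨h1, h2, h3, h4, h5, h6, h7⟩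
    have hsort : ∀ w, (keys (s.buf w j)).Pairwise (before r) := by
      intro w
      rcases Nat.eq_zero_or_pos j with rfl | hpos
      · rw [h5.base_buf w (Finset.mem_univ _)]
        simp [keys]
      · obtain ⟨q, rfl⟩ : ∃ q, j = q + 1 := ⟨j - 1, by omega⟩
        exact (h5.node q (by omega) w (Finset.mem_univ _)).sorted
    obtain ⟨B, D, k, m, e, g1, g2, g3, g4⟩ := compute_spec hM hN hN1 v j s (fun w _ => hsort w)
      (fun w _ => h5.buf_length_le hN1 le_rfl (Finset.mem_univ _)) rfl rfl
    have hb : ∀ x i, x ≠ v ∨ i ≠ j + 1 → (compute r M v j s).val.buf x i = s.buf x i := by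
      rw [e]
      exact fun x i h => write_ne _ _ h
    have hd : ∀ x i, x ≠ v ∨ i ≠ j + 1 → (compute r M v j s).val.dep x i = s.dep x i := by
      rw [e]
      exact fun x i h => write_ne _ _ h
    have hl : ∀ x i, x ≠ v ∨ i ≠ j + 1 → (compute r M v j s).val.lvl x i = s.lvl x i := by
      rw [e]
      exact fun x i h => write_ne _ _ h
    have hti : ∀ x i, x ≠ v ∨ i ≠ j + 1 → (compute r M v j s).val.ties x i = s.ties x i := by
      rw [e]
      exact fun x i h => write_ne _ _ h
    have hp : ∀ x i, x ≠ v ∨ i ≠ j + 1 → freshPot (compute r M v j s).val x i = freshPot s x i := by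
      intro x i h
      unfold freshPot
      rw [hl x i h]
    have hvis : ∀ x, vis [] (compute r M v j s).val j x = vis [] s j x := fun x => by
      rw [vis_nil, vis_nil, hb x j (Or.inr (by omega))]
    have hlj : ∀ x, (compute r M v j s).val.lvl x j = s.lvl x j := fun x =>
      hl x j (Or.inr (by omega))
    refine ⟨by rw [e]; exact h1, by rw [e]; exact h2, by rw [e]; exact h3, by rw [e]; exact h4,
      h5.congr (fun _ _ => rfl) (fun i hi x => hb x i (Or.inr (by omega)))
        (fun i hi x => hd x i (Or.inr (by omega))) (fun i hi x => hl x i (Or.inr (by omega)))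
        (fun i hi x => hti x i (Or.inr (by omega))) (fun i hi x => hp x i (Or.inr (by omega))),
      fun x => ?_, ?_⟩
    · by_cases hxv : x = v
      · subst hxv
        right
        have hX : (fun w => keys (s.buf w j)) = vis [] s j := funext fun w => (vis_nil s j w).symm
        rw [h1, hX] at g1 g3
        unfold NodeAt MinimalAt freshPot
        rw [funext hvis]
        simp only [hlj]
        rw [e]
        simp only [write_same]
        exact ⟨g1, g3⟩
      · rcases h6 x with h | ⟨h, h'⟩
        · exact Or.inl ((List.mem_cons.1 h).resolve_left hxv)
        · right
          exact ⟨h.congr (fun w _ y => by rw [hvis]) (fun w _ => hlj w) (hb x _ (Or.inl hxv))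
              (hd x _ (Or.inl hxv)) (hl x _ (Or.inl hxv)) (hti x _ (Or.inl hxv))
              (hp x _ (Or.inl hxv)),
            h'.congr (fun w _ y => by rw [hvis]) (fun w _ => hlj w) (hl x _ (Or.inl hxv))⟩
    · rw [List.map_cons, List.sum_cons] at h7
      rw [h1] at g4
      omega
  · refine ⟨hadj, hb, hp, ht, H, fun v => Or.inl (by simp), ?_⟩
    rw [zero_add, ← List.ofFn_eq_map, List.sum_ofFn]

theorem init_levels {r : Fin n → ℕ} {N : ℕ} {M : ℝ} (hM : 0 ≤ M) (hN : ⌊M⌋₊ = N) (hN1 : 1 ≤ N)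
    (h : ℕ) {s₀ : Store n} (hadj : s₀.adj = adjOf G Finset.univ) (hb : ∀ p, s₀.bucket p = [])
    (hp : s₀.ptr = 0) (ht : s₀.top = 0)
    (H : Levels r N 0 Finset.univ (fun _ => adjOf G Finset.univ) (fun _ => []) (freshPot s₀) s₀) :
    let res := forEach (fun j s => forEach (fun v s => compute r M v j s) (List.finRange n) s)
      (List.range h) s₀
    res.val.adj = adjOf G Finset.univ ∧ (∀ p, res.val.bucket p = []) ∧ res.val.ptr = 0 ∧
      res.val.top = 0 ∧
      Levels r N h Finset.univ (fun _ => adjOf G Finset.univ) (fun _ => [])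
        (freshPot res.val) res.val ∧
      res.steps ≤ h * (1 + ∑ v, (20 * ((adjOf G Finset.univ v).length * (N + 1)) + 4)) := by
  intro res
  set T := ∑ v, (20 * ((adjOf G Finset.univ v).length * (N + 1)) + 4) with hT
  have key := forEach_rule
    (body := fun j s => forEach (fun v s => compute r M v j s) (List.finRange n) s)
    (fun L s t => ∃ j, j ≤ h ∧ L = List.range' j (h - j) ∧
      s.adj = adjOf G Finset.univ ∧ (∀ p, s.bucket p = []) ∧ s.ptr = 0 ∧ s.top = 0 ∧
      Levels r N j Finset.univ (fun _ => adjOf G Finset.univ) (fun _ => []) (freshPot s) s ∧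
      t ≤ j * (1 + T))
    ?_ (List.range h) s₀ 0 ?_
  · obtain ⟨j, hj, hR, h1, h2, h3, h4, h5, h6⟩ := key
    have hjh : j = h := by
      have := congrArg List.length hR
      simp at this
      omega
    subst hjh
    exact ⟨h1, h2, h3, h4, h5, (Nat.zero_add _).symm.le.trans h6⟩
  · rintro a L s t ⟨j, hj, hR, h1, h2, h3, h4, h5, h6⟩
    obtain ⟨k, hk⟩ : ∃ k, h - j = k + 1 := ⟨h - j - 1, by
      have := congrArg List.length hR
      simp at this
      omega⟩
    rw [hk, List.range'_succ] at hR
    obtain ⟨rfl, hR⟩ := List.cons.inj hR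
    obtain ⟨g1, g2, g3, g4, g5, g6⟩ := init_level G hM hN hN1 h1 h2 h3 h4 h5
    refine ⟨a + 1, by omega, ?_, g1, g2, g3, g4, g5, ?_⟩
    · rw [hR]
      congr 1
      omega
    · rw [Nat.succ_mul]
      omega
  · exact ⟨0, Nat.zero_le _, by rw [List.range_eq_range', Nat.sub_zero], hadj, hb, hp, ht, H,
      by omega⟩

/-- Allocation costs exactly the growth of `top`, so all allocations together cost at most `T`,
besides two steps per node. -/
theorem init_queue {M : ℝ} {h T : ℕ} {s₀ : Store n} (hb : ∀ p, s₀.bucket p = [])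
    (hp : s₀.ptr = 0) (ht : s₀.top = 0)
    (hT : ∀ v, bucketIndex M (size h s₀ v) (s₀.lvl v h) + 1 ≤ T) :
    let res := forEach (fun v s => requeue M h v s) (List.finRange n) s₀
    res.val.adj = s₀.adj ∧ res.val.buf = s₀.buf ∧ res.val.lvl = s₀.lvl ∧ res.val.dep = s₀.dep ∧
      res.val.ties = s₀.ties ∧ Queue Finset.univ res.val ∧ Fresh M h Finset.univ [] res.val ∧
      res.val.ptr = 0 ∧ res.steps ≤ 2 * n + T := by
  intro res
  have key := forEach_rule (body := fun v s => requeue M h v s)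
    (fun L s t => s.adj = s₀.adj ∧ s.buf = s₀.buf ∧ s.lvl = s₀.lvl ∧ s.dep = s₀.dep ∧
      s.ties = s₀.ties ∧ s.ptr = 0 ∧ s.top ≤ T ∧ t + 2 * L.length ≤ 2 * n + s.top ∧ L.Nodup ∧
      ∃ S : Finset (Fin n), (∀ v, v ∈ S ↔ v ∉ L) ∧ Queue S s ∧ Fresh M h S [] s)
    ?_ (List.finRange n) s₀ 0 ?_
  · obtain ⟨h1, h2, h3, h4, h5, h6, h7, h8, -, S, h9, h10, h11⟩ := key
    obtain rfl : S = Finset.univ := by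
      ext v
      simp [h9]
    refine ⟨h1, h2, h3, h4, h5, h10, h11, h6, ?_⟩
    rw [List.length_nil, zero_add] at h8
    exact h8.trans (Nat.add_le_add_left h7 _)
  · rintro v L s t ⟨h1, h2, h3, h4, h5, h6, h7, h8, hnd, S, h9, h10, h11⟩
    obtain ⟨hvL, hL⟩ := List.nodup_cons.1 hnd
    have hvS : v ∉ S := by simp [h9]
    have hsz : ∀ x, size h s x = size h s₀ x := fun x => by
      unfold size
      rw [h2]
    obtain ⟨bucket, e, g1, g2⟩ := requeue_spec h10 M h v
    have hTv := hT v
    rw [← hsz, ← h3] at hTv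
    set p := bucketIndex M (size h s v) (s.lvl v h) with hpdef
    rw [List.length_cons] at h8
    rw [g2]
    refine ⟨by rw [e]; exact h1, by rw [e]; exact h2, by rw [e]; exact h3, by rw [e]; exact h4,
      by rw [e]; exact h5, by rw [e]; simp [h6], by rw [e]; exact max_le h7 hTv, ?_, hL,
      insert v S, fun x => ?_, g1, ?_⟩
    · rw [e]
      dsimp only
      omega
    · rw [Finset.mem_insert, h9, List.mem_cons]
      by_cases hx : x = v
      · subst hx
        simp [hvL]
      · simp [hx]
    · have heq : ∀ x ∈ insert v S, (requeue M h v s).val.key x =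
          bucketIndex M (size h (requeue M h v s).val x) ((requeue M h v s).val.lvl x h) ∧
          (requeue M h v s).val.est x =
            estimate M (size h (requeue M h v s).val x) ((requeue M h v s).val.lvl x h) := by
        intro x hx
        rw [e]
        dsimp only
        by_cases hxv : x = v
        · subst hxv
          rw [Function.update_self, Function.update_self]
          exact ⟨rfl, rfl⟩
        · rw [Function.update_of_ne hxv, Function.update_of_ne hxv]
          exact h11.eq x ((Finset.mem_insert.1 hx).resolve_left hxv) (by simp)
      exact ⟨fun x hx => (heq x hx).1.ge, fun x hx _ => heq x hx⟩
  · refine ⟨rfl, rfl, rfl, rfl, rfl, hp, by omega, by simp, List.nodup_finRange n, ∅,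
      by simp, ⟨?_, ?_, ?_, ?_⟩, ⟨?_, ?_⟩⟩ <;> simp [hb]

end KHCore

namespace KHCore

variable {n : ℕ}

/-! ## The main loop -/

theorem seek_spec (bucket : ℕ → List (Fin n)) (f p : ℕ) (h : ∃ q, p ≤ q ∧ q < p + f ∧ bucket q ≠ []) :
    p ≤ (seek bucket f p).val ∧ bucket (seek bucket f p).val ≠ [] ∧
      (seek bucket f p).steps = (seek bucket f p).val - p + 1 ∧
      ∀ q, p ≤ q → q < (seek bucket f p).val → bucket q = [] := by
  induction f generalizing p with
  | zero =>
    obtain ⟨q, h1, h2, -⟩ := h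
    omega
  | succ f ih =>
    obtain ⟨q, h1, h2, h3⟩ := h
    by_cases hp : bucket p = []
    · have hpq : p ≠ q := by
        rintro rfl
        exact h3 hp
      obtain ⟨g1, g2, g3, g4⟩ := ih (p + 1) ⟨q, by omega, by omega, h3⟩
      have hv : (seek bucket (f + 1) p).val = (seek bucket f (p + 1)).val := by
        simp [seek, hp]
      have hs : (seek bucket (f + 1) p).steps = 1 + (seek bucket f (p + 1)).steps := by
        simp [seek, hp]
      rw [hv, hs]
      refine ⟨by omega, g2, by omega, fun q' hq' hlt => ?_⟩
      rcases hq'.lt_or_eq with h' | rfl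
      · exact g4 q' h' hlt
      · exact hp
    · have hv : (seek bucket (f + 1) p).val = p := by simp [seek, hp]
      have hs : (seek bucket (f + 1) p).steps = 1 := by simp [seek, hp]
      rw [hv, hs]
      exact ⟨le_rfl, hp, by omega, fun q' h1 h2 => by omega⟩

theorem compute_ptr (r : Fin n → ℕ) (M : ℝ) (v : Fin n) (j : ℕ) (s : Store n) :
    (compute r M v j s).val.ptr = s.ptr := by
  rw [compute_eq]
  simp only [bind_val]
  split_ifs <;> rfl

theorem forEach_notify_ptr (j : ℕ) (Y : List (Fin n)) (old : Option ℕ) (A : List (Fin n))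
    (sW : Store n × Stack n) : (forEach (notify j Y old) A sW).val.1.ptr = sW.1.ptr := by
  induction A generalizing sW with
  | nil => rfl
  | cons a A ih =>
    rw [forEach_cons_val, ih]
    rfl

theorem process_ptr_le (r : Fin n → ℕ) (M : ℝ) (h j : ℕ) (vY : Fin n × List (Fin n))
    (sW : Store n × Stack n) : (process r M h j vY sW).val.1.ptr ≤ sW.1.ptr := by
  obtain ⟨v, Y⟩ := vY
  obtain ⟨s, W⟩ := sW
  rw [process_eq]
  simp only [bind_val]
  set s₁ := (if ((s.buf v (j + 1)).length + (s.dep v (j + 1)).length : ℝ) ≤ M ∧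
    s.ties v (j + 1) = 0 then compute r M v j s else pure s).val with hs₁
  have h1 : s₁.ptr = s.ptr := by
    rw [hs₁]
    split_ifs
    · exact compute_ptr r M v j s
    · rfl
  set s₂ := (if j + 1 = h then requeue M h v s₁ else pure s₁).val with hs₂
  have h2 : s₂.ptr ≤ s₁.ptr := by
    rw [hs₂]
    split_ifs
    · exact min_le_left _ _
    · exact le_rfl
  split_ifs
  · rw [forEach_notify_ptr]
    exact h2.trans h1.le
  · rw [forEach_notify_ptr]
    exact h2.trans h1.le
  · exact h2.trans h1.le

/-- During a deletion the pointer can only retreat, so afterwards it is at most the key of the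
deleted node. This bounds its final value. -/
theorem update_ptr_le (r : Fin n → ℕ) (M : ℝ) (h : ℕ) (u : Fin n) (s : Store n) :
    (update r M h u s).val.ptr ≤ s.ptr := by
  unfold update
  simp only [bind_val, pure_val, forEach_pure_val]
  refine forEach_rule (fun _ (sU : Store n × Stack n) _ => sU.1.ptr ≤ s.ptr) ?_ _ _ 0 ?_
  · rintro j L ⟨s₁, U⟩ t h1
    simp only [bind_val]
    refine forEach_rule (fun _ (sU : Store n × Stack n) _ => sU.1.ptr ≤ s.ptr) ?_ _ _ 0 ?_
    · rintro vY L ⟨s₂, U₂⟩ t h2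
      exact (process_ptr_le r M h j vY _).trans h2
    · dsimp only
      rw [forEach_notify_ptr]
      exact h1
  · dsimp only
    have : ∀ (L : List (Fin n)) (s' : Store n), (L.foldl (fun s w =>
        { s with adj := Function.update s.adj w ((s.adj w).erase u) }) s').ptr = s'.ptr := by
      intro L
      induction L with
      | nil => exact fun _ => rfl
      | cons a L ih =>
        intro s'
        rw [List.foldl_cons, ih]
    exact (this _ _).le

/-- The value `c` separates the sets which contain `v`: each of them has an element where `d` is at
most `c`, and in one of them all elements have at least this value. -/
def Separates (d : Finset (Fin n) → Fin n → ℝ) (c : ℝ) (v : Fin n) : Prop :=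
  (∀ S, v ∈ S → ∃ u ∈ S, d S u ≤ c) ∧ ∃ S, v ∈ S ∧ ∀ u ∈ S, c ≤ d S u

/-- The invariant of the running maximum and of the output. -/
structure Peeled (d : Finset (Fin n) → Fin n → ℝ) (S : Finset (Fin n)) (c : ℝ) (out : Fin n → ℝ) :
    Prop where
  lower : ∀ S', ¬ S' ⊆ S → ∃ u ∈ S', d S' u ≤ c
  upper : ∃ S', S ⊆ S' ∧ ∀ u ∈ S', c ≤ d S' u
  out : ∀ v, v ∉ S → Separates d (out v) v

/-- A set not contained in `S.erase u` is either outside `S`, where the old bound applies, or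
contains `u` and lies in `S`, where monotonicity bounds its value at `u` by `d S u`. The upper
witness is `S` itself if the maximum is attained by the new value, and the old witness otherwise. -/
theorem Peeled.step {d : Finset (Fin n) → Fin n → ℝ}
    (hd : ∀ S S' v, S ⊆ S' → d S v ≤ d S' v) {S : Finset (Fin n)} {c : ℝ} {out : Fin n → ℝ}
    (H : Peeled d S c out) {u : Fin n} (hu : u ∈ S) (hmin : ∀ x ∈ S, d S u ≤ d S x) :
    Peeled d (S.erase u) (max c (d S u)) (Function.update out u (max c (d S u))) := by
  have hlow : ∀ S', ¬ S' ⊆ S.erase u → ∃ x ∈ S', d S' x ≤ max c (d S u) := by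
    intro S' hS'
    by_cases h : S' ⊆ S
    · have huS' : u ∈ S' := by
        by_contra hn
        exact hS' (Finset.subset_erase.2 ⟨h, hn⟩)
      exact ⟨u, huS', (hd _ _ u h).trans (le_max_right _ _)⟩
    · obtain ⟨x, h1, h2⟩ := H.lower S' h
      exact ⟨x, h1, h2.trans (le_max_left _ _)⟩
  have hup : ∃ S', S ⊆ S' ∧ ∀ x ∈ S', max c (d S u) ≤ d S' x := by
    rcases le_total c (d S u) with h | h
    · exact ⟨S, Finset.Subset.refl _, by rwa [max_eq_right h]⟩
    · rw [max_eq_left h]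
      exact H.upper
  refine ⟨hlow, ?_, fun v hv => ?_⟩
  · obtain ⟨S', h1, h2⟩ := hup
    exact ⟨S', (Finset.erase_subset u S).trans h1, h2⟩
  · by_cases hvu : v = u
    · subst hvu
      rw [Function.update_self]
      refine ⟨fun S' hS' => hlow S' fun h => Finset.notMem_erase v S (h hS'), ?_⟩
      obtain ⟨S', h1, h2⟩ := hup
      exact ⟨S', h1 hu, h2⟩
    · rw [Function.update_of_ne hvu]
      exact H.out v fun h => hv (Finset.mem_erase.2 ⟨hvu, h⟩)

variable (G : SimpleGraph (Fin n)) [DecidableRel G.Adj]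

/-- The estimate of `v` in the graph induced by `S`. -/
noncomputable def nodeEstimate (r : Fin n → ℕ) (M : ℝ) (h : ℕ) (S : Finset (Fin n)) (v : Fin n) :
    ℝ := sizeEstimate r M (ball G S h v) v

theorem mainStep_spec {r : Fin n → ℕ} {M : ℝ} (hM : 0 ≤ M) (hN1 : 1 ≤ ⌊M⌋₊) {h : ℕ}
    {dg : Fin n → ℕ} (hdg : ∀ T x, (adjOf G T x).length ≤ dg x) {t : MainState n}
    {S : Finset (Fin n)} (hS : S.Nonempty) {pot : Fin n → ℕ → ℕ}
    (hadj : t.store.adj = adjOf G S)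
    (H : Levels r ⌊M⌋₊ h S (fun _ => adjOf G S) (fun _ => []) pot t.store) (Q : Queue S t.store)
    (F : Fresh M h S [] t.store) (P : Peeled (nodeEstimate G r M h) S t.c t.out) :
    ∃ u ∈ S, ∃ pot', (mainStep r M h t).val.store.adj = adjOf G (S.erase u) ∧
      Levels r ⌊M⌋₊ h (S.erase u) (fun _ => adjOf G (S.erase u)) (fun _ => []) pot'
        (mainStep r M h t).val.store ∧
      Queue (S.erase u) (mainStep r M h t).val.store ∧
      Fresh M h (S.erase u) [] (mainStep r M h t).val.store ∧
      Peeled (nodeEstimate G r M h) (S.erase u) (mainStep r M h t).val.c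
        (mainStep r M h t).val.out ∧
      (mainStep r M h t).val.store.ptr ≤ t.store.key u ∧
      (mainStep r M h t).steps +
        potential ⌊M⌋₊ h dg (S.erase u) (fun _ => []) pot' (mainStep r M h t).val.store +
        t.store.ptr ≤
        potential ⌊M⌋₊ h dg S (fun _ => []) pot t.store + (mainStep r M h t).val.store.ptr +
        (2 + deleteCharge ⌊M⌋₊ h (dg u)) := by
  obtain ⟨x₀, hx₀⟩ := hS
  obtain ⟨f1, f2, f3, f4⟩ := seek_spec t.store.bucket (t.store.top - t.store.ptr) t.store.ptr
    ⟨t.store.key x₀, Q.ptr_le x₀ hx₀, by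
      have := Q.key_lt x₀ hx₀
      have := Q.ptr_le x₀ hx₀
      omega, List.ne_nil_of_mem ((Q.mem _ _).2 ⟨hx₀, rfl⟩)⟩
  set p := (seek t.store.bucket (t.store.top - t.store.ptr) t.store.ptr).val with hp
  obtain ⟨u, rest, hur⟩ := List.exists_cons_of_ne_nil f2
  have hu : u ∈ S ∧ t.store.key u = p := (Q.mem p u).1 (by rw [hur]; simp)
  have hle : ∀ x ∈ S, p ≤ t.store.key x := by
    intro x hx
    by_contra hlt
    have := f4 _ (Q.ptr_le x hx) (not_le.1 hlt)
    exact List.ne_nil_of_mem ((Q.mem _ _).2 ⟨hx, rfl⟩) this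
  have hsize : ∀ x ∈ S, size h t.store x ≤ ⌊M⌋₊ := fun x hx =>
    size_le.trans (H.buf_length_le hN1 le_rfl hx)
  -- With an empty stack all keys are exact, so the order of the buckets gives the order of the
  -- estimates.
  have hmin : ∀ x ∈ S, nodeEstimate G r M h S u ≤ nodeEstimate G r M h S x := by
    intro x hx
    unfold nodeEstimate
    rw [← F.est_eq hN1 H hu.1, ← F.est_eq hN1 H hx, (F.eq u hu.1 (by simp)).2,
      (F.eq x hx (by simp)).2]
    refine (estimate_le_of_bucketIndex_le hM (hsize u hu.1) (hsize x hx) ?_).2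
    rw [← (F.eq u hu.1 (by simp)).1, ← (F.eq x hx (by simp)).1, hu.2]
    exact hle x hx
  set s₁ : Store n :=
    { t.store with bucket := Function.update t.store.bucket p rest, ptr := p } with hs₁
  have hnd : (u :: rest).Nodup := hur ▸ Q.nodup p
  have hQ : Queue (S.erase u) s₁ := by
    refine ⟨fun q x => ?_, fun q => ?_, fun x hx => Q.key_lt x (Finset.mem_of_mem_erase hx),
      fun x hx => hle x (Finset.mem_of_mem_erase hx)⟩
    · have hq := Q.mem q x
      rw [Finset.mem_erase]
      by_cases hqp : q = p
      · subst hqp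
        rw [hs₁]
        dsimp only
        rw [Function.update_self]
        rw [hur, List.mem_cons] at hq
        by_cases hxu : x = u
        · subst hxu
          simp [(List.nodup_cons.1 hnd).1]
        · simpa [hxu] using hq
      · rw [hs₁]
        dsimp only
        rw [Function.update_of_ne hqp, hq]
        constructor
        · rintro ⟨g1, g2⟩
          refine ⟨⟨?_, g1⟩, g2⟩
          rintro rfl
          exact hqp (g2.symm.trans hu.2)
        · tauto
    · by_cases hqp : q = p
      · subst hqp
        rw [hs₁]
        dsimp only
        rw [Function.update_self]
        exact (List.nodup_cons.1 hnd).2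
      · rw [hs₁]
        dsimp only
        rw [Function.update_of_ne hqp]
        exact Q.nodup q
  have hF : Fresh M h (S.erase u) [] s₁ :=
    ⟨fun x hx => F.le x (Finset.mem_of_mem_erase hx),
      fun x hx => F.eq x (Finset.mem_of_mem_erase hx)⟩
  have hL : Levels r ⌊M⌋₊ h S (fun _ => adjOf G S) (fun _ => []) pot s₁ :=
    H.congr (fun _ _ => rfl) (fun _ _ _ => rfl) (fun _ _ _ => rfl) (fun _ _ _ => rfl)
      (fun _ _ _ => rfl) (fun _ _ _ => rfl)
  obtain ⟨pot', g1, g2, g3, g4, g5⟩ := update_spec G hM rfl hN1 hu.1 hdg (s := s₁) hadj hL hQ hF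
  have hval : (mainStep r M h t).val = ⟨(update r M h u s₁).val, max t.c (t.store.est u),
      Function.update t.out u (max t.c (t.store.est u))⟩ := by
    unfold mainStep
    simp only [bind_val]
    rw [← hp, hur]
    rfl
  have hsteps : (mainStep r M h t).steps = 1 + ((p - t.store.ptr + 1) +
      (update r M h u s₁).steps) := by
    unfold mainStep
    simp only [bind_steps, tick_steps]
    rw [f3, ← hp, hur]
    rfl
  have hpot : potential ⌊M⌋₊ h dg (S.erase u) (fun _ => []) pot s₁ ≤
      potential ⌊M⌋₊ h dg S (fun _ => []) pot t.store := by
    unfold potential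
    have hsub := Finset.erase_subset u S
    refine Nat.add_le_add (Nat.add_le_add ?_ le_rfl) ?_
    · exact Finset.sum_le_sum_of_subset hsub
    · exact Finset.sum_le_sum_of_subset hsub
  refine ⟨u, hu.1, pot', ?_, ?_, ?_, ?_, ?_, ?_, ?_⟩
  · rw [hval]; exact g4
  · rw [hval]; exact g1
  · rw [hval]; exact g2
  · rw [hval]; exact g3
  · rw [hval, F.est_eq hN1 H hu.1]
    exact P.step (fun S S' v hSS => sizeEstimate_mono hM (ball_mono G hSS h v) v) hu.1 hmin
  · rw [hval, hu.2]
    exact update_ptr_le r M h u s₁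
  · rw [hval, hsteps]
    have : s₁.ptr = p := rfl
    rw [this] at g5
    dsimp only
    omega

/-- Because the pointer counts negatively, its final value is added back; it never exceeds `T`, the
bound for all keys. The `3` consists of two steps in an iteration and one of the loop. -/
theorem mainLoop_spec {r : Fin n → ℕ} {M : ℝ} (hM : 0 ≤ M) (hN1 : 1 ≤ ⌊M⌋₊) {h : ℕ}
    {dg : Fin n → ℕ} (hdg : ∀ T x, (adjOf G T x).length ≤ dg x) {t₀ : MainState n}
    {pot : Fin n → ℕ → ℕ} (hadj : t₀.store.adj = adjOf G Finset.univ)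
    (H : Levels r ⌊M⌋₊ h Finset.univ (fun _ => adjOf G Finset.univ) (fun _ => []) pot t₀.store)
    (Q : Queue Finset.univ t₀.store) (F : Fresh M h Finset.univ [] t₀.store) (hc : t₀.c = 0)
    (hp : t₀.store.ptr = 0) {T : ℕ}
    (hT : ∀ S pot s, Levels r ⌊M⌋₊ h S (fun _ => adjOf G S) (fun _ => []) pot s →
      Fresh M h S [] s → ∀ v ∈ S, s.key v ≤ T) :
    (∀ v, Separates (nodeEstimate G r M h)
      ((forEach (fun _ t => mainStep r M h t) (List.finRange n) t₀).val.out v) v) ∧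
    (forEach (fun _ t => mainStep r M h t) (List.finRange n) t₀).steps ≤
      potential ⌊M⌋₊ h dg Finset.univ (fun _ => []) pot t₀.store + T +
        ∑ v, (3 + deleteCharge ⌊M⌋₊ h (dg v)) := by
  set P₀ := potential ⌊M⌋₊ h dg Finset.univ (fun _ => []) pot t₀.store with hP₀
  have key := forEach_rule (body := fun (_ : Fin n) t => mainStep r M h t)
    (fun L t c => ∃ S : Finset (Fin n), ∃ pot, S.card = L.length ∧ t.store.adj = adjOf G S ∧
      Levels r ⌊M⌋₊ h S (fun _ => adjOf G S) (fun _ => []) pot t.store ∧ Queue S t.store ∧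
      Fresh M h S [] t.store ∧ Peeled (nodeEstimate G r M h) S t.c t.out ∧ t.store.ptr ≤ T ∧
      c + potential ⌊M⌋₊ h dg S (fun _ => []) pot t.store +
        ∑ v ∈ S, (3 + deleteCharge ⌊M⌋₊ h (dg v)) ≤
        P₀ + t.store.ptr + ∑ v, (3 + deleteCharge ⌊M⌋₊ h (dg v)))
    ?_ (List.finRange n) t₀ 0 ?_
  · obtain ⟨S, pot', h1, h2, h3, h4, h5, h6, h7, h8⟩ := key
    obtain rfl := Finset.card_eq_zero.1 h1
    refine ⟨fun v => h6.out v (by simp), ?_⟩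
    omega
  · rintro _ L t c ⟨S, pot', h1, h2, h3, h4, h5, h6, h7, h8⟩
    have hne : S.Nonempty := Finset.card_pos.1 (by rw [h1]; simp)
    obtain ⟨u, hu, pot₂, g1, g2, g3, g4, g5, g6, g7⟩ :=
      mainStep_spec G hM hN1 hdg hne h2 h3 h4 h5 h6
    refine ⟨S.erase u, pot₂, ?_, g1, g2, g3, g4, g5, g6.trans (hT S pot' _ h3 h5 u hu), ?_⟩
    · rw [Finset.card_erase_of_mem hu, h1]
      simp
    · rw [← Finset.add_sum_erase S _ hu] at h8
      omega
  · refine ⟨Finset.univ, pot, by simp, hadj, H, Q, F, ⟨fun S' hS' => ?_, ?_, fun v hv => ?_⟩,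
      by omega, by omega⟩
    · exact absurd (Finset.subset_univ S') hS'
    · exact ⟨Finset.univ, Finset.Subset.refl _, fun u _ => hc ▸ estimate_nonneg _ _ _⟩
    · exact absurd (Finset.mem_univ v) hv

end KHCore

/-! ### Output and running time of the whole algorithm for fixed ranks -/

namespace KHCore

variable {n : ℕ}

variable (G : SimpleGraph (Fin n)) [DecidableRel G.Adj]

theorem length_adjOf_le (S : Finset (Fin n)) (v : Fin n) :
    (adjOf G S v).length ≤ (adjOf G Finset.univ v).length := by
  rw [← List.toFinset_card_of_nodup (adjOf_nodup G S v),
    ← List.toFinset_card_of_nodup (adjOf_nodup G Finset.univ v)]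
  refine Finset.card_le_card fun w hw => ?_
  rw [List.mem_toFinset, mem_adjOf] at hw ⊢
  exact ⟨Finset.mem_univ _, Finset.mem_univ _, hw.2.2⟩

theorem sum_length_adjOf : ∑ v, (adjOf G Finset.univ v).length = 2 * G.edgeFinset.card := by
  rw [← G.sum_degrees_eq_twice_card_edges]
  refine Finset.sum_congr rfl fun v _ => ?_
  rw [← List.toFinset_card_of_nodup (adjOf_nodup G Finset.univ v), ← G.card_neighborFinset_eq_degree]
  congr 1
  ext w
  rw [List.mem_toFinset, mem_adjOf, G.mem_neighborFinset]
  simp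

/-- The output and the running time in terms of a threshold at which at most `⌊M⌋` nodes are
sampled. -/
theorem run_spec {r : Fin n → ℕ} {M : ℝ} (hM : 0 ≤ M) (hN1 : 1 ≤ ⌊M⌋₊) {h k : ℕ} (hh : 1 ≤ h)
    (hn : 1 ≤ n) (hk : (Finset.univ.filter fun x => k ≤ r x).card ≤ ⌊M⌋₊) :
    (∀ v, Separates (nodeEstimate G r M h) ((run G h M r).val v) v) ∧
    (run G h M r).steps ≤ ∑ v, (r v + 1) +
      120 * (h * (n + 2 * G.edgeFinset.card) * ((⌊M⌋₊ + 1) * (k + 1))) := by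
  set N := ⌊M⌋₊ with hN
  set dg : Fin n → ℕ := fun v => (adjOf G Finset.univ v).length with hdg
  obtain ⟨a1, a2, a3, a4, a5, a6⟩ := init_base G r N
  set R₁ := forEach (fun v (s : Store n) => (do
      let _ ← touch (List.range (r v + 1))
      let _ ← touch (s.adj v)
      pure { s with buf := write s.buf v 0 [(v, 1)], lvl := write s.lvl v 0 0 } : Timed (Store n)))
      (List.finRange n) (initialStore G) with hR₁
  obtain ⟨b1, b2, b3, b4, b5, b6⟩ := init_levels G hM hN.symm hN1 h a1 a2 a3 a4 a5
  set R₂ := forEach (fun j s => forEach (fun v s => compute r M v j s) (List.finRange n) s)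
      (List.range h) R₁.val with hR₂
  have hkey : ∀ S pot s, Levels r N h S (fun _ => adjOf G S) (fun _ => []) pot s → ∀ v ∈ S,
      bucketIndex M (size h s v) (s.lvl v h) + 1 ≤ (N + 1) * (k + 1) := by
    intro S pot s H v hv
    have h1 := H.lvl_le hN1 hk le_rfl hv
    have h2 : size h s v ≤ N := size_le.trans (H.buf_length_le hN1 le_rfl hv)
    rw [bucketIndex_eq hN.symm]
    have h3 : s.lvl v h * (N + 1) ≤ k * (N + 1) := Nat.mul_le_mul_right _ h1
    have h4 : (N + 1) * (k + 1) = k * (N + 1) + N + 1 := by ring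
    omega
  set X := (N + 1) * (k + 1) with hX
  obtain ⟨c1, c2, c3, c4, c5, c6, c7, c8, c9⟩ := init_queue (M := M) (h := h) (T := X) b2 b3 b4
    (fun v => hkey _ _ _ b5 v (Finset.mem_univ _))
  set R₃ := forEach (fun v s => requeue M h v s) (List.finRange n) R₂.val with hR₃
  have hL : Levels r N h Finset.univ (fun _ => adjOf G Finset.univ) (fun _ => [])
      (freshPot R₂.val) R₃.val :=
    b5.congr (fun _ _ => rfl) (fun _ _ _ => by rw [c2]) (fun _ _ _ => by rw [c4])
      (fun _ _ _ => by rw [c3]) (fun _ _ _ => by rw [c5]) (fun _ _ _ => rfl)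
  obtain ⟨d1, d2⟩ := mainLoop_spec G hM hN1 (dg := dg) (length_adjOf_le G)
    (t₀ := { store := R₃.val, c := 0, out := fun _ => 0 }) (c1.trans b1) hL c6 c7 rfl c8 (T := X)
    (fun S pot s H F v hv => by
      rw [(F.eq v hv (by simp)).1]
      exact (Nat.le_succ _).trans (hkey S pot s H v hv))
  set R₄ := forEach (fun _ t => mainStep r M h t) (List.finRange n)
    { store := R₃.val, c := 0, out := fun _ => 0 } with hR₄
  have hval : (run G h M r).val = R₄.val.out := rfl
  have hsteps : (run G h M r).steps =
      1 + (R₁.steps + (R₂.steps + (R₃.steps + (R₄.steps + 0)))) := rfl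
  refine ⟨by rw [hval]; exact d1, ?_⟩
  rw [hsteps, a6]
  set D := 2 * G.edgeFinset.card with hD
  have hsum : ∑ v, dg v = D := sum_length_adjOf G
  have e1 : ∑ v, (r v + 2 + (adjOf G Finset.univ v).length) = ∑ v, (r v + 1) + n + D := by
    rw [← hsum, Finset.sum_add_distrib, Finset.sum_add_distrib, Finset.sum_add_distrib]
    simp [hdg]
    omega
  have e2 : ∑ v, (20 * ((adjOf G Finset.univ v).length * (N + 1)) + 4) =
      20 * (D * (N + 1)) + 4 * n := by
    rw [← hsum, Finset.sum_add_distrib, ← Finset.mul_sum, ← Finset.sum_mul]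
    simp [hdg]
    omega
  have e3 : ∑ v, (3 + deleteCharge N h (dg v)) =
      4 * n + D + h * (n * (1 + N)) + h * (D * (N + 8)) := by
    unfold deleteCharge
    have : ∀ v, 3 + (1 + dg v + h * (1 + N + dg v * (N + 8))) =
        (4 + h * (1 + N)) + dg v * (1 + h * (N + 8)) := fun v => by ring
    rw [Finset.sum_congr rfl fun v _ => this v, Finset.sum_add_distrib, ← Finset.sum_mul, hsum]
    simp only [Finset.sum_const, Finset.card_univ, Fintype.card_fin, smul_eq_mul]
    ring
  -- A fresh potential is at most `2 * (k + 1)` and a buffer has at most `N` nodes, which gives `37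
  -- * 2 + 9 = 83` multiples of `X` per node, level and unit of degree.
  have e4 : potential N h dg Finset.univ (fun _ => []) (freshPot R₂.val) R₃.val ≤
      h * (D * (83 * X)) + n * X := by
    unfold potential
    have p1 : ∑ v, ∑ i ∈ Finset.Icc 1 h, dg v * (37 * (N + 1) * freshPot R₂.val v i +
        9 * (vis [] R₃.val i v).length) ≤ ∑ v, ∑ i ∈ Finset.Icc 1 h, dg v * (83 * X) := by
      refine Finset.sum_le_sum fun v hv => Finset.sum_le_sum fun i hi => Nat.mul_le_mul_left _ ?_
      have hih := (Finset.mem_Icc.1 hi).2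
      have q1 : freshPot R₂.val v i ≤ 2 * (k + 1) := by
        have := b5.lvl_le hN1 hk hih hv
        unfold freshPot
        omega
      have q2 : (vis [] R₃.val i v).length ≤ N + 1 := by
        rw [vis_nil, keys_length]
        exact (hL.buf_length_le hN1 hih hv).trans (Nat.le_succ _)
      have q3 : N + 1 ≤ X := Nat.le_mul_of_pos_right _ (Nat.succ_pos k)
      have q4 : 37 * (N + 1) * freshPot R₂.val v i ≤ 37 * (N + 1) * (2 * (k + 1)) :=
        Nat.mul_le_mul_left _ q1
      have q5 : 37 * (N + 1) * (2 * (k + 1)) = 74 * X := by rw [hX]; ring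
      omega
    have p2 : ∑ v, R₃.val.key v ≤ n * X := by
      have : ∀ v ∈ Finset.univ, R₃.val.key v ≤ X := fun v hv => by
        rw [(c7.eq v hv (by simp)).1]
        exact (Nat.le_succ _).trans (hkey _ _ _ hL v hv)
      simpa using Finset.sum_le_card_nsmul _ _ _ this
    have p3 : ∑ v, ∑ i ∈ Finset.Icc 1 h, dg v * (83 * X) = h * (D * (83 * X)) := by
      rw [← hsum, Finset.sum_mul, Finset.mul_sum]
      simp
    simp only [List.length_nil, Finset.sum_const_zero, mul_zero, add_zero]
    omega
  rw [e2] at b6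
  replace d2 : R₄.steps ≤ potential N h dg Finset.univ (fun _ => []) (freshPot R₂.val) R₃.val + X +
      (4 * n + D + h * (n * (1 + N)) + h * (D * (N + 8))) := by
    rw [← e3]
    exact d2
  rw [e1]
  have hX1 : N + 1 ≤ X := Nat.le_mul_of_pos_right _ (Nat.succ_pos k)
  have hX2 : 1 ≤ X := by omega
  have hhX : 1 ≤ h * X := Nat.mul_pos hh hX2
  have s1 : h * X ≤ h * (n * X) := Nat.mul_le_mul_left _ (Nat.le_mul_of_pos_left _ hn)
  have s2 : X ≤ h * X := Nat.le_mul_of_pos_left _ hh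
  have s3 : n * X ≤ h * (n * X) := Nat.le_mul_of_pos_left _ hh
  have s4 : n ≤ n * X := Nat.le_mul_of_pos_right _ hX2
  have s5 : D * X ≤ h * (D * X) := Nat.le_mul_of_pos_left _ hh
  have s6 : D ≤ D * X := Nat.le_mul_of_pos_right _ hX2
  have s7 : h * (n * (1 + N)) ≤ h * (n * X) :=
    Nat.mul_le_mul_left _ (Nat.mul_le_mul_left _ (by omega))
  have s8 : h * (D * (N + 8)) ≤ h * (D * (8 * X)) :=
    Nat.mul_le_mul_left _ (Nat.mul_le_mul_left _ (by omega))
  have s9 : h * (1 + (20 * (D * (N + 1)) + 4 * n)) ≤ h * (1 + (20 * (D * X) + 4 * (n * X))) :=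
    Nat.mul_le_mul_left _ (by
      have := Nat.mul_le_mul_left D hX1
      omega)
  have t1 : h * (1 + (20 * (D * X) + 4 * (n * X))) = h + 20 * (h * (D * X)) + 4 * (h * (n * X)) := by
    ring
  have t2 : h * (D * (8 * X)) = 8 * (h * (D * X)) := by ring
  have t3 : h * (D * (83 * X)) = 83 * (h * (D * X)) := by ring
  have t4 : h * (n + D) * X = h * (n * X) + h * (D * X) := by ring
  have t5 : h ≤ h * X := Nat.le_mul_of_pos_right _ hX2
  rw [t4]
  omega

end KHCore

namespace KHCore

variable {n : ℕ}

/-! ## Core numbers -/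

variable (G : SimpleGraph (Fin n)) [DecidableRel G.Adj]

theorem mem_ball_of_walk {H : G.Subgraph} {S : Finset (Fin n)} (hS : ∀ x ∈ H.verts, x ∈ S)
    {u w : H.verts} (p : H.coe.Walk u w) {i : ℕ} (hp : p.length ≤ i) : w.1 ∈ ball G S i u.1 := by
  induction p generalizing i with
  | nil => exact self_mem_ball G S i _
  | @cons a b c hab p ih =>
    obtain ⟨q, rfl⟩ : ∃ q, i = q + 1 := ⟨i - 1, by rw [SimpleGraph.Walk.length_cons] at hp; omega⟩
    rw [SimpleGraph.Walk.length_cons] at hp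
    rw [mem_ball_succ]
    exact Or.inr ⟨b.1, (mem_adjOf G).2 ⟨hS _ a.2, hS _ b.2, H.adj_sub hab⟩, ih (by omega)⟩

theorem exists_walk_of_mem_ball {S : Finset (Fin n)} {i : ℕ} {u x : Fin n} (hu : u ∈ S)
    (hx : x ∈ ball G S i u) : ∃ hxS : x ∈ S,
      ∃ p : ((⊤ : G.Subgraph).induce (S : Set (Fin n))).coe.Walk ⟨u, hu⟩ ⟨x, hxS⟩,
        p.length ≤ i := by
  induction i generalizing u with
  | zero =>
    obtain rfl : x = u := by simpa [ball] using hx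
    exact ⟨hu, SimpleGraph.Walk.nil, le_rfl⟩
  | succ i ih =>
    rcases (mem_ball_succ G).1 hx with rfl | ⟨w, hw, hxw⟩
    · exact ⟨hu, SimpleGraph.Walk.nil, Nat.zero_le _⟩
    · obtain ⟨-, hwS, hadj⟩ := (mem_adjOf G).1 hw
      obtain ⟨hxS, p, hp⟩ := ih hwS hxw
      have h : ((⊤ : G.Subgraph).induce (S : Set (Fin n))).coe.Adj ⟨u, hu⟩ ⟨w, hwS⟩ :=
        ⟨hu, hwS, hadj⟩
      refine ⟨hxS, SimpleGraph.Walk.cons h p, ?_⟩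
      rw [SimpleGraph.Walk.length_cons]
      omega

/-- All nodes of `S` have at least `k` other nodes in their `h`-neighbourhood inside `S`. -/
def Dense (h k : ℕ) (S : Finset (Fin n)) : Prop := ∀ u ∈ S, k + 1 ≤ (ball G S h u).card

theorem nbhd_ncard_le {H : G.Subgraph} {S : Finset (Fin n)} (hS : ∀ x ∈ H.verts, x ∈ S)
    (u : H.verts) (h : ℕ) : (nbhd H.coe u h).ncard ≤ (ball G S h u.1).card := by
  rw [← Set.ncard_image_of_injective _ Subtype.val_injective, ← Set.ncard_coe_finset]
  refine Set.ncard_le_ncard ?_ (Finset.finite_toSet _)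
  rintro _ ⟨w, ⟨p, hp⟩, rfl⟩
  exact mem_ball_of_walk G hS p hp

theorem card_ball_le_ncard {S : Finset (Fin n)} {u : Fin n} (hu : u ∈ S) (h : ℕ) :
    (ball G S h u).card ≤
      (nbhd ((⊤ : G.Subgraph).induce (S : Set (Fin n))).coe ⟨u, hu⟩ h).ncard := by
  rw [← Set.ncard_image_of_injective _ Subtype.val_injective, ← Set.ncard_coe_finset]
  refine Set.ncard_le_ncard (fun x hx => ?_) (Set.toFinite _)
  obtain ⟨hxS, p, hp⟩ := exists_walk_of_mem_ball G hu (Finset.mem_coe.1 hx)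
  exact ⟨⟨x, hxS⟩, ⟨p, hp⟩, rfl⟩

open Classical in
/-- The nodes of the `(k, h)`-core. -/
noncomputable def coreSet (h k : ℕ) : Finset (Fin n) :=
  Finset.univ.filter fun v => ∃ S, Dense G h k S ∧ v ∈ S

theorem mem_coreSet {h k : ℕ} {v : Fin n} : v ∈ coreSet G h k ↔ ∃ S, Dense G h k S ∧ v ∈ S := by
  classical
  simp [coreSet]

theorem subset_coreSet {h k : ℕ} {S : Finset (Fin n)} (hS : Dense G h k S) : S ⊆ coreSet G h k :=
  fun _ hv => (mem_coreSet G).2 ⟨S, hS, hv⟩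

/-- Balls grow with the set, so a union of dense sets is dense. -/
theorem dense_coreSet (h k : ℕ) : Dense G h k (coreSet G h k) := by
  intro u hu
  obtain ⟨S, hS, huS⟩ := (mem_coreSet G).1 hu
  exact (hS u huS).trans (Finset.card_le_card (ball_mono G (subset_coreSet G hS) h u))

theorem coreSet_anti {h k k' : ℕ} (hk : k ≤ k') : coreSet G h k' ⊆ coreSet G h k :=
  subset_coreSet G fun u hu => (Nat.add_le_add_right hk 1).trans (dense_coreSet G h k' u hu)

/-- Neighbourhoods in an arbitrary subgraph are contained in the balls of the graph induced by its
nodes. Hence every competitor has a dense node set, and the induced graph on the largest dense set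
contains it. -/
theorem isCore_coreSet (h k : ℕ) :
    IsCore G h k ((⊤ : G.Subgraph).induce (coreSet G h k : Set (Fin n))) := by
  classical
  constructor
  · rintro ⟨u, hu⟩
    exact (dense_coreSet G h k u hu).trans (card_ball_le_ncard G hu h)
  · intro H hH
    have hsub : ∀ x ∈ H.verts, x ∈ coreSet G h k := by
      have : Dense G h k H.verts.toFinset := fun u hu =>
        (hH ⟨u, Set.mem_toFinset.1 hu⟩).trans
          (nbhd_ncard_le G (fun x hx => Set.mem_toFinset.2 hx) _ h)
      exact fun x hx => subset_coreSet G this (Set.mem_toFinset.2 hx)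
    exact ⟨hsub, fun a b hab => ⟨hsub a (H.edge_vert hab), hsub b (H.edge_vert hab.symm),
      H.adj_sub hab⟩⟩

theorem coreNumber_eq (h : ℕ) (v : Fin n) : coreNumber G h v = sSup {k | v ∈ coreSet G h k} := by
  unfold coreNumber
  congr 1
  ext k
  constructor
  · rintro ⟨H, hH, hv⟩
    rw [hH.unique (isCore_coreSet G h k)] at hv
    exact hv
  · exact fun hv => ⟨_, isCore_coreSet G h k, hv⟩

theorem bddAbove_coreSet (h : ℕ) (v : Fin n) : BddAbove {k | v ∈ coreSet G h k} := by
  refine ⟨n, fun k hk => ?_⟩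
  have h1 := dense_coreSet G h k v hk
  have h2 := Finset.card_le_univ (ball G (coreSet G h k) h v)
  rw [Fintype.card_fin] at h2
  omega

theorem mem_coreSet_coreNumber (h : ℕ) (v : Fin n) : v ∈ coreSet G h (coreNumber G h v) := by
  rw [coreNumber_eq]
  refine Nat.sSup_mem (s := {k | v ∈ coreSet G h k}) ⟨0, ?_⟩ (bddAbove_coreSet G h v)
  -- A single node is dense of order `0`, so the set whose supremum is taken is not empty.
  exact subset_coreSet G (S := {v}) (fun u _ => Finset.card_pos.2 ⟨u, self_mem_ball G _ h u⟩)
    (Finset.mem_singleton_self v)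

theorem le_coreNumber {h k : ℕ} {v : Fin n} (hv : v ∈ coreSet G h k) : k ≤ coreNumber G h v := by
  rw [coreNumber_eq]
  exact le_csSup (bddAbove_coreSet G h v) hv

/-- Peeling: the sets that remain when nodes with smallest neighbourhoods are removed. -/
theorem exists_peeling (h : ℕ) (S : Finset (Fin n)) : ∃ T : Fin n → Finset (Fin n),
    (∀ x ∈ S, ∀ v ∈ T x, (ball G (T x) h x).card ≤ coreNumber G h v + 1) ∧
      ∀ S' ⊆ S, S'.Nonempty → ∃ x ∈ S', S' ⊆ T x := by
  induction S using Finset.strongInduction with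
  | _ S ih =>
    rcases S.eq_empty_or_nonempty with rfl | hne
    · refine ⟨fun _ => ∅, by simp, fun S' hS' h' => ?_⟩
      rw [Finset.subset_empty.1 hS'] at h'
      exact absurd h' Finset.not_nonempty_empty
    · obtain ⟨x₀, hx₀, hmin⟩ := Finset.exists_min_image S (fun x => (ball G S h x).card) hne
      obtain ⟨T, h1, h2⟩ := ih (S.erase x₀) (Finset.erase_ssubset hx₀)
      refine ⟨Function.update T x₀ S, fun x hx v hv => ?_, fun S' hS' hne' => ?_⟩
      · by_cases hxx : x = x₀
        · subst hxx
          rw [Function.update_self] at hv ⊢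
          have hpos : 0 < (ball G S h x).card := Finset.card_pos.2 ⟨x, self_mem_ball G S h x⟩
          have hd : Dense G h ((ball G S h x).card - 1) S := fun u hu => by
            have := hmin u hu
            omega
          have := le_coreNumber G (subset_coreSet G hd hv)
          omega
        · rw [Function.update_of_ne hxx] at hv ⊢
          exact h1 x (Finset.mem_erase.2 ⟨hxx, hx⟩) v hv
      · by_cases hx : x₀ ∈ S'
        · exact ⟨x₀, hx, by rwa [Function.update_self]⟩
        · obtain ⟨x, hxS', hsub⟩ := h2 S' (Finset.subset_erase.2 ⟨hS', hx⟩) hne'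
          refine ⟨x, hxS', ?_⟩
          rwa [Function.update_of_ne]
          rintro rfl
          exact hx hxS'

/-- It suffices that the estimates are accurate for two sets per node. -/
theorem exists_approx_of_accurate (h : ℕ) : ∃ K T : Fin n → Finset (Fin n),
    ∀ (d : Finset (Fin n) → Fin n → ℝ) (ε : ℝ), 0 ≤ ε → ε ≤ 1 →
      (∀ S S' v, S ⊆ S' → d S v ≤ d S' v) →
      (∀ u, (1 - ε) * (((ball G (K u) h u).erase u).card : ℝ) ≤ d (K u) u) →
      (∀ u, d (T u) u ≤ (1 + ε) * (((ball G (T u) h u).erase u).card : ℝ)) →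
      ∀ c' : Fin n → ℝ, (∀ v, Separates d (c' v) v) → IsApproxCoreMap G h ε c' := by
  obtain ⟨T, hT1, hT2⟩ := exists_peeling G h Finset.univ
  -- Both families are chosen before `d`. With random ranks they are therefore fixed sets, whatever
  -- order the algorithm follows.
  refine ⟨fun u => coreSet G h (coreNumber G h u), T, fun d ε hε hε1 hd hK hT c' hc v => ?_⟩
  dsimp only at hK
  have hcard : ∀ S u, (((ball G S h u).erase u).card : ℝ) + 1 = (ball G S h u).card := by
    intro S u
    exact_mod_cast Finset.card_erase_add_one (self_mem_ball G S h u)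
  obtain ⟨hlow, S, hvS, hup⟩ := hc v
  rw [abs_le]
  constructor
  -- Apply the separation to the core of order `c(v)`. The node `u` found there has `c(u) ≥ c(v)`,
  -- so its own core `K u` is a subset, and accuracy on `K u` together with monotonicity bounds the
  -- output from below.
  · obtain ⟨u, hu, hle⟩ := hlow _ (mem_coreSet_coreNumber G h v)
    have h1 : coreNumber G h v ≤ coreNumber G h u := le_coreNumber G hu
    have h2 := dense_coreSet G h _ u (mem_coreSet_coreNumber G h u)
    have h3 : (coreNumber G h v : ℝ) ≤
        ((ball G (coreSet G h (coreNumber G h u)) h u).erase u).card := by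
      have h4 := hcard (coreSet G h (coreNumber G h u)) u
      have h5 : (coreNumber G h v : ℝ) + 1 ≤ (ball G (coreSet G h (coreNumber G h u)) h u).card := by
        exact_mod_cast (Nat.add_le_add_right h1 1).trans h2
      linarith
    have h6 := mul_le_mul_of_nonneg_left h3 (by linarith : (0 : ℝ) ≤ 1 - ε)
    have h7 := hK u
    have h8 := hd _ _ u (coreSet_anti G (h := h) h1)
    linarith
  -- In the witness set `S`, look at the member `x` which exact peeling removes first: `S ⊆ T x`,
  -- and in `T x` the ball of `x` has at most `c(v)` other nodes.
  · obtain ⟨x, hx, hsub⟩ := hT2 S (Finset.subset_univ S) ⟨v, hvS⟩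
    have h1 := hup x hx
    have h2 := hd _ _ x hsub
    have h3 := hT x
    have h4 : (((ball G (T x) h x).erase x).card : ℝ) ≤ coreNumber G h v := by
      have h5 := hcard (T x) x
      have h6 : ((ball G (T x) h x).card : ℝ) ≤ coreNumber G h v + 1 := by
        exact_mod_cast hT1 x (Finset.mem_univ x) v (hsub hvS)
      linarith
    have h7 := mul_le_mul_of_nonneg_left h4 (by linarith : (0 : ℝ) ≤ 1 + ε)
    linarith

end KHCore

namespace KHCore

variable {n : ℕ}

/-! ## Tail bounds for the samples -/

open MeasureTheory ProbabilityTheory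

instance (n : ℕ) : IsProbabilityMeasure (rankLaw n) := by
  unfold rankLaw
  infer_instance

/-- The number of nodes of `Q` with rank at least `k`. -/
def sampled (Q : Finset (Fin n)) (k : ℕ) (r : Fin n → ℕ) : ℕ := (Q.filter fun u => k ≤ r u).card

/-- The probability `1/2`. -/
noncomputable def half : unitInterval := ⟨1 / 2, by norm_num, by norm_num⟩

theorem half_val : (half : ℝ) = 1 / 2 := rfl

theorem rankLaw_eq (n : ℕ) : rankLaw n = Measure.pi fun _ => geometricMeasure half := rfl

theorem half_ne_zero : half ≠ 0 := by
  intro h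
  have := congrArg Subtype.val h
  rw [half_val] at this
  norm_num at this

/-- The event has probability `2⁻ᵏ`. With `a = exp t` this is the moment generating function of its
indicator, with `a = 0` it yields `rank_tail`. -/
theorem integral_rank (k : ℕ) (a : ℝ) :
    ∫ x, (if k ≤ x then a else 1) ∂geometricMeasure half =
      1 + (a - 1) / 2 ^ k := by
  rw [integral_geometricMeasure half_ne_zero]
  have h1 := hasSum_one_geometricMeasure half_ne_zero
  rw [half_val] at h1 ⊢
  have h2 : HasSum (fun i : ℕ => (1 - (1 / 2 : ℝ)) ^ i * (1 / 2) * (if k ≤ i then a - 1 else 0))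
      ((a - 1) / 2 ^ k) := by
    have h3 : HasSum (fun i : ℕ => (1 - (1 / 2 : ℝ)) ^ (i + k) * (1 / 2) *
        (if k ≤ i + k then a - 1 else 0)) ((a - 1) / 2 ^ k) := by
      have h4 := h1.mul_right ((a - 1) / 2 ^ k)
      rw [one_mul] at h4
      refine (congrArg (fun f => HasSum f ((a - 1) / 2 ^ k)) (funext fun i => ?_)).mp h4
      rw [if_pos (Nat.le_add_left k i), pow_add, show (1 - (1 / 2 : ℝ)) = 1 / 2 by norm_num,
        one_div_pow (2 : ℝ) k]
      ring
    have := (hasSum_nat_add_iff (f := fun i : ℕ => (1 - (1 / 2 : ℝ)) ^ i * (1 / 2) *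
      (if k ≤ i then a - 1 else 0)) k).1 h3
    rwa [Finset.sum_eq_zero, add_zero] at this
    intro i hi
    rw [if_neg (not_le.2 (Finset.mem_range.1 hi)), mul_zero]
  refine (tsum_congr fun i => ?_).trans (h1.add h2).tsum_eq
  rw [smul_eq_mul]
  split_ifs <;> ring

theorem integrable_sampled (Q : Finset (Fin n)) (k : ℕ) (t : ℝ) :
    Integrable (fun r => Real.exp (t * (sampled Q k r : ℝ))) (rankLaw n) := by
  refine Integrable.of_bound (measurable_of_countable _).aestronglyMeasurable
    (Real.exp (|t| * n)) (ae_of_all _ fun r => ?_)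
  rw [Real.norm_eq_abs, Real.abs_exp, Real.exp_le_exp]
  have h1 : (sampled Q k r : ℝ) ≤ n := by
    have := Finset.card_le_univ (Q.filter fun u => k ≤ r u)
    rw [Fintype.card_fin] at this
    exact_mod_cast this
  calc t * (sampled Q k r : ℝ) ≤ |t| * (sampled Q k r : ℝ) := by
        gcongr
        exact le_abs_self t
    _ ≤ |t| * n := by gcongr

/-- Independence makes the integral a product, and `1 + y ≤ exp y` in each factor gives the moment
generating function of a Poisson variable of the same mean. -/
theorem mgf_sampled_le (Q : Finset (Fin n)) (k : ℕ) (t : ℝ) :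
    mgf (fun r => (sampled Q k r : ℝ)) (rankLaw n) t ≤
      Real.exp ((Real.exp t - 1) * (Q.card / 2 ^ k)) := by
  have h1 : ∀ r : Fin n → ℕ, Real.exp (t * (sampled Q k r : ℝ)) =
      ∏ u, if k ≤ r u then (if u ∈ Q then Real.exp t else 1) else 1 := by
    intro r
    rw [mul_comm, Real.exp_nat_mul, sampled, ← Finset.prod_const, Finset.prod_filter]
    rw [← Finset.prod_subset (Finset.subset_univ Q)]
    · exact Finset.prod_congr rfl fun u hu => by rw [if_pos hu]
    · intro u _ hu
      rw [if_neg hu, ite_self]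
  have h0 : mgf (fun r => (sampled Q k r : ℝ)) (rankLaw n) t =
      ∏ u, ∫ x, (if k ≤ x then (if u ∈ Q then Real.exp t else 1) else 1)
        ∂geometricMeasure half :=
    (integral_congr_ae (ae_of_all _ h1)).trans (integral_fintype_prod_eq_prod
      (μ := fun _ : Fin n => geometricMeasure half)
      fun u x => if k ≤ x then (if u ∈ Q then Real.exp t else 1) else 1)
  rw [h0]
  simp_rw [integral_rank]
  have h2 : Real.exp ((Real.exp t - 1) * (Q.card / 2 ^ k)) =
      ∏ u, Real.exp (((if u ∈ Q then Real.exp t else 1) - 1) / 2 ^ k) := by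
    rw [← Real.exp_sum, ← Finset.sum_div]
    congr 1
    have : ∀ u : Fin n, (if u ∈ Q then Real.exp t else 1) - 1 =
        if u ∈ Q then Real.exp t - 1 else 0 := fun u => by split_ifs <;> ring
    simp_rw [this]
    rw [← Finset.sum_filter]
    simp
    ring
  rw [h2]
  refine Finset.prod_le_prod (fun u _ => ?_) fun u _ => ?_
  · rw [← integral_rank]
    refine integral_nonneg fun x => ?_
    dsimp only
    split_ifs <;> simp [Real.exp_nonneg]
  · have := Real.add_one_le_exp (((if u ∈ Q then Real.exp t else 1) - 1) / 2 ^ k)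
    linarith

/-- Chernoff's bound at `t = log (1 + x)`, simplified by `log (1 + x) ≥ 2x / (2 + x)`. -/
theorem upper_tail (Q : Finset (Fin n)) (k : ℕ) {x : ℝ} (hx : 0 ≤ x) :
    (rankLaw n).real {r | (1 + x) * (Q.card / 2 ^ k : ℝ) ≤ sampled Q k r} ≤
      Real.exp (-((Q.card / 2 ^ k : ℝ) * (x ^ 2 / (2 + x)))) := by
  set μ : ℝ := Q.card / 2 ^ k with hμ
  have hμ0 : 0 ≤ μ := by positivity
  have hlog := Real.le_log_one_add_of_nonneg hx
  have hlog0 : 0 ≤ Real.log (1 + x) := Real.log_nonneg (by linarith)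
  refine (measure_ge_le_exp_mul_mgf ((1 + x) * μ) hlog0 (integrable_sampled Q k _)).trans ?_
  refine (mul_le_mul_of_nonneg_left (mgf_sampled_le Q k _) (Real.exp_nonneg _)).trans ?_
  rw [← Real.exp_add, Real.exp_le_exp, Real.exp_log (by linarith), ← hμ]
  have h1 : 2 * x / (x + 2) * ((1 + x) * μ) ≤ Real.log (1 + x) * ((1 + x) * μ) := by gcongr
  have h2 : 2 * x / (x + 2) * ((1 + x) * μ) = x * μ + μ * (x ^ 2 / (2 + x)) := by
    field_simp
    ring
  nlinarith

/-- The product of `1 + x + x² / 2` and `1 - x + x² / 2` is `1 + x⁴ / 4 ≥ 1`. -/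
theorem exp_neg_le {x : ℝ} (hx : 0 ≤ x) : Real.exp (-x) ≤ 1 - x + x ^ 2 / 2 := by
  have h1 := Real.quadratic_le_exp_of_nonneg hx
  have h2 : 0 < 1 + x + x ^ 2 / 2 := by positivity
  rw [Real.exp_neg]
  refine (inv_anti₀ h2 h1).trans ?_
  rw [inv_le_iff_one_le_mul₀ h2]
  nlinarith [sq_nonneg (x ^ 2)]

/-- Chernoff's bound at `t = -x`; this is not the optimal exponent, but `exp_neg_le` makes it give
the usual quadratic one. -/
theorem lower_tail (Q : Finset (Fin n)) (k : ℕ) {x : ℝ} (hx : 0 ≤ x) :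
    (rankLaw n).real {r | (sampled Q k r : ℝ) ≤ (1 - x) * (Q.card / 2 ^ k : ℝ)} ≤
      Real.exp (-((Q.card / 2 ^ k : ℝ) * (x ^ 2 / 2))) := by
  set μ : ℝ := Q.card / 2 ^ k with hμ
  have hμ0 : 0 ≤ μ := by positivity
  refine (measure_le_le_exp_mul_mgf ((1 - x) * μ) (neg_nonpos.2 hx)
    (integrable_sampled Q k _)).trans ?_
  refine (mul_le_mul_of_nonneg_left (mgf_sampled_le Q k _) (Real.exp_nonneg _)).trans ?_
  rw [← Real.exp_add, Real.exp_le_exp, ← hμ]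
  have h1 := mul_le_mul_of_nonneg_right (exp_neg_le hx) hμ0
  nlinarith

theorem rank_tail (u : Fin n) (k : ℕ) :
    (rankLaw n).real {r | k ≤ r u} = (1 / 2) ^ k := by
  have h1 := (measurePreserving_eval (fun _ : Fin n => geometricMeasure half) u).measureReal_preimage
    (s := {x | k ≤ x}) (MeasurableSet.of_discrete).nullMeasurableSet
  rw [← rankLaw_eq] at h1
  refine h1.trans ?_
  have h2 := integral_rank k 0
  have h3 : (fun x => if k ≤ x then (0 : ℝ) else 1) = Set.indicator {x | k ≤ x}ᶜ 1 := by
    funext x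
    by_cases hx : k ≤ x <;> simp [hx]
  rw [h3, integral_indicator_one MeasurableSet.of_discrete,
    probReal_compl_eq_one_sub MeasurableSet.of_discrete] at h2
  rw [one_div_pow]
  linarith [h2, neg_div ((2 : ℝ) ^ k) 1, show (0 - 1 : ℝ) / 2 ^ k = -(1 / 2 ^ k) by ring]

end KHCore

namespace KHCore

variable {n : ℕ}

open MeasureTheory ProbabilityTheory

/-! ## Accuracy of the estimates -/

/-- The samples of `Q` are good approximations for all thresholds that matter. -/
def Accurate (ε M : ℝ) (Q : Finset (Fin n)) (r : Fin n → ℕ) : Prop :=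
  ∀ k, M / 4 ≤ (Q.card / 2 ^ k : ℝ) →
    (1 - ε) * (Q.card / 2 ^ k : ℝ) ≤ sampled Q k r ∧
    (sampled Q k r : ℝ) ≤ (1 + ε) * (Q.card / 2 ^ k : ℝ) ∧
    (M / 2 ≤ (Q.card / 2 ^ k : ℝ) →
      (sampled Q k r : ℝ) ≤ (1 + 3 / 4 * ε) * (Q.card / 2 ^ k : ℝ))

theorem exists_scale {s M : ℝ} (hM : 0 < M) (hs : M / 4 ≤ s) :
    ∃ k : ℕ, M / 4 ≤ s / 2 ^ k ∧ s / 2 ^ k < M / 2 := by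
  obtain ⟨k, h1, h2⟩ := exists_nat_pow_near (x := s / (M / 4)) (y := 2)
    ((one_le_div (by positivity)).2 hs) (by norm_num)
  refine ⟨k, ?_, ?_⟩
  · rw [le_div_iff₀ (by positivity)] at h1 ⊢
    linarith
  · rw [div_lt_iff₀ (by positivity)] at h2 ⊢
    rw [pow_succ] at h2
    linarith

theorem sum_eighth_le (m : ℕ) : ∑ i ∈ Finset.range m, (1 / 8 : ℝ) ^ i ≤ 8 / 7 := by
  have h : ∑ i ∈ Finset.range m, (1 / 8 : ℝ) ^ i = 8 / 7 - 8 / 7 * (1 / 8) ^ m := by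
    induction m with
    | zero => simp
    | succ m ih =>
      rw [Finset.sum_range_succ, ih, pow_succ]
      ring
  rw [h]
  have : (0 : ℝ) ≤ (1 / 8) ^ m := by positivity
  linarith

theorem succ_le_two_pow (i : ℕ) : ((i : ℝ) + 1) ≤ 2 ^ i := by
  exact_mod_cast Nat.lt_two_pow_self

/-- Let `k₀` be the coarsest scale that matters, where the mean lies in `[M / 4, M / 2)`. At scale
`k₀ - i` the mean is `2 ^ i` times larger, so with `q = exp (-L)` each tail is at most `q ^ (i +
1)`. The sharper upper bound, needed only for `i ≥ 1`, fails with probability at most `q ^ i`. As `q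
≤ 1 / 8`, the failures form a geometric series of sum at most `(2 + 10 / 7) q`. -/
theorem accurate_prob (Q : Finset (Fin n)) {ε M L : ℝ} (hε : 0 < ε) (hε1 : ε ≤ 1 / 2)
    (hL : Real.log 8 ≤ L) (hM : 4 * (2 + ε) / ε ^ 2 * L ≤ M) :
    (rankLaw n).real {r | ¬ Accurate ε M Q r} ≤ 4 * Real.exp (-L) := by
  have hL0 : 0 < L := (Real.log_pos (by norm_num)).trans_le hL
  have hMpos : 0 < M := lt_of_lt_of_le (by positivity) hM
  set q := Real.exp (-L) with hq
  have hq0 : 0 < q := Real.exp_pos _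
  have hq8 : q ≤ 1 / 8 := by
    have : q ≤ Real.exp (-Real.log 8) := Real.exp_le_exp.2 (neg_le_neg hL)
    rw [Real.exp_neg, Real.exp_log (by norm_num)] at this
    linarith
  have hqpow : ∀ (i : ℕ) (y : ℝ), (i : ℝ) * L ≤ y → Real.exp (-y) ≤ q ^ i := by
    intro i y hy
    rw [hq, ← Real.exp_nat_mul, Real.exp_le_exp]
    linarith
  by_cases hs : (Q.card : ℝ) < M / 4
  · have : {r | ¬ Accurate ε M Q r} = ∅ := by
      refine Set.eq_empty_iff_forall_notMem.2 fun r hr => hr fun k hk => absurd hk (not_le.2 ?_)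
      refine lt_of_le_of_lt (div_le_self (Nat.cast_nonneg _) ?_) hs
      exact one_le_pow₀ (by norm_num)
    rw [this, measureReal_empty]
    positivity
  · obtain ⟨k₀, hk1, hk2⟩ := exists_scale hMpos (not_lt.1 hs)
    have hmono : ∀ k, k₀ < k → (Q.card / 2 ^ k : ℝ) < M / 4 := by
      intro k hk
      have h1 : (2 : ℝ) ^ (k₀ + 1) ≤ 2 ^ k := pow_le_pow_right₀ (by norm_num) hk
      have h2 : (Q.card / 2 ^ k : ℝ) ≤ Q.card / 2 ^ (k₀ + 1) := by gcongr
      rw [pow_succ, ← div_div] at h2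
      linarith
    have hμ : ∀ i ≤ k₀, (2 : ℝ) ^ i * L ≤ (Q.card / 2 ^ (k₀ - i) : ℝ) * (ε ^ 2 / (2 + ε)) := by
      intro i hi
      have h1 : (Q.card / 2 ^ (k₀ - i) : ℝ) = 2 ^ i * (Q.card / 2 ^ k₀) := by
        have : (2 : ℝ) ^ k₀ = 2 ^ (k₀ - i) * 2 ^ i := by rw [← pow_add, Nat.sub_add_cancel hi]
        rw [this]
        field_simp
      have h2 : (2 + ε) / ε ^ 2 * L ≤ Q.card / 2 ^ k₀ := by
        refine le_trans ?_ hk1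
        have : 4 * (2 + ε) / ε ^ 2 * L = 4 * ((2 + ε) / ε ^ 2 * L) := by ring
        linarith
      calc (2 : ℝ) ^ i * L = 2 ^ i * ((2 + ε) / ε ^ 2 * L) * (ε ^ 2 / (2 + ε)) := by field_simp
        _ ≤ 2 ^ i * (Q.card / 2 ^ k₀) * (ε ^ 2 / (2 + ε)) := by gcongr
        _ = _ := by rw [h1]
    set A : ℕ → Set (Fin n → ℕ) := fun i =>
      {r | (sampled Q (k₀ - i) r : ℝ) ≤ (1 - ε) * (Q.card / 2 ^ (k₀ - i) : ℝ)} with hA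
    set B : ℕ → Set (Fin n → ℕ) := fun i =>
      {r | (1 + ε) * (Q.card / 2 ^ (k₀ - i) : ℝ) ≤ sampled Q (k₀ - i) r} with hB
    set C : ℕ → Set (Fin n → ℕ) := fun i =>
      {r | (1 + 3 / 4 * ε) * (Q.card / 2 ^ (k₀ - i) : ℝ) ≤ sampled Q (k₀ - i) r} with hC
    have hAB : ∀ i ≤ k₀, (rankLaw n).real (A i ∪ B i) ≤ 2 * q ^ (i + 1) := by
      intro i hi
      have h0 : ((i + 1 : ℕ) : ℝ) * L ≤ (Q.card / 2 ^ (k₀ - i) : ℝ) * (ε ^ 2 / (2 + ε)) := by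
        refine le_trans ?_ (hμ i hi)
        have := succ_le_two_pow i
        push_cast
        gcongr
      have h1 := (lower_tail Q (k₀ - i) hε.le).trans (hqpow (i + 1) _ (h0.trans (by
        gcongr
        linarith)))
      have h2 := (upper_tail Q (k₀ - i) hε.le).trans (hqpow (i + 1) _ h0)
      exact (measureReal_union_le _ _).trans (by linarith)
    -- Replacing `ε` by `3ε / 4` costs a factor `9 / 16` in the exponent, and `9 / 16 * 2 ^ i ≥ i`
    -- because `2 ^ i ≥ 2 i` for `i ≥ 1`.
    have hCi : ∀ i, 1 ≤ i → i ≤ k₀ → (rankLaw n).real (C i) ≤ q ^ i := by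
      intro i hi1 hi
      refine (upper_tail Q (k₀ - i) (by positivity)).trans (hqpow i _ ?_)
      have h1 := hμ i hi
      have h2 : 9 / 16 * (ε ^ 2 / (2 + ε)) ≤ (3 / 4 * ε) ^ 2 / (2 + 3 / 4 * ε) := by
        rw [mul_pow, mul_div_assoc]
        have : ε ^ 2 / (2 + ε) ≤ ε ^ 2 / (2 + 3 / 4 * ε) := by
          gcongr
          linarith
        norm_num
        linarith
      have h3 : (2 : ℝ) * i ≤ 2 ^ i := by
        obtain ⟨j, rfl⟩ : ∃ j, i = j + 1 := ⟨i - 1, by omega⟩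
        have := succ_le_two_pow j
        rw [pow_succ]
        push_cast
        linarith
      calc (i : ℝ) * L ≤ 9 / 16 * (2 ^ i * L) := by nlinarith
        _ ≤ 9 / 16 * ((Q.card / 2 ^ (k₀ - i) : ℝ) * (ε ^ 2 / (2 + ε))) := by gcongr
        _ = (Q.card / 2 ^ (k₀ - i) : ℝ) * (9 / 16 * (ε ^ 2 / (2 + ε))) := by ring
        _ ≤ _ := by gcongr
    have hsub : {r | ¬ Accurate ε M Q r} ⊆
        (A 0 ∪ B 0) ∪ ⋃ i ∈ Finset.range k₀, ((A (i + 1) ∪ B (i + 1)) ∪ C (i + 1)) := by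
      intro r hr
      by_contra hno
      rw [Set.mem_union, not_or] at hno
      refine hr fun k hk => ?_
      have hkk : k ≤ k₀ := by
        by_contra hlt
        exact absurd hk (not_le.2 (hmono k (not_le.1 hlt)))
      rcases Nat.eq_zero_or_pos (k₀ - k) with h0 | hpos
      · obtain rfl : k = k₀ := by omega
        have h1 := hno.1
        simp only [hA, hB, Set.mem_union, Set.mem_ofPred_eq, not_or, not_le, Nat.sub_zero] at h1
        exact ⟨h1.1.le, h1.2.le, fun h => absurd h (not_le.2 hk2)⟩
      · have h1 := hno.2
        simp only [Set.mem_iUnion, not_exists] at h1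
        have h2 := h1 (k₀ - k - 1) (Finset.mem_range.2 (by omega))
        rw [show k₀ - k - 1 + 1 = k₀ - k by omega] at h2
        simp only [hA, hB, hC, Set.mem_union, Set.mem_ofPred_eq, not_or, not_le] at h2
        rw [show k₀ - (k₀ - k) = k by omega] at h2
        exact ⟨h2.1.1.le, h2.1.2.le, fun _ => h2.2.le⟩
    have hterm : ∀ i ∈ Finset.range k₀,
        (rankLaw n).real ((A (i + 1) ∪ B (i + 1)) ∪ C (i + 1)) ≤ 5 / 4 * q * (1 / 8) ^ i := by
      intro i hi
      have hi' : i + 1 ≤ k₀ := Finset.mem_range.1 hi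
      refine (measureReal_union_le _ _).trans ?_
      have h1 := hAB (i + 1) hi'
      have h2 := hCi (i + 1) (by omega) hi'
      have h3 : q ^ i ≤ (1 / 8) ^ i := by gcongr
      have h4 : 2 * q ^ (i + 1 + 1) + q ^ (i + 1) = (2 * q + 1) * q * q ^ i := by ring
      have h5 : (2 * q + 1) * q ≤ 5 / 4 * q := by nlinarith
      calc _ ≤ (2 * q + 1) * q * q ^ i := by linarith
        _ ≤ 5 / 4 * q * (1 / 8) ^ i := by gcongr
    calc (rankLaw n).real {r | ¬ Accurate ε M Q r}
        ≤ (rankLaw n).real ((A 0 ∪ B 0) ∪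
          ⋃ i ∈ Finset.range k₀, ((A (i + 1) ∪ B (i + 1)) ∪ C (i + 1))) := measureReal_mono hsub
      _ ≤ (rankLaw n).real (A 0 ∪ B 0) + (rankLaw n).real
          (⋃ i ∈ Finset.range k₀, ((A (i + 1) ∪ B (i + 1)) ∪ C (i + 1))) :=
        measureReal_union_le _ _
      _ ≤ 2 * q + ∑ i ∈ Finset.range k₀, 5 / 4 * q * (1 / 8) ^ i := by
        refine add_le_add ?_ ((measureReal_biUnion_finset_le _ _).trans (Finset.sum_le_sum hterm))
        simpa using hAB 0 (Nat.zero_le _)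
      _ ≤ 2 * q + 5 / 4 * q * (8 / 7) := by
        rw [← Finset.mul_sum]
        have := sum_eighth_le k₀
        gcongr
      _ ≤ 4 * q := by linarith

theorem card_filter_le_sampled {B : Finset (Fin n)} {v : Fin n} (r : Fin n → ℕ) (k : ℕ) :
    (B.filter fun x => k ≤ r x).card ≤ sampled (B.erase v) k r + 1 := by
  unfold sampled
  rw [Finset.filter_erase]
  have := Finset.pred_card_le_card_erase (s := B.filter fun x => k ≤ r x) (a := v)
  omega

/-- Accurate samples lead to an accurate estimate. -/
theorem sizeEstimate_accurate {ε M : ℝ} (hε : 0 < ε) (hε1 : ε ≤ 1 / 2) (hM4 : 4 ≤ M)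
    (hMε : 8 / ε ≤ M) {B : Finset (Fin n)} {v : Fin n} {r : Fin n → ℕ}
    (H : Accurate ε M (B.erase v) r) :
    (1 - ε) * ((B.erase v).card : ℝ) ≤ sizeEstimate r M B v ∧
      sizeEstimate r M B v ≤ (1 + ε) * ((B.erase v).card : ℝ) := by
  set Q := B.erase v with hQ
  set N := ⌊M⌋₊ with hN
  set k := threshold r N B with hk
  have hM0 : 0 ≤ M := by linarith
  have hcard : ∀ j, (B.filter fun x => j ≤ r x).card ≤ sampled Q j r + 1 := fun j =>
    card_filter_le_sampled r j
  have hsize : sampleSize r N B v = sampled Q k r := by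
    unfold sampleSize sampled
    rw [hQ, Finset.filter_erase]
  have hthr : ∀ j, ((sampled Q j r : ℝ) + 1 ≤ M) → k ≤ j := by
    intro j hj
    refine threshold_le ((hcard j).trans (Nat.le_floor ?_))
    push_cast
    exact hj
  have hval : sizeEstimate r M B v = estimate M (sampled Q k r) k := by
    rw [← hsize]
    rfl
  have hs0 : (0 : ℝ) ≤ Q.card := Nat.cast_nonneg _
  rw [hval]
  rcases Nat.eq_zero_or_pos k with h0 | hpos
  · have h1 : sampled Q 0 r = Q.card := by simp [sampled]
    rw [h0, h1]
    simp only [estimate, lt_irrefl, if_false, pow_zero, mul_one]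
    constructor <;> nlinarith
  -- At a scale with mean below `M / 2`, the sample together with `v` has at most `(1 + ε) M / 2 + 1
  -- ≤ M` nodes, so the threshold never passes the scales on which accuracy is assumed.
  · have hge : M / 4 ≤ (Q.card / 2 ^ k : ℝ) := by
      by_cases hs : (Q.card : ℝ) < M / 4
      · exfalso
        have h1 : (sampled Q 0 r : ℝ) ≤ Q.card := by
          exact_mod_cast Finset.card_filter_le _ _
        have := hthr 0 (by linarith)
        omega
      · obtain ⟨k₀, g1, g2⟩ := exists_scale (by linarith) (not_lt.1 hs)
        have h1 := (H k₀ g1).2.1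
        have h2 : k ≤ k₀ := hthr k₀ (by nlinarith)
        refine g1.trans ?_
        gcongr
        norm_num
    obtain ⟨j, hj⟩ : ∃ j, k = j + 1 := ⟨k - 1, by omega⟩
    obtain ⟨g1, g2, -⟩ := H k hge
    have hpow : (0 : ℝ) < 2 ^ k := by positivity
    have e1 : (Q.card / 2 ^ k : ℝ) * 2 ^ k = Q.card := by field_simp
    have l1 : (1 - ε) * (Q.card : ℝ) ≤ sampled Q k r * 2 ^ k := by
      have := mul_le_mul_of_nonneg_right g1 hpow.le
      rwa [mul_assoc, e1] at this
    have l2 : (sampled Q k r : ℝ) * 2 ^ k ≤ (1 + ε) * (Q.card : ℝ) := by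
      have := mul_le_mul_of_nonneg_right g2 hpow.le
      rwa [mul_assoc, e1] at this
    unfold estimate
    rw [if_pos hpos]
    refine ⟨l1.trans (le_max_left _ _), max_le l2 ?_⟩
    rw [hj, Nat.add_sub_cancel]
    have hge2 : M / 2 ≤ (Q.card / 2 ^ j : ℝ) := by
      rw [hj, pow_succ, ← div_div] at hge
      linarith
    have g3 := (H j (by linarith)).2.2 hge2
    -- Minimality of the threshold: at `k - 1` the sample overflows, where the `1` accounts for `v`
    -- itself.
    have g4 : M < sampled Q j r + 1 := by
      by_contra hlt
      have := hthr j (not_lt.1 hlt)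
      omega
    have hpj : (0 : ℝ) < 2 ^ j := by positivity
    have e2 : (Q.card / 2 ^ j : ℝ) * 2 ^ j = Q.card := by field_simp
    -- The quarter of `ε` spared by the sharper bound in `Accurate` absorbs the node `v`, as the
    -- mean at `k - 1` is at least `M / 2 ≥ 4 / ε`.
    have h5 : 1 ≤ ε / 4 * (Q.card / 2 ^ j : ℝ) := by
      have h6 : 4 / ε ≤ (Q.card / 2 ^ j : ℝ) := by
        refine le_trans ?_ hge2
        have : 8 / ε = 2 * (4 / ε) := by ring
        linarith
      rw [div_le_iff₀ hε] at h6
      linarith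
    have h7 : M ≤ (1 + ε) * (Q.card / 2 ^ j : ℝ) := by linarith
    have h8 := mul_le_mul_of_nonneg_right h7 hpj.le
    rwa [mul_assoc, e2] at h8

/-- At the scale where the mean lies in `[M / 4, M / 2)`, the upper side leaves at most `3 M / 4`
sampled nodes, and the lower side is the claimed bound for `2 ^ k`. -/
theorem exists_threshold {ε M : ℝ} (hε1 : ε ≤ 1 / 2) (hM4 : 4 ≤ M) {r : Fin n → ℕ}
    (H : Accurate ε M Finset.univ r) : ∃ k : ℕ,
      (Finset.univ.filter fun x => k ≤ r x).card ≤ ⌊M⌋₊ ∧ (k = 0 ∨ 2 ^ k * M ≤ 4 * n) := by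
  have hcard : ((Finset.univ : Finset (Fin n)).card : ℝ) = n := by simp
  by_cases hs : (n : ℝ) < M / 4
  · refine ⟨0, Nat.le_floor ?_, Or.inl rfl⟩
    have : ((Finset.univ.filter fun x => 0 ≤ r x).card : ℝ) ≤ n := by
      rw [← hcard]
      exact_mod_cast Finset.card_filter_le _ _
    linarith
  · obtain ⟨k, g1, g2⟩ := exists_scale (by linarith) (not_lt.1 hs)
    rw [← hcard] at g1 g2
    refine ⟨k, Nat.le_floor ?_, Or.inr ?_⟩
    · have h1 := (H k g1).2.1
      change (sampled Finset.univ k r : ℝ) ≤ M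
      nlinarith
    · rw [hcard, le_div_iff₀ (by positivity)] at g1
      linarith

end KHCore

namespace KHCore

variable {n : ℕ}

open MeasureTheory ProbabilityTheory

/-! ## The main result -/

/-- The event that the output is correct and that the running time is small. -/
theorem core_spec (G : SimpleGraph (Fin n)) [DecidableRel G.Adj] {h : ℕ} {ε M L δ : ℝ}
    (hn : 1 ≤ n) (hh : 1 ≤ h) (hε : 0 < ε) (hε1 : ε ≤ 1 / 2) (hL : Real.log 8 ≤ L)
    (hM : 4 * (2 + ε) / ε ^ 2 * L ≤ M) (hM4 : 4 ≤ M) (hMε : 8 / ε ≤ M)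
    (hδ : Real.exp (-L) = δ / (16 * n)) {k₁ : ℕ} (hk₁ : 4 * n ≤ 2 ^ k₁ * δ) :
    (rankLaw n).real {r | ¬ (IsApproxCoreMap G h ε (run G h M r).val ∧
      ∃ k : ℕ, (k = 0 ∨ 2 ^ k * M ≤ 4 * n) ∧ (run G h M r).steps ≤ n * k₁ +
        120 * (h * (n + 2 * G.edgeFinset.card) * ((⌊M⌋₊ + 1) * (k + 1))))} ≤ δ := by
  obtain ⟨K, T, hKT⟩ := exists_approx_of_accurate G h
  set μ := rankLaw n with hμ
  have hn0 : (1 : ℝ) ≤ n := by exact_mod_cast hn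
  have hM0 : 0 ≤ M := by linarith
  have hδ0 : 0 < δ := by
    have h1 := Real.exp_pos (-L)
    rw [hδ] at h1
    exact (div_pos_iff_of_pos_right (by positivity)).1 h1
  -- The bad events are inaccuracy on a core `K u`, on a peeling set `T u`, and on all nodes (needed
  -- only for the running time), and a rank that is too expensive to sample. Each has probability at
  -- most `δ / 4`.
  set E₁ := ⋃ u ∈ (Finset.univ : Finset (Fin n)),
    {r | ¬ Accurate ε M ((ball G (K u) h u).erase u) r} with hE₁
  set E₂ := ⋃ u ∈ (Finset.univ : Finset (Fin n)),
    {r | ¬ Accurate ε M ((ball G (T u) h u).erase u) r} with hE₂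
  set E₃ := {r | ¬ Accurate ε M (Finset.univ : Finset (Fin n)) r} with hE₃
  set E₄ := ⋃ u ∈ (Finset.univ : Finset (Fin n)), {r : Fin n → ℕ | k₁ ≤ r u} with hE₄
  have hsub : {r | ¬ (IsApproxCoreMap G h ε (run G h M r).val ∧
      ∃ k : ℕ, (k = 0 ∨ 2 ^ k * M ≤ 4 * n) ∧ (run G h M r).steps ≤ n * k₁ +
        120 * (h * (n + 2 * G.edgeFinset.card) * ((⌊M⌋₊ + 1) * (k + 1))))} ⊆
      (E₁ ∪ E₂) ∪ (E₃ ∪ E₄) := by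
    intro r hr
    by_contra hno
    simp only [hE₁, hE₂, hE₃, hE₄, Set.mem_union, Set.mem_iUnion, Finset.mem_univ,
      Set.mem_ofPred_eq, not_or, not_exists, not_not, not_le, forall_const] at hno
    obtain ⟨⟨f1, f2⟩, f3, f4⟩ := hno
    obtain ⟨k, g1, g2⟩ := exists_threshold hε1 hM4 f3
    obtain ⟨d1, d2⟩ := run_spec G hM0 (Nat.le_floor (by push_cast; linarith)) hh hn g1
    refine hr ⟨hKT (nodeEstimate G r M h) ε hε.le (by linarith)
      (fun S S' v hSS => sizeEstimate_mono hM0 (ball_mono G hSS h v) v)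
      (fun u => (sizeEstimate_accurate hε hε1 hM4 hMε (f1 u)).1)
      (fun u => (sizeEstimate_accurate hε hε1 hM4 hMε (f2 u)).2) _ d1, k, g2, d2.trans ?_⟩
    have : ∑ v, (r v + 1) ≤ n * k₁ := by
      simpa using Finset.sum_le_card_nsmul Finset.univ (fun v => r v + 1) k₁ fun v _ => f4 v
    omega
  -- `4 * exp (-L) = δ / (4 n)`: this is the purpose of `log 8` and of the factor `2` in `C`.
  have hacc : ∀ Q : Finset (Fin n), μ.real {r | ¬ Accurate ε M Q r} ≤ δ / (4 * n) := by
    intro Q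
    have := accurate_prob Q hε hε1 hL hM
    rw [hδ] at this
    refine this.trans (le_of_eq ?_)
    field_simp
    norm_num
  have hsum : ∀ Q : Fin n → Finset (Fin n),
      μ.real (⋃ u ∈ (Finset.univ : Finset (Fin n)), {r | ¬ Accurate ε M (Q u) r}) ≤ δ / 4 := by
    intro Q
    refine (measureReal_biUnion_finset_le _ _).trans ?_
    refine (Finset.sum_le_card_nsmul _ _ _ fun u _ => hacc (Q u)).trans (le_of_eq ?_)
    rw [Finset.card_univ, Fintype.card_fin, nsmul_eq_mul]
    field_simp
  have h3 : μ.real E₃ ≤ δ / 4 := by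
    refine (hacc _).trans ?_
    gcongr
    linarith
  have h4 : μ.real E₄ ≤ δ / 4 := by
    refine (measureReal_biUnion_finset_le _ _).trans ?_
    refine (Finset.sum_le_card_nsmul _ _ _ fun u _ => (rank_tail u k₁).le).trans ?_
    rw [Finset.card_univ, Fintype.card_fin, nsmul_eq_mul, one_div_pow, mul_one_div,
      div_le_div_iff₀ (by positivity) (by norm_num)]
    linarith
  calc _ ≤ μ.real ((E₁ ∪ E₂) ∪ (E₃ ∪ E₄)) := measureReal_mono hsub
    _ ≤ (μ.real E₁ + μ.real E₂) + (μ.real E₃ + μ.real E₄) :=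
      (measureReal_union_le _ _).trans
        (add_le_add (measureReal_union_le _ _) (measureReal_union_le _ _))
    _ ≤ δ := by
      have h1 : μ.real E₁ ≤ δ / 4 := hsum _
      have h2 : μ.real E₂ ≤ δ / 4 := hsum _
      linarith

/-! ### Comparison of the bounds with `timeBound` -/

theorem le_two_mul_max {n k : ℕ} {ε M Λ : ℝ} (hε : 0 < ε) (hΛ : 0 < Λ)
    (hM : 8 / ε ^ 2 * Λ ≤ M) (hk : k = 0 ∨ 2 ^ k * M ≤ 4 * n) :
    (k : ℝ) + 1 ≤ 2 * max 1 (Real.log (n * ε ^ 2 / Λ)) := by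
  have hmax : (1 : ℝ) ≤ max 1 (Real.log (n * ε ^ 2 / Λ)) := le_max_left _ _
  rcases hk with rfl | hk
  · push_cast
    linarith
  · have hlog2 := Real.log_two_gt_d9
    -- The factor `8` in the bound for `M` against the `4` in `hk` leaves room for `k + 1` instead
    -- of `k`. The final factor `2` exceeds `1 / log 2`.
    have h1 : (2 : ℝ) ^ (k + 1) ≤ n * ε ^ 2 / Λ := by
      rw [le_div_iff₀ hΛ]
      have h2 : (2 : ℝ) ^ k * (8 / ε ^ 2 * Λ) ≤ 4 * n := le_trans (by gcongr) hk
      have h3 := mul_le_mul_of_nonneg_right h2 (by positivity : 0 ≤ ε ^ 2 / 4)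
      have h4 : (2 : ℝ) ^ k * (8 / ε ^ 2 * Λ) * (ε ^ 2 / 4) = 2 ^ (k + 1) * Λ := by
        rw [pow_succ]
        field_simp
        ring
      rw [h4] at h3
      linarith
    have h2 := Real.log_le_log (by positivity) h1
    rw [Real.log_pow] at h2
    push_cast at h2
    have h3 : Real.log (n * ε ^ 2 / Λ) ≤ max 1 (Real.log (n * ε ^ 2 / Λ)) := le_max_right _ _
    nlinarith

/-- `n ≤ 2m` removes `n`, and `Λ ≥ log 2` absorbs additive constants: `L ≤ 5Λ`, `k + 1 ≤ 6Λ` and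
`⌊M⌋ + 1 ≤ 51Λ / ε²`. The total constant is `3 + 120 * 4 * 51 * 2 = 48963`. -/
theorem steps_le_timeBound {n m h k j : ℕ} {s ε δ L M : ℝ} (hh : 1 ≤ h) (hnm : n ≤ 2 * m)
    (hn : 1 ≤ n) (hε : 0 < ε) (hε1 : ε ≤ 1 / 2) (hδ : 0 < δ) (hΛ2 : Real.log 2 ≤ Real.log (n / δ))
    (hL : L = 4 * Real.log 2 + Real.log (n / δ)) (hM : M = 1 + 4 * (2 + ε) / ε ^ 2 * L)
    (hk : 2 ^ k ≤ 4 * n / δ) (hj : j = 0 ∨ 2 ^ j * M ≤ 4 * n)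
    (hs : s ≤ n * ((k + 1 : ℕ) : ℝ) + 120 * (h * (n + 2 * m) * ((⌊M⌋₊ + 1) * (j + 1)))) :
    s ≤ 50000 * timeBound n m h ε δ := by
  have hlog2 := Real.log_two_gt_d9
  have hn0 : (1 : ℝ) ≤ n := by exact_mod_cast hn
  have hm0 : (0 : ℝ) ≤ m := Nat.cast_nonneg _
  have hnm' : (n : ℝ) ≤ 2 * m := by exact_mod_cast hnm
  have hh' : (1 : ℝ) ≤ h := by exact_mod_cast hh
  have hkΛ : ((k + 1 : ℕ) : ℝ) ≤ 6 * Real.log (n / δ) := by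
    have h1 := Real.log_le_log (by positivity) hk
    rw [Real.log_pow, mul_div_assoc, Real.log_mul (by norm_num) (by positivity),
      show (4 : ℝ) = 2 ^ 2 by norm_num, Real.log_pow] at h1
    push_cast at h1 ⊢
    nlinarith
  unfold timeBound
  set Λ := Real.log (n / δ) with hΛ
  have hΛpos : 0 < Λ := by linarith
  have hε2 : ε ^ 2 ≤ 1 / 4 := by nlinarith
  have hM8 : 8 / ε ^ 2 * Λ ≤ M := by
    have h1 : 8 / ε ^ 2 * Λ ≤ 4 * (2 + ε) / ε ^ 2 * L := by
      gcongr <;> linarith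
    linarith
  have hM0 : 0 ≤ M := le_trans (by positivity) hM8
  have hmax := le_two_mul_max (n := n) (k := j) (M := M) hε hΛpos hM8 hj
  set X := max 1 (Real.log (n * ε ^ 2 / Λ)) with hX
  have hX1 : 1 ≤ X := le_max_left _ _
  have hΛε : 4 * Λ ≤ Λ / ε ^ 2 := by
    rw [le_div_iff₀ (by positivity)]
    nlinarith
  have hN : ((⌊M⌋₊ : ℝ) + 1) ≤ 51 * (Λ / ε ^ 2) := by
    have h1 := Nat.floor_le hM0
    have h2 : 4 * (2 + ε) / ε ^ 2 * L ≤ 10 / ε ^ 2 * (5 * Λ) := by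
      gcongr <;> linarith
    have h3 : 10 / ε ^ 2 * (5 * Λ) = 50 * (Λ / ε ^ 2) := by ring
    linarith
  have hY : 0 ≤ Λ / ε ^ 2 := by positivity
  have a1 : (n : ℝ) * ((k + 1 : ℕ) : ℝ) ≤ 2 * m * (6 * Λ) := by gcongr
  have a2 : 2 * m * (6 * Λ) ≤ 3 * (h * m * (Λ / ε ^ 2) * X) := by
    have b1 : (m : ℝ) * (4 * Λ) ≤ m * (Λ / ε ^ 2) := by gcongr
    have b2 : (m : ℝ) * (Λ / ε ^ 2) ≤ h * (m * (Λ / ε ^ 2)) :=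
      le_mul_of_one_le_left (by positivity) hh'
    have b3 : h * (m * (Λ / ε ^ 2)) ≤ h * (m * (Λ / ε ^ 2)) * X :=
      le_mul_of_one_le_right (by positivity) hX1
    linarith
  have a3 : 120 * (h * (n + 2 * m) * (((⌊M⌋₊ : ℝ) + 1) * (j + 1))) ≤
      120 * (h * (2 * m + 2 * m) * (51 * (Λ / ε ^ 2) * (2 * X))) := by gcongr
  have a4 : h * m * Λ / ε ^ 2 * X = h * m * (Λ / ε ^ 2) * X := by ring
  rw [a4]
  have a5 : 0 ≤ h * m * (Λ / ε ^ 2) * X := by positivity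
  linarith

theorem core_bound (G : SimpleGraph (Fin n)) [DecidableRel G.Adj] {h : ℕ} {ε δ : ℝ}
    (hn : 1 ≤ n) (hh : 1 ≤ h) (hε : 0 < ε) (hε1 : ε ≤ 1 / 2) (hδ : 0 < δ) (hδ1 : δ < 1) :
    (rankLaw n).real {r | ¬ (IsApproxCoreMap G h ε (core G h ε (Real.log (2 * n / δ)) r).val ∧
      (n ≤ 2 * G.edgeFinset.card → ((core G h ε (Real.log (2 * n / δ)) r).steps : ℝ) ≤
        50000 * timeBound n G.edgeFinset.card h ε δ))} ≤ δ := by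
  have hn0 : (1 : ℝ) ≤ n := by exact_mod_cast hn
  set L := Real.log (2 * n / δ) + Real.log 8 with hL
  set M := bufferBound ε (Real.log (2 * n / δ)) with hM
  have hM' : M = 1 + 4 * (2 + ε) / ε ^ 2 * L := rfl
  have hlog2 := Real.log_two_gt_d9
  have hlog8 : Real.log 8 = 3 * Real.log 2 := by
    rw [show (8 : ℝ) = 2 ^ 3 by norm_num, Real.log_pow]
    norm_num
  have hLL : Real.log (2 * n / δ) = Real.log 2 + Real.log (n / δ) := by
    rw [mul_div_assoc, Real.log_mul (by norm_num) (by positivity)]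
  have hΛ0 : 0 ≤ Real.log (n / δ) := Real.log_nonneg (by
    rw [le_div_iff₀ hδ]
    linarith)
  have hL2 : 2 ≤ L := by linarith
  have hexp : Real.exp (-L) = δ / (16 * n) := by
    rw [hL, Real.exp_neg, Real.exp_add, Real.exp_log (by positivity), Real.exp_log (by norm_num)]
    field_simp
    norm_num
  have hinv : 1 / ε ≤ 1 / ε ^ 2 := by
    rw [div_le_div_iff₀ hε (by positivity)]
    nlinarith
  have hinv2 : 2 ≤ 1 / ε := by
    rw [le_div_iff₀ hε]
    linarith
  have hML : 8 / ε ^ 2 * L ≤ 4 * (2 + ε) / ε ^ 2 * L := by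
    gcongr
    linarith
  have h16 : 16 * (1 / ε ^ 2) ≤ 8 / ε ^ 2 * L := by
    have : 16 * (1 / ε ^ 2) = 8 / ε ^ 2 * 2 := by ring
    rw [this]
    gcongr
  have hM4 : 4 ≤ M := by linarith
  have hMε : 8 / ε ≤ M := by
    have : 8 / ε = 8 * (1 / ε) := by ring
    linarith
  have hMle : 4 * (2 + ε) / ε ^ 2 * L ≤ M := by linarith
  -- The ranks are cut off at `k + 1`, the first exponent with `2 ^ (k + 1) > 4 n / δ`; the lower
  -- estimate `2 ^ k ≤ 4 n / δ` keeps the number of coin flips per node logarithmic.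
  obtain ⟨k, hk1, hk2⟩ := exists_nat_pow_near (x := 4 * n / δ) (y := 2)
    ((one_le_div hδ).2 (by linarith)) (by norm_num)
  refine le_trans (measureReal_mono ?_) (core_spec G (k₁ := k + 1) hn hh hε hε1
    (by linarith : Real.log 8 ≤ L) hMle hM4 hMε hexp ((div_lt_iff₀ hδ).1 hk2).le)
  refine fun r hr hgood => hr ?_
  obtain ⟨hout, j, hj, hsteps⟩ := hgood
  refine ⟨hout, fun hnm => ?_⟩
  set m := G.edgeFinset.card with hm
  -- A single node has no edges, which contradicts `n ≤ 2m`. With `δ < 1` this gives `n / δ ≥ 2`, so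
  -- the first logarithm is bounded away from `0`.
  have hn2 : 2 ≤ n := by
    by_contra hlt
    obtain rfl : n = 1 := by omega
    have : m ≤ _ := G.card_edgeFinset_le_card_choose_two
    rw [Fintype.card_fin] at this
    simp at this
    omega
  have hΛ2 : Real.log 2 ≤ Real.log (n / δ) := by
    refine Real.log_le_log (by norm_num) ?_
    rw [le_div_iff₀ hδ]
    have : (2 : ℝ) ≤ n := by exact_mod_cast hn2
    linarith
  change ((run G h M r).steps : ℝ) ≤ _
  refine steps_le_timeBound hh hnm hn hε hε1 hδ hΛ2 (by linarith) hM' hk1 hj ?_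
  exact_mod_cast hsteps

theorem timeBound_le {a : ℝ} (ha : 0 < a) {n m h : ℕ} {ε δ : ℝ} (hn : 1 ≤ n) (hε : 0 < ε)
    (hε1 : ε ≤ 1 / 2) (hδ : (n : ℝ) ^ (-a) ≤ δ) (hδ1 : δ ≤ 1) :
    timeBound n m h ε δ ≤
      (2 + 2 * a) * (1 / ε ^ 2 * h * m * ((Real.log n) ^ 2 - Real.log δ)) := by
  have hn0 : (1 : ℝ) ≤ n := by exact_mod_cast hn
  have hδ0 : 0 < δ := lt_of_lt_of_le (by positivity) hδ
  have hlogδ : Real.log δ ≤ 0 := Real.log_nonpos hδ0.le hδ1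
  have hlogδ' : -a * Real.log n ≤ Real.log δ := by
    rw [← Real.log_rpow (by positivity)]
    exact Real.log_le_log (by positivity) hδ
  have hlogn : 0 ≤ Real.log n := Real.log_nonneg hn0
  have hΛ : Real.log (n / δ) = Real.log n - Real.log δ :=
    Real.log_div (by positivity) hδ0.ne'
  unfold timeBound
  suffices H : Real.log (n / δ) * max 1 (Real.log (n * ε ^ 2 / Real.log (n / δ))) ≤
      (2 + 2 * a) * ((Real.log n) ^ 2 - Real.log δ) by
    calc _ = (1 / ε ^ 2 * h * m) *
          (Real.log (n / δ) * max 1 (Real.log (n * ε ^ 2 / Real.log (n / δ)))) := by ring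
      _ ≤ (1 / ε ^ 2 * h * m) * ((2 + 2 * a) * ((Real.log n) ^ 2 - Real.log δ)) := by gcongr
      _ = _ := by ring
  -- For `n = 1` the constraints force `δ = 1`, and both sides vanish.
  rcases hn.eq_or_lt with rfl | hn2
  · have : Real.log δ = 0 := by
      simp only [Nat.cast_one, Real.log_one, mul_zero] at hlogδ'
      linarith
    rw [hΛ, this]
    simp
  · have hlog2 := Real.log_two_gt_d9
    have h2 : Real.log 2 ≤ Real.log n :=
      Real.log_le_log (by norm_num) (by exact_mod_cast hn2)
    -- `ε² ≤ 1 / 4` is below `log 2 ≤ log (n / δ)`, so the inner logarithm is at most `log n`; the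
    -- value `1` is covered by `2 log 2 > 1`.
    have hX : max 1 (Real.log (n * ε ^ 2 / Real.log (n / δ))) ≤ 2 * Real.log n := by
      refine max_le (by linarith) ?_
      have hpos : 0 < Real.log (n / δ) := by linarith
      have : n * ε ^ 2 / Real.log (n / δ) ≤ n := by
        rw [div_le_iff₀ hpos]
        have : ε ^ 2 ≤ Real.log (n / δ) := by nlinarith
        gcongr
      have := Real.log_le_log (by positivity) this
      linarith
    calc Real.log (n / δ) * max 1 (Real.log (n * ε ^ 2 / Real.log (n / δ)))
        ≤ Real.log (n / δ) * (2 * Real.log n) := by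
          gcongr
          linarith
      _ = 2 * (Real.log n) ^ 2 + 2 * (-Real.log δ) * Real.log n := by
          rw [hΛ]
          ring
      _ ≤ 2 * (Real.log n) ^ 2 + 2 * (a * Real.log n) * Real.log n := by
          gcongr
          linarith
      _ ≤ _ := by nlinarith

end KHCore

theorem corollary1 :
    (∃ K : ℝ, ∀ (n : ℕ) (G : SimpleGraph (Fin n)) [DecidableRel G.Adj] (h : ℕ) (ε δ : ℝ),
      1 ≤ n → 1 ≤ h → 0 < ε → ε ≤ 1 / 2 → 0 < δ →
      ENNReal.ofReal (1 - δ) ≤ KHCore.rankLaw n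
        {r | KHCore.IsApproxCoreMap G h ε (KHCore.core G h ε (Real.log (2 * n / δ)) r).val ∧
          (n ≤ 2 * G.edgeFinset.card →
            ((KHCore.core G h ε (Real.log (2 * n / δ)) r).steps : ℝ)
              ≤ K * KHCore.timeBound n G.edgeFinset.card h ε δ)}) ∧
    (∀ a : ℝ, 0 < a → ∃ K : ℝ, ∀ (n m h : ℕ) (ε δ : ℝ),
      1 ≤ n → 0 < ε → ε ≤ 1 / 2 → (n : ℝ) ^ (-a) ≤ δ → δ ≤ 1 →
      KHCore.timeBound n m h ε δ
        ≤ K * (1 / ε ^ 2 * h * m * ((Real.log n) ^ 2 - Real.log δ))) := by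
  refine ⟨⟨50000, fun n G _ h ε δ hn hh hε hε1 hδ => ?_⟩,
    fun a ha => ⟨2 + 2 * a, fun n m h ε δ hn hε hε1 hδ hδ1 =>
      KHCore.timeBound_le ha hn hε hε1 hδ hδ1⟩⟩
  -- For `δ ≥ 1` the claimed probability is not positive.
  by_cases hδ1 : 1 ≤ δ
  · rw [ENNReal.ofReal_of_nonpos (by linarith)]
    exact zero_le
  · have h1 := KHCore.core_bound G hn hh hε hε1 hδ (not_le.1 hδ1)
    set S := {r | KHCore.IsApproxCoreMap G h ε (KHCore.core G h ε (Real.log (2 * n / δ)) r).val ∧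
      (n ≤ 2 * G.edgeFinset.card → ((KHCore.core G h ε (Real.log (2 * n / δ)) r).steps : ℝ)
        ≤ 50000 * KHCore.timeBound n G.edgeFinset.card h ε δ)} with hS
    -- Subadditivity is enough to pass to the complement, so measurability of the event plays no
    -- role.
    have h2 : (1 : ℝ) ≤ (KHCore.rankLaw n).real S + (KHCore.rankLaw n).real Sᶜ := by
      have := MeasureTheory.measureReal_union_le (μ := KHCore.rankLaw n) S Sᶜ
      rwa [Set.union_compl_self, MeasureTheory.probReal_univ] at this
    have h3 : (KHCore.rankLaw n).real Sᶜ ≤ δ := h1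
    refine ENNReal.ofReal_le_of_le_toReal ?_
    change 1 - δ ≤ (KHCore.rankLaw n).real S
    linarith
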